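/- Let $\mathcal N(\mu,\Sigma)$ denote the Gaussian law on $\mathbb R^d$. Let $P_0,P_1$ be probability measures on $\mathbb R^m$, let $\mu_i:\mathbb R^m\to\mathbb R^d$ and $\Sigma_i:\mathbb R^m\to\mathbb R^{d\times d}$ be Borel maps with $\Sigma_i(w)$ symmetric positive definite for $P_i$-almost every $w$, and let $\bar\rho_i=\int_{\mathbb R^m}\mathcal N(\mu_i(w),\Sigma_i(w))\,dP_i(w)$ ($i=0,1$). For probability laws $\nu_0,\nu_1$ on $\mathbb R^d$, a Borel feedback policy $u:[0,1]\times\mathbb R^d\to\mathbb R^d$ is called feasible from $\nu_0$ to $\nu_1$, with flow $(\rho_t)_{t\in[0,1]}$, if there is a process $(x_t)_{t\in[0,1]}$ with $dx_t=u_t(x_t)\,dt$ (that is, almost surely $s\mapsto u_s(x_s)$ is integrable on $[0,1]$ and $x_t=x_0+\int_0^t u_s(x_s)\,ds$ for all $t\in[0,1]$) and $x_t\sim\rho_t$ for all $t\in[0,1]$, if $\rho_0=\nu_0$ and $\rho_1=\nu_1$, and if its energy $\int_0^1\int\|u_t\|^2\,d\rho_t\,dt$ is finite. It solves the bridge problem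 from $\nu_0$ to $\nu_1$ if moreover its energy is minimal among all feasible policies and flows. Let $\Lambda$ be any coupling of $P_0$ and $P_1$. For $\Lambda$-almost every $(w_0,w_1)$ let $u_{t|w_0,w_1}$ be a policy that solves the bridge problem from $\mathcal N(\mu_0(w_0),\Sigma_0(w_0))$ to $\mathcal N(\mu_1(w_1),\Sigma_1(w_1))$, let $\rho_{t|w_0,w_1}(x)$ be the density of the resulting flow (both jointly Borel in $(t,w_0,w_1,x)$), and let $J(w_0,w_1)$ be its energy. Put $$\rho_t(x)=\int\rho_{t|w_0,w_1}(x)\,d\Lambda(w_0,w_1),\qquad u_t(x)=\int u_{t|w_0,w_1}(x)\,\frac{\rho_{t|w_0,w_1}(x)}{\rho_t(x)}\,d\Lambda(w_0,w_1).$$ Then: 1. For every $t\in[0,1]$ the integral defining $\rho_t(x)$ converges for almost every $x$, and for almost every $(t,x)\in[0,1]\times\mathbb R^d$ the integral $\int\rho_{t|w_0,w_1}(x)\,u_{t|w_0,w_1}(x)\,d\Lambda(w_0,w_1)$ converges absolutely. 2. For every $t\in[0,1]$, $\rho_t$ is a probability density; $\rho_0$ and $\rho_1$ are the densities of $\bar\rho_0$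 and $\bar\rho_1$. 3. $\rho_tu_t$ is locally integrable on $[0,1]\times\mathbb R^d$, and $(\rho_t,u_t)$ satisfies the Fokker–Planck–Kolmogorov equation $\partial_t\rho_t+\nabla\cdot(\rho_tu_t)=0$ on $[0,1]\times\mathbb R^d$ in the sense of distributions, that is, $\int\psi\,\rho_t\,dx-\int\psi\,\rho_0\,dx=\int_0^t\int\langle\nabla\psi,u_s\rangle\,\rho_s\,dx\,ds$ for all $\psi\in C_c^\infty(\mathbb R^d)$ and $t\in[0,1]$. 4. If $\int J\,d\Lambda<\infty$, then $u_t$ is a feasible policy from $\bar\rho_0$ to $\bar\rho_1$, with flow $\rho_t$. -/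

import Mathlib

open MeasureTheory ProbabilityTheory Set
open scoped ENNReal NNReal ContDiff

noncomputable section

namespace GMMBridge

/-- The state space `ℝᵈ` (also used for the parameter space `ℝᵐ`), with its Euclidean norm. -/
abbrev E (d : ℕ) := EuclideanSpace ℝ (Fin d)

/-- The feedback policy `u` produces the flow of marginal laws `ρ`: on some probability space there
is a process `X` on `[0, 1]`, almost all of whose paths satisfy `dX_t = u_t(X_t) dt`
(that is, `X_t = X_0 + ∫_0^t u_s(X_s) ds` with an integrable integrand), such that
`X_t` has law `ρ_t` for every `t ∈ [0, 1]`. -/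
def Produces {d : ℕ} (u : ℝ → E d → E d) (ρ : ℝ → Measure (E d)) : Prop :=
  ∃ (Ω : Type) (_ : MeasurableSpace Ω) (Q : Measure Ω) (X : ℝ → Ω → E d),
    IsProbabilityMeasure Q ∧
    (∀ t ∈ Icc (0 : ℝ) 1, Measurable (X t)) ∧
    (∀ᵐ o ∂Q, IntervalIntegrable (fun s => u s (X s o)) volume 0 1 ∧
      ∀ t ∈ Icc (0 : ℝ) 1, X t o = X 0 o + ∫ s in (0 : ℝ)..t, u s (X s o)) ∧
    (∀ t ∈ Icc (0 : ℝ) 1, Measure.map (X t) Q = ρ t)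

/-- The control cost `∫_0^1 E_{x ∼ ρ_t} ‖u_t(x)‖² dt`. -/
def energy {d : ℕ} (u : ℝ → E d → E d) (ρ : ℝ → Measure (E d)) : ℝ≥0∞ :=
  ∫⁻ t in Icc (0 : ℝ) 1, ∫⁻ x, ‖u t x‖ₑ ^ 2 ∂(ρ t)

/-- `u` is a feasible policy, with flow `ρ`, for steering `ν₀` to `ν₁` in unit time with the
dynamics `dx = u dt`: it is a Borel feedback policy of finite energy that produces the flow `ρ`,
and `ρ` has the prescribed boundary laws. -/
structure IsFeasible {d : ℕ} (ν₀ ν₁ : Measure (E d)) (u : ℝ → E d → E d)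
    (ρ : ℝ → Measure (E d)) : Prop where
  measurable : Measurable (Function.uncurry u)
  produces : Produces u ρ
  initial : ρ 0 = ν₀
  terminal : ρ 1 = ν₁
  finite_energy : energy u ρ < ⊤

/-- `u`, with flow `ρ`, solves the minimum energy problem of steering `ν₀` to `ν₁`. -/
def SolvesBridge {d : ℕ} (ν₀ ν₁ : Measure (E d)) (u : ℝ → E d → E d)
    (ρ : ℝ → Measure (E d)) : Prop :=
  IsFeasible ν₀ ν₁ u ρ ∧
    ∀ (u' : ℝ → E d → E d) (ρ' : ℝ → Measure (E d)),
      IsFeasible ν₀ ν₁ u' ρ' → energy u ρ ≤ energy u' ρ'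

/-- The noise-free Fokker-Planck-Kolmogorov (continuity) equation
`∂ρ_t/∂t + ∇ ⬝ (ρ_t u_t) = 0` on `[0, 1] × ℝᵈ`, in the sense of distributions, with
`ρ_t u_t` locally integrable. -/
def SolvesContinuityEquation {d : ℕ} (u : ℝ → E d → E d) (ρ : ℝ → Measure (E d)) : Prop :=
  (∀ R : ℝ, ∫⁻ t in Icc (0 : ℝ) 1, ∫⁻ x in Metric.closedBall 0 R, ‖u t x‖ₑ ∂(ρ t) < ⊤) ∧
  ∀ ψ : E d → ℝ, ContDiff ℝ ∞ ψ → HasCompactSupport ψ → ∀ t ∈ Icc (0 : ℝ) 1,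
    ∫ x, ψ x ∂(ρ t) - ∫ x, ψ x ∂(ρ 0) =
      ∫ s in (0 : ℝ)..t, ∫ x, fderiv ℝ ψ x (u s x) ∂(ρ s)

/-- The continuous Gaussian mixture `∫ N(μ(w), S(w)) dP(w)`. -/
def gaussianMixture {d m : ℕ} (P : Measure (E m)) (μ : E m → E d)
    (S : E m → Matrix (Fin d) (Fin d) ℝ) : Measure (E d) :=
  P.bind fun w => multivariateGaussian (μ w) (S w)

/-- The law on `ℝᵈ` with density `r`. -/
def densityLaw {d : ℕ} (r : E d → ℝ≥0) : Measure (E d) :=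
  volume.withDensity fun x => (r x : ℝ≥0∞)

/-- The mixture density `ρ_t(x) = ∫ ρ_{t|w₀,w₁}(x) dΛ(w₀,w₁)`. -/
def mixDensity {d m : ℕ} (Λ : Measure (E m × E m)) (r : ℝ → E m → E m → E d → ℝ≥0)
    (t : ℝ) (x : E d) : ℝ :=
  ∫ w, (r t w.1 w.2 x : ℝ) ∂Λ

/-- The flow of laws whose densities are the mixture densities. -/
def mixFlow {d m : ℕ} (Λ : Measure (E m × E m)) (r : ℝ → E m → E m → E d → ℝ≥0)
    (t : ℝ) : Measure (E d) :=
  volume.withDensity fun x => ENNReal.ofReal (mixDensity Λ r t x)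

/-- The mixture policy
`u_t(x) = ∫ u_{t|w₀,w₁}(x) (ρ_{t|w₀,w₁}(x) / ∫ ρ_{t|w₀,w₁}(x) dΛ) dΛ(w₀,w₁)`. -/
def mixPolicy {d m : ℕ} (Λ : Measure (E m × E m)) (r : ℝ → E m → E m → E d → ℝ≥0)
    (u : ℝ → E m → E m → E d → E d) (t : ℝ) (x : E d) : E d :=
  ∫ w, ((r t w.1 w.2 x : ℝ) / mixDensity Λ r t x) • u t w.1 w.2 x ∂Λ

end GMMBridge

end

open GMMBridge

noncomputable section

namespace GMMBridge

open Filter Topology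

/-! Everything is reduced to random straight lines: a law γ on pairs (starting point, velocity),
with position `line t p` at time t and conditional mean velocity `meanVel γ t x` of the lines that
are at x at time t.

The analytic core is `produces_of_ae_eq_meanVel`, a superposition principle: if γ has square
integrable velocity, some process has the same one-time marginals as the random line and follows
`meanVel γ`. This field is only measurable, so its differential equation cannot be solved pathwise.
Instead a particle moves along segments and redraws its velocity, at the times of a grid, from the
conditional law given its position. This keeps every marginal law exactly. The differences between
drawn and mean velocities are orthogonal, so their accumulated effect has mean square of the order
of the mesh (`IsChain.extend`, `IsChain.lintegral_defect_le`). The energy bound makes the paths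
Hölder of order one half outside sets of small probability, so the laws are tight, and
`exists_limit_law` passes to the limit with continuous fields approximating `meanVel γ` in mean.

Optimal flows consist of lines (`SolvesBridge.exists_line`). Let γ be the law of (x_0, x_1 - x_0).
The energy of the process is the mean of |x_1 - x_0|² plus the time variance of the velocity along
the paths. By Jensen `meanVel γ` costs at most the first term, and by the superposition principle it
is a feasible competitor. Optimality therefore makes the variance vanish.

For the mixture, the law of the lines is an explicit measurable function of the parameters
(`lineLaw`), and averaging it gives `mixLine`. Its marginals have the mixture densities, and the
mixture policy is the mean velocity of its lines through a point of space-time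
(`IsLineMixture.integral_jointField`). The continuity equation is the average over the lines of the
fundamental theorem of calculus. Local integrability needs no energy bound, because a line of speed
|v| stays in a ball of radius k for a time of at most 2k/|v|. If the mean energy is finite, the
mixture policy agrees almost everywhere with the conditional mean velocity of `mixLine`, and the
superposition principle applies once more. -/

variable {d : ℕ}

/-! ### Random lines and their conditional mean velocity. -/

/-- The position at time `t` of a particle that starts at `p.1` and has velocity `p.2`. -/
def line (t : ℝ) (p : E d × E d) : E d := p.1 + t • p.2

lemma continuous_uncurry_line : Continuous fun q : ℝ × E d × E d => line q.1 q.2 := by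
  unfold line; fun_prop

@[fun_prop]
lemma measurable_line (t : ℝ) : Measurable (line t : E d × E d → E d) := by
  unfold line; fun_prop

lemma measurable_uncurry_line : Measurable fun q : ℝ × E d × E d => line q.1 q.2 :=
  continuous_uncurry_line.measurable

/-- The law of position and velocity, as a function of time, of a particle that moves along a
random line. -/
def pairKernel (γ : Measure (E d × E d)) : Kernel ℝ (E d × E d) :=
  (Kernel.id ×ₖ Kernel.const ℝ γ).map fun q => (line q.1 q.2, q.2.2)

lemma measurable_pair : Measurable fun q : ℝ × E d × E d => (line q.1 q.2, q.2.2) :=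
  measurable_uncurry_line.prodMk (by fun_prop)

variable (γ : Measure (E d × E d)) [IsProbabilityMeasure γ]

instance : IsMarkovKernel (pairKernel γ) := Kernel.IsMarkovKernel.map _ measurable_pair

lemma pairKernel_apply (t : ℝ) : pairKernel γ t = γ.map fun p => (line t p, p.2) := by
  rw [pairKernel, Kernel.map_apply _ measurable_pair, Kernel.prod_apply, Kernel.const_apply,
    Kernel.id_apply, Measure.dirac_prod, Measure.map_map measurable_pair (by fun_prop)]
  rfl

/-- The conditional law of the velocity given the position. -/
def velKernel : Kernel (ℝ × E d) (E d) := (pairKernel γ).condKernel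

instance : IsMarkovKernel (velKernel γ) := by unfold velKernel; infer_instance

/-- The conditional mean of the velocity given the position. -/
def meanVel (t : ℝ) (x : E d) : E d := ∫ v, v ∂velKernel γ (t, x)

/-- Disintegration over all times at once, read off at a fixed time. -/
lemma map_line_compProd (t : ℝ) :
    (γ.map (line t)) ⊗ₘ (velKernel γ).sectR t = γ.map fun p => (line t p, p.2) := by
  have h := congrArg (fun κ => κ t) (Kernel.disintegrate (pairKernel γ) (pairKernel γ).condKernel)
  simp only [Kernel.compProd_apply_eq_compProd_sectR, pairKernel_apply, Kernel.fst_apply] at h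
  rw [Measure.map_map measurable_fst (by fun_prop)] at h
  exact h

/-- Policies must be jointly Borel in time and position; this is why the velocity is disintegrated
as a kernel over time and not separately for each time. -/
lemma measurable_meanVel : Measurable (Function.uncurry (meanVel γ)) := by
  have : StronglyMeasurable fun q : ℝ × E d => ∫ v, v ∂velKernel γ q :=
    StronglyMeasurable.integral_kernel (κ := velKernel γ) (f := fun v => v) stronglyMeasurable_id
  exact this.measurable

lemma enorm_integral_sq_le {α : Type*} [MeasurableSpace α] {F : Type*} [NormedAddCommGroup F]
    [NormedSpace ℝ F] (μ : Measure α) [IsProbabilityMeasure μ] {f : α → F}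
    (hf : AEStronglyMeasurable f μ) : ‖∫ a, f a ∂μ‖ₑ ^ 2 ≤ ∫⁻ a, ‖f a‖ₑ ^ 2 ∂μ := by
  have h1 : ‖∫ a, f a ∂μ‖ₑ ≤ eLpNorm f 2 μ := by
    refine (enorm_integral_le_lintegral_enorm f).trans ?_
    rw [← eLpNorm_one_eq_lintegral_enorm]
    exact eLpNorm_le_eLpNorm_of_exponent_le (by norm_num) hf
  calc ‖∫ a, f a ∂μ‖ₑ ^ 2 ≤ eLpNorm f 2 μ ^ 2 := by gcongr
    _ = ∫⁻ a, ‖f a‖ₑ ^ 2 ∂μ := by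
      have := eLpNorm_nnreal_pow_eq_lintegral (μ := μ) (f := f) (p := 2) (by norm_num)
      simpa using this

/-- Jensen's inequality for the conditional mean velocity. -/
lemma lintegral_meanVel_sq_le (t : ℝ) :
    ∫⁻ p, ‖meanVel γ t (line t p)‖ₑ ^ 2 ∂γ ≤ ∫⁻ p, ‖p.2‖ₑ ^ 2 ∂γ := by
  have hm : Measurable (meanVel γ t) := (measurable_meanVel γ).comp measurable_prodMk_left
  calc ∫⁻ p, ‖meanVel γ t (line t p)‖ₑ ^ 2 ∂γ
      = ∫⁻ x, ‖meanVel γ t x‖ₑ ^ 2 ∂γ.map (line t) := by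
        rw [lintegral_map (by fun_prop) (by fun_prop)]
    _ ≤ ∫⁻ x, ∫⁻ v, ‖v‖ₑ ^ 2 ∂(velKernel γ).sectR t x ∂γ.map (line t) := by
        refine lintegral_mono fun x => ?_
        exact enorm_integral_sq_le _ aestronglyMeasurable_id
    _ = ∫⁻ q, ‖q.2‖ₑ ^ 2 ∂((γ.map (line t)) ⊗ₘ (velKernel γ).sectR t) := by
        rw [Measure.lintegral_compProd (by fun_prop)]
    _ = ∫⁻ p, ‖p.2‖ₑ ^ 2 ∂γ := by
        rw [map_line_compProd, lintegral_map (by fun_prop) (by fun_prop)]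

lemma memLp_two_iff_lintegral {α : Type*} [MeasurableSpace α] {F : Type*} [NormedAddCommGroup F]
    {μ : Measure α} {f : α → F} (hf : AEStronglyMeasurable f μ) :
    MemLp f 2 μ ↔ ∫⁻ a, ‖f a‖ₑ ^ 2 ∂μ < ⊤ := by
  have := eLpNorm_nnreal_pow_eq_lintegral (μ := μ) (f := f) (p := 2) (by norm_num)
  have h2 : eLpNorm f 2 μ ^ 2 = ∫⁻ a, ‖f a‖ₑ ^ 2 ∂μ := by simpa using this
  rw [← h2, MemLp]
  simp [hf]

/-! ### Chains with resampled velocities. -/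

/-- A process that moves along segments, and whose velocity is drawn anew at each of the times
`τ 0, …, τ (n - 1)` from the conditional law of the velocity of the random line `γ` at that time
given the position. -/
structure IsChain (γ : Measure (E d × E d)) [IsProbabilityMeasure γ] (τ : ℕ → ℝ) (n : ℕ)
    {Ω : Type} [MeasurableSpace Ω] (Q : Measure Ω) (X V : ℕ → Ω → E d) : Prop where
  prob : IsProbabilityMeasure Q
  measurable_pos : ∀ k, Measurable (X k)
  measurable_vel : ∀ k, Measurable (V k)
  law : ∀ k < n, Q.map (fun o => (X k o, V k o)) = γ.map fun p => (line (τ k) p, p.2)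
  law_last : Q.map (X n) = γ.map (line (τ n))
  step : ∀ k < n, ∀ o, X (k + 1) o = X k o + (τ (k + 1) - τ k) • V k o
  -- All deterministic weights are allowed, because a path observed up to time t uses only part of
  -- some cells. Linear growth in the squared weights is what orthogonality of the noise gives.
  orth : ∀ c : ℕ → ℝ,
    ∫ o, ‖∑ j ∈ Finset.range n, c j • (V j o - meanVel γ (τ j) (X j o))‖ ^ 2 ∂Q ≤
      (∑ j ∈ Finset.range n, c j ^ 2) * (4 * ∫ p, ‖p.2‖ ^ 2 ∂γ)

lemma integrable_inner_of_memLp {α : Type*} [MeasurableSpace α] {μ : Measure α} {f g : α → E d}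
    (hf : MemLp f 2 μ) (hg : MemLp g 2 μ) : Integrable (fun a => inner ℝ (f a) (g a)) μ := by
  refine (hf.norm.integrable_mul hg.norm).mono' (hf.1.inner hg.1) (ae_of_all _ fun a => ?_)
  exact norm_inner_le_norm _ _

lemma measurable_meanVel_apply (γ : Measure (E d × E d)) [IsProbabilityMeasure γ] (t : ℝ) :
    Measurable (meanVel γ t) :=
  (measurable_meanVel γ).comp measurable_prodMk_left

section
variable {γ : Measure (E d × E d)} [IsProbabilityMeasure γ]

lemma memLp_meanVel (hγ : ∫⁻ p, ‖p.2‖ₑ ^ 2 ∂γ < ⊤) (t : ℝ) :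
    MemLp (fun p => meanVel γ t (line t p)) 2 γ := by
  have hm := measurable_meanVel_apply γ t
  exact (memLp_two_iff_lintegral (hm.comp (measurable_line t)).aestronglyMeasurable).2
    ((lintegral_meanVel_sq_le γ t).trans_lt hγ)

omit [IsProbabilityMeasure γ] in
lemma memLp_snd (hγ : ∫⁻ p, ‖p.2‖ₑ ^ 2 ∂γ < ⊤) : MemLp (fun p => p.2) 2 γ :=
  (memLp_two_iff_lintegral measurable_snd.aestronglyMeasurable).2 hγ

lemma integral_sq_meanVel_le (hγ : ∫⁻ p, ‖p.2‖ₑ ^ 2 ∂γ < ⊤) (t : ℝ) :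
    ∫ p, ‖meanVel γ t (line t p)‖ ^ 2 ∂γ ≤ ∫ p, ‖p.2‖ ^ 2 ∂γ := by
  have hm := measurable_meanVel_apply γ t
  have key : ∀ f : E d × E d → E d, Measurable f →
      ∫ p, ‖f p‖ ^ 2 ∂γ = (∫⁻ p, ‖f p‖ₑ ^ 2 ∂γ).toReal := fun f hf => by
    rw [integral_eq_lintegral_of_nonneg_ae (ae_of_all _ fun p => by positivity)
      (by fun_prop)]
    congr 1
    refine lintegral_congr fun p => ?_
    rw [ENNReal.ofReal_pow (norm_nonneg _), ofReal_norm]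
  rw [key (fun p => meanVel γ t (line t p)) (by fun_prop), key _ measurable_snd]
  exact ENNReal.toReal_mono hγ.ne (lintegral_meanVel_sq_le γ t)

/-- The factor 4 comes from (a + b)² ≤ 2a² + 2b² and Jensen; any constant would do. -/
lemma integral_sq_sub_meanVel_le (hγ : ∫⁻ p, ‖p.2‖ₑ ^ 2 ∂γ < ⊤) (t : ℝ) :
    ∫ p, ‖p.2 - meanVel γ t (line t p)‖ ^ 2 ∂γ ≤ 4 * ∫ p, ‖p.2‖ ^ 2 ∂γ := by
  have h1 := (memLp_snd hγ).integrable_norm_pow (p := 2) (by norm_num)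
  have h2 := (memLp_meanVel hγ t).integrable_norm_pow (p := 2) (by norm_num)
  calc ∫ p, ‖p.2 - meanVel γ t (line t p)‖ ^ 2 ∂γ
      ≤ ∫ p, (2 * ‖p.2‖ ^ 2 + 2 * ‖meanVel γ t (line t p)‖ ^ 2) ∂γ := by
        refine integral_mono_of_nonneg (ae_of_all _ fun p => by positivity)
          ((h1.const_mul 2).add (h2.const_mul 2)) (ae_of_all _ fun p => ?_)
        have := norm_sub_le p.2 (meanVel γ t (line t p))
        have h0 := norm_nonneg (p.2 - meanVel γ t (line t p))
        simp only
        nlinarith [sq_nonneg (‖p.2‖ - ‖meanVel γ t (line t p)‖)]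
    _ = 2 * ∫ p, ‖p.2‖ ^ 2 ∂γ + 2 * ∫ p, ‖meanVel γ t (line t p)‖ ^ 2 ∂γ := by
        rw [integral_add (h1.const_mul 2) (h2.const_mul 2), integral_const_mul, integral_const_mul]
    _ ≤ _ := by linarith [integral_sq_meanVel_le hγ t]

variable {τ : ℕ → ℝ} {n : ℕ} {Ω : Type} [MeasurableSpace Ω] {Q : Measure Ω} {X V : ℕ → Ω → E d}

lemma IsChain.lintegral_comp (h : IsChain γ τ n Q X V) {k : ℕ} (hk : k < n)
    {f : E d × E d → ℝ≥0∞} (hf : Measurable f) :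
    ∫⁻ o, f (X k o, V k o) ∂Q = ∫⁻ p, f (line (τ k) p, p.2) ∂γ := by
  have hX := h.measurable_pos k
  have hV := h.measurable_vel k
  rw [← lintegral_map (g := fun o => (X k o, V k o)) hf (by fun_prop),
    h.law k hk, lintegral_map hf (by fun_prop)]

lemma IsChain.memLp_sub (h : IsChain γ τ n Q X V) (hγ : ∫⁻ p, ‖p.2‖ₑ ^ 2 ∂γ < ⊤)
    {k : ℕ} (hk : k < n) : MemLp (fun o => V k o - meanVel γ (τ k) (X k o)) 2 Q := by
  have hX := h.measurable_pos k
  have hV := h.measurable_vel k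
  have hm := measurable_meanVel_apply γ (τ k)
  have := (memLp_snd hγ).sub (memLp_meanVel hγ (τ k))
  rw [memLp_two_iff_lintegral (by fun_prop)] at this ⊢
  rw [h.lintegral_comp hk (f := fun q => ‖q.2 - meanVel γ (τ k) q.1‖ₑ ^ 2) (by fun_prop)]
  exact this

lemma IsChain.memLp_sum (h : IsChain γ τ n Q X V) (hγ : ∫⁻ p, ‖p.2‖ₑ ^ 2 ∂γ < ⊤) (c : ℕ → ℝ) :
    MemLp (fun o => ∑ j ∈ Finset.range n, c j • (V j o - meanVel γ (τ j) (X j o))) 2 Q :=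
  memLp_finsetSum _ fun j hj => (h.memLp_sub hγ (Finset.mem_range.1 hj)).const_smul (c j)

lemma isChain_zero (γ : Measure (E d × E d)) [IsProbabilityMeasure γ] (τ : ℕ → ℝ) :
    IsChain γ τ 0 γ (fun _ => line (τ 0)) (fun _ p => p.2) where
  prob := inferInstance
  measurable_pos _ := measurable_line _
  measurable_vel _ := measurable_snd
  law k hk := absurd hk (Nat.not_lt_zero k)
  law_last := rfl
  step k hk := absurd hk (Nat.not_lt_zero k)
  orth c := by simp

/-- The law of an extension of a chain by one step. -/
def extendLaw (γ : Measure (E d × E d)) [IsProbabilityMeasure γ] (t : ℝ) (Q : Measure Ω)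
    (Y : Ω → E d) (hY : Measurable Y) : Measure (Ω × E d) :=
  Q ⊗ₘ ((velKernel γ).sectR t).comap Y hY

instance (t : ℝ) [IsProbabilityMeasure Q] {Y : Ω → E d} (hY : Measurable Y) :
    IsProbabilityMeasure (extendLaw γ t Q Y hY) := by
  unfold extendLaw; infer_instance

lemma extendLaw_map_fst (t : ℝ) [IsProbabilityMeasure Q] {Y : Ω → E d} (hY : Measurable Y) :
    (extendLaw γ t Q Y hY).map Prod.fst = Q :=
  Measure.fst_compProd _ _

/-- Drawing from the conditional velocity law at a point that has the law of the line at time t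
restores the joint law of position and velocity of the random line. -/
lemma extendLaw_map_pair (t : ℝ) [IsProbabilityMeasure Q] {Y : Ω → E d} (hY : Measurable Y)
    (hlaw : Q.map Y = γ.map (line t)) :
    (extendLaw γ t Q Y hY).map (fun o => (Y o.1, o.2)) = γ.map fun p => (line t p, p.2) := by
  rw [← map_line_compProd, ← hlaw, extendLaw]
  refine Measure.ext_of_lintegral _ fun f hf => ?_
  rw [lintegral_map hf (by fun_prop), Measure.lintegral_compProd (by fun_prop),
    Measure.lintegral_compProd hf, lintegral_map hf.lintegral_kernel_prod_right' hY]
  rfl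

/-- Given the past, the fresh velocity has mean `meanVel γ t (Y o)`, so its deviation is orthogonal
to every square integrable function of the past. -/
lemma integral_inner_extendLaw_eq_zero (hγ : ∫⁻ p, ‖p.2‖ₑ ^ 2 ∂γ < ⊤) (t : ℝ)
    [IsProbabilityMeasure Q] {Y S : Ω → E d} (hY : Measurable Y)
    (hlaw : Q.map Y = γ.map (line t)) (hS : MemLp S 2 Q) :
    ∫ o, inner ℝ (S o.1) (o.2 - meanVel γ t (Y o.1)) ∂extendLaw γ t Q Y hY = 0 := by
  have hm := measurable_meanVel_apply γ t
  have hfst : MeasurePreserving Prod.fst (extendLaw γ t Q Y hY) Q :=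
    ⟨measurable_fst, extendLaw_map_fst t hY⟩
  have hpair : MeasurePreserving (fun o : Ω × E d => (Y o.1, o.2)) (extendLaw γ t Q Y hY)
      (γ.map fun p => (line t p, p.2)) := ⟨by fun_prop, extendLaw_map_pair t hY hlaw⟩
  have hvel : MemLp (fun o : Ω × E d => o.2) 2 (extendLaw γ t Q Y hY) := by
    refine MemLp.comp_measurePreserving (g := fun q : E d × E d => q.2) ?_ hpair
    exact (memLp_map_measure_iff (by fun_prop) (by fun_prop)).2 (memLp_snd hγ)
  have hmean : MemLp (fun o : Ω × E d => meanVel γ t (Y o.1)) 2 (extendLaw γ t Q Y hY) := by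
    refine MemLp.comp_measurePreserving (g := fun q : E d × E d => meanVel γ t q.1) ?_ hpair
    exact (memLp_map_measure_iff (hm.comp measurable_fst).aestronglyMeasurable (by fun_prop)).2
      (memLp_meanVel hγ t)
  have hS' := hS.comp_measurePreserving hfst
  have hint : Integrable (fun o : Ω × E d => inner ℝ (S o.1) (o.2 - meanVel γ t (Y o.1)))
    (extendLaw γ t Q Y hY) := integrable_inner_of_memLp hS' (hvel.sub hmean)
  have hv1 := hvel.integrable (by norm_num)
  rw [extendLaw] at hint hv1 ⊢
  rw [Measure.integral_compProd hint]
  rw [Measure.integrable_compProd_iff (by fun_prop)] at hv1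
  refine integral_eq_zero_of_ae ?_
  filter_upwards [hv1.1] with o ho
  have ho2 : Integrable (fun v => v - meanVel γ t (Y o))
    ((((velKernel γ).sectR t).comap Y hY) o) := ho.sub (integrable_const _)
  simp only [Pi.zero_apply]
  rw [integral_inner ho2, integral_sub ho (integrable_const _)]
  simp [meanVel]

lemma IsChain.extend (h : IsChain γ τ n Q X V) (hγ : ∫⁻ p, ‖p.2‖ₑ ^ 2 ∂γ < ⊤) :
    IsChain γ τ (n + 1) (extendLaw γ (τ n) Q (X n) (h.measurable_pos n))
      (fun k o => if k ≤ n then X k o.1 else X n o.1 + (τ (n + 1) - τ n) • o.2)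
      (fun k o => if k < n then V k o.1 else o.2) := by
  have := h.prob
  have hX := h.measurable_pos
  have hV := h.measurable_vel
  set Q' := extendLaw γ (τ n) Q (X n) (h.measurable_pos n) with hQ'
  have hfst : MeasurePreserving Prod.fst Q' Q := ⟨measurable_fst, extendLaw_map_fst _ _⟩
  have hpair : Q'.map (fun o => (X n o.1, o.2)) = γ.map fun p => (line (τ n) p, p.2) :=
    extendLaw_map_pair _ _ h.law_last
  refine ⟨?_, fun k => ?_, fun k => ?_, fun k hk => ?_, ?_, fun k hk o => ?_, fun c => ?_⟩
  · infer_instance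
  · split_ifs
    · exact (hX k).comp measurable_fst
    · have := hX n
      fun_prop
  · split_ifs
    · exact (hV k).comp measurable_fst
    · exact measurable_snd
  · rcases Nat.lt_succ_iff_lt_or_eq.1 hk with hk | rfl
    · simp only [hk, hk.le, if_true]
      have h1 : Measurable fun o => (X k o, V k o) := by fun_prop
      rw [← h.law k hk, ← hfst.map_eq, Measure.map_map h1 measurable_fst]
      rfl
    · simpa using hpair
  -- Moving with velocity `p.2` for a time `τ (n + 1) - τ n` takes `line (τ n) p` to `line (τ (n +
  -- 1)) p`. So the marginal law survives, although the velocity was redrawn.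
  · simp only [Nat.not_succ_le_self, if_false]
    have h1 : Measurable fun q : E d × E d => q.1 + (τ (n + 1) - τ n) • q.2 := by fun_prop
    have h2 := congrArg (Measure.map fun q : E d × E d => q.1 + (τ (n + 1) - τ n) • q.2) hpair
    rw [Measure.map_map h1 (by fun_prop), Measure.map_map h1 (by fun_prop)] at h2
    refine Eq.trans h2 (congrArg (fun f => γ.map f) (funext fun p => ?_))
    simp only [line, Function.comp_apply]
    module
  · rcases Nat.lt_succ_iff_lt_or_eq.1 hk with hk | rfl
    · simp [hk, hk.le, Nat.succ_le_of_lt hk, h.step k hk]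
    · simp
  -- Pythagoras: the square of past noise plus fresh noise has a cross term of mean zero.
  · set S : Ω → E d := fun o =>
      ∑ j ∈ Finset.range n, c j • (V j o - meanVel γ (τ j) (X j o)) with hS
    have hSm : MemLp S 2 Q := h.memLp_sum hγ c
    have hsum : ∀ o : Ω × E d, ∑ j ∈ Finset.range (n + 1), c j •
        ((if j < n then V j o.1 else o.2) - meanVel γ (τ j)
          (if j ≤ n then X j o.1 else X n o.1 + (τ (n + 1) - τ n) • o.2)) =
        S o.1 + c n • (o.2 - meanVel γ (τ n) (X n o.1)) := fun o => by
      rw [Finset.sum_range_succ, hS]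
      simp only [lt_irrefl, le_refl, if_true, if_false]
      congr 1
      refine Finset.sum_congr rfl fun j hj => ?_
      have := Finset.mem_range.1 hj
      simp [this, this.le]
    simp only [hsum]
    have hcross := integral_inner_extendLaw_eq_zero hγ (τ n) (hX n) h.law_last hSm
    rw [← hQ'] at hcross
    have hm := measurable_meanVel_apply γ (τ n)
    have hξ : MemLp (fun o : Ω × E d => o.2 - meanVel γ (τ n) (X n o.1)) 2 Q' := by
      refine MemLp.comp_measurePreserving (f := fun o : Ω × E d => (X n o.1, o.2))
        (g := fun q : E d × E d => q.2 - meanVel γ (τ n) q.1)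
        (ν := γ.map fun p => (line (τ n) p, p.2)) ?_ ⟨by fun_prop, hpair⟩
      exact (memLp_map_measure_iff (by fun_prop) (by fun_prop)).2
        ((memLp_snd hγ).sub (memLp_meanVel hγ (τ n)))
    have hξ2 : ∫ o, ‖o.2 - meanVel γ (τ n) (X n o.1)‖ ^ 2 ∂Q' ≤ 4 * ∫ p, ‖p.2‖ ^ 2 ∂γ := by
      refine le_of_eq_of_le ?_ (integral_sq_sub_meanVel_le hγ (τ n))
      rw [← integral_map (φ := fun o : Ω × E d => (X n o.1, o.2))
        (f := fun q : E d × E d => ‖q.2 - meanVel γ (τ n) q.1‖ ^ 2) (by fun_prop) (by fun_prop),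
        hpair, integral_map (by fun_prop) (by fun_prop)]
    have hS' : MemLp (fun o : Ω × E d => S o.1) 2 Q' := hSm.comp_measurePreserving hfst
    have hS2 : ∫ o, ‖S o.1‖ ^ 2 ∂Q' = ∫ o, ‖S o‖ ^ 2 ∂Q := by
      rw [← hfst.map_eq, integral_map (by fun_prop)]
      rw [hfst.map_eq]
      exact (hSm.1.norm.pow 2)
    have hi1 := hS'.integrable_norm_pow (p := 2) (by norm_num)
    have hi2 := hξ.integrable_norm_pow (p := 2) (by norm_num)
    have hi3 := integrable_inner_of_memLp hS' hξ
    have hexp : ∀ o : Ω × E d, ‖S o.1 + c n • (o.2 - meanVel γ (τ n) (X n o.1))‖ ^ 2 =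
        ‖S o.1‖ ^ 2 + (2 * c n) * inner ℝ (S o.1) (o.2 - meanVel γ (τ n) (X n o.1)) +
          c n ^ 2 * ‖o.2 - meanVel γ (τ n) (X n o.1)‖ ^ 2 := fun o => by
      rw [norm_add_sq_real, inner_smul_right, norm_smul, mul_pow, Real.norm_eq_abs, sq_abs]
      ring
    simp only [hexp]
    have hi4 : Integrable (fun o : Ω × E d => ‖S o.1‖ ^ 2 +
        (2 * c n) * inner ℝ (S o.1) (o.2 - meanVel γ (τ n) (X n o.1))) Q' :=
      hi1.add (hi3.const_mul _)
    rw [integral_add hi4 (hi2.const_mul _),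
      integral_add hi1 (hi3.const_mul _), integral_const_mul, integral_const_mul, hcross, hS2,
      Finset.sum_range_succ, add_mul]
    have := h.orth c
    have := mul_le_mul_of_nonneg_left hξ2 (sq_nonneg (c n))
    simp only [mul_zero, add_zero]
    gcongr

variable (γ) in
theorem exists_isChain (hγ : ∫⁻ p, ‖p.2‖ₑ ^ 2 ∂γ < ⊤) (τ : ℕ → ℝ) (n : ℕ) :
    ∃ (Ω : Type) (_ : MeasurableSpace Ω) (Q : Measure Ω) (X V : ℕ → Ω → E d),
      IsChain γ τ n Q X V := by
  induction n with
  | zero => exact ⟨_, _, _, _, _, isChain_zero γ τ⟩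
  | succ n ih =>
    obtain ⟨Ω, _, Q, X, V, h⟩ := ih
    exact ⟨_, _, _, _, _, h.extend hγ⟩

end

/-! ### Polygonal paths on a shifted grid. -/

/-- The function that rises with slope one from `0` at time `a` to `h` at time `a + h`. -/
def ramp (h a t : ℝ) : ℝ := max 0 (min h (t - a))

@[fun_prop]
lemma continuous_ramp (h a : ℝ) : Continuous (ramp h a) := by unfold ramp; fun_prop

lemma ramp_mono (h a : ℝ) : Monotone (ramp h a) := fun s t hst => by
  unfold ramp; gcongr

lemma ramp_sub_le {h a s t : ℝ} (hst : s ≤ t) : ramp h a t - ramp h a s ≤ t - s := by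
  unfold ramp
  rcases min_cases h (t - a) with h1 | h1 <;> rcases min_cases h (s - a) with h2 | h2 <;>
  rcases max_cases 0 (min h (t - a)) with h3 | h3 <;>
  rcases max_cases 0 (min h (s - a)) with h4 | h4 <;> linarith

/-- The times of a uniform grid with mesh `h` that starts at `-δ`. -/
def grid (h δ : ℝ) (k : ℕ) : ℝ := k * h - δ

lemma grid_succ (h δ : ℝ) (k : ℕ) : grid h δ (k + 1) = grid h δ k + h := by
  simp only [grid]; push_cast; ring

lemma grid_mono {h : ℝ} (hh : 0 ≤ h) (δ : ℝ) : Monotone (grid h δ) :=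
  monotone_nat_of_le_succ fun k => by rw [grid_succ]; linarith

/-- The cells abut, so each ramp starts where the previous one saturates. -/
lemma sum_ramp {h : ℝ} (hh : 0 ≤ h) (δ : ℝ) (n : ℕ) (t : ℝ) :
    ∑ j ∈ Finset.range n, ramp h (grid h δ j) t = ramp (n * h) (-δ) t := by
  induction n with
  | zero => simp [ramp]
  | succ n ih =>
    rw [Finset.sum_range_succ, ih]
    have : 0 ≤ n * h := by positivity
    simp only [ramp, grid, Nat.cast_succ, add_mul, one_mul]
    rcases min_cases (n * h) (t - -δ) with h1 | h1 <;>
    rcases min_cases h (t - (n * h - δ)) with h2 | h2 <;>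
    rcases min_cases (n * h + h) (t - -δ) with h3 | h3 <;>
    rcases max_cases 0 (min (n * h) (t - -δ)) with h4 | h4 <;>
    rcases max_cases 0 (min h (t - (n * h - δ))) with h5 | h5 <;>
    rcases max_cases 0 (min (n * h + h) (t - -δ)) with h6 | h6 <;> linarith

lemma sum_ramp_sub_le {h : ℝ} (hh : 0 ≤ h) (δ : ℝ) (n : ℕ) {s t : ℝ} (hst : s ≤ t) :
    ∑ j ∈ Finset.range n, (ramp h (grid h δ j) t - ramp h (grid h δ j) s) ≤ t - s := by
  rw [Finset.sum_sub_distrib, sum_ramp hh, sum_ramp hh]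
  exact ramp_sub_le hst

/-- Both sides measure the part of the cell from a to a + h inside [0, t]. The clipped endpoints on
the right turn consecutive cells into adjacent intervals of integration. -/
lemma ramp_sub_eq_clip {h a t : ℝ} (hh : 0 ≤ h) (ht : 0 ≤ t) :
    ramp h a t - ramp h a 0 = max 0 (min t (a + h)) - max 0 (min t a) := by
  unfold ramp
  rcases min_cases h (t - a) with h1 | h1 <;> rcases min_cases h (0 - a) with h2 | h2 <;>
  rcases min_cases t (a + h) with h3 | h3 <;> rcases min_cases t a with h4 | h4 <;>
  rcases max_cases 0 (min h (t - a)) with h5 | h5 <;>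
  rcases max_cases 0 (min h (0 - a)) with h6 | h6 <;>
  rcases max_cases 0 (min t (a + h)) with h7 | h7 <;>
  rcases max_cases 0 (min t a) with h8 | h8 <;> linarith

/-- The path that starts at `x` and has velocity `v j` in the `j`-th cell of the grid. -/
def gridPath (h δ : ℝ) (n : ℕ) (x : E d) (v : ℕ → E d) (t : ℝ) : E d :=
  x + ∑ j ∈ Finset.range n, ramp h (grid h δ j) t • v j

lemma continuous_gridPath (h δ : ℝ) (n : ℕ) (x : E d) (v : ℕ → E d) :
    Continuous (gridPath h δ n x v) := by
  unfold gridPath; fun_prop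

/-- A path of finite energy is Hölder continuous of order one half. -/
lemma norm_gridPath_sub_sq_le {h : ℝ} (hh : 0 ≤ h) (δ : ℝ) (n : ℕ) (x : E d) (v : ℕ → E d)
    {s t : ℝ} (hst : s ≤ t) :
    ‖gridPath h δ n x v t - gridPath h δ n x v s‖ ^ 2 ≤
      (t - s) * (h * ∑ j ∈ Finset.range n, ‖v j‖ ^ 2) := by
  set c : ℕ → ℝ := fun j => ramp h (grid h δ j) t - ramp h (grid h δ j) s with hc
  have hc0 : ∀ j, 0 ≤ c j := fun j => sub_nonneg.2 (ramp_mono _ _ hst)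
  have hch : ∀ j, c j ≤ h := fun j => by
    have h1 : ramp h (grid h δ j) t ≤ h := max_le hh (min_le_left _ _)
    have h2 : 0 ≤ ramp h (grid h δ j) s := le_max_left _ _
    simp only [hc]; linarith
  have h1 : gridPath h δ n x v t - gridPath h δ n x v s = ∑ j ∈ Finset.range n, c j • v j := by
    simp only [gridPath, hc, sub_smul, Finset.sum_sub_distrib]
    abel
  -- Writing `c j` as a product of square roots lets Cauchy–Schwarz separate the elapsed time `∑ c
  -- j` from the energy.
  have h2 : ‖∑ j ∈ Finset.range n, c j • v j‖ ≤
      ∑ j ∈ Finset.range n, √(c j) * (√(c j) * ‖v j‖) := by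
    refine (norm_sum_le _ _).trans (Finset.sum_le_sum fun j _ => ?_)
    rw [norm_smul, Real.norm_of_nonneg (hc0 j), ← mul_assoc, Real.mul_self_sqrt (hc0 j)]
  rw [h1]
  calc ‖∑ j ∈ Finset.range n, c j • v j‖ ^ 2
      ≤ (∑ j ∈ Finset.range n, √(c j) * (√(c j) * ‖v j‖)) ^ 2 := by gcongr
    _ ≤ (∑ j ∈ Finset.range n, √(c j) ^ 2) * ∑ j ∈ Finset.range n, (√(c j) * ‖v j‖) ^ 2 :=
        Finset.sum_mul_sq_le_sq_mul_sq _ _ _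
    _ = (∑ j ∈ Finset.range n, c j) * ∑ j ∈ Finset.range n, c j * ‖v j‖ ^ 2 := by
        simp only [mul_pow, Real.sq_sqrt (hc0 _)]
    _ ≤ (t - s) * ∑ j ∈ Finset.range n, h * ‖v j‖ ^ 2 := by
        have := sum_ramp_sub_le hh δ n hst
        gcongr with j
        · exact Finset.sum_nonneg fun j _ => mul_nonneg (hc0 j) (by positivity)
        · exact hch j
    _ = _ := by rw [← Finset.mul_sum]

/-- In cell k the earlier ramps are saturated at h and the later ones have not started. The base
point `x 0` is the position at the first grid time -δ, not at time zero. -/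
lemma gridPath_eq {h : ℝ} (hh : 0 ≤ h) {δ : ℝ} {n : ℕ} {x v : ℕ → E d}
    (hstep : ∀ k < n, x (k + 1) = x k + h • v k) {k : ℕ} (hk : k < n) {t : ℝ}
    (h1 : grid h δ k ≤ t) (h2 : t ≤ grid h δ (k + 1)) :
    gridPath h δ n (x 0) v t = x k + (t - grid h δ k) • v k := by
  have hx : ∀ i ≤ n, x i = x 0 + ∑ j ∈ Finset.range i, h • v j := fun i hi => by
    induction i with
    | zero => simp
    | succ i ih => rw [hstep i hi, ih (by omega), Finset.sum_range_succ, add_assoc]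
  have hfirst : ∀ j ∈ Finset.range k, ramp h (grid h δ j) t • v j = h • v j := fun j hj => by
    have : grid h δ (j + 1) ≤ grid h δ k := grid_mono hh δ (Finset.mem_range.1 hj)
    rw [grid_succ] at this
    rw [ramp, min_eq_left (by linarith), max_eq_right hh]
  have hlast : ∀ j ∈ Finset.range n, j ∉ Finset.range (k + 1) →
      ramp h (grid h δ j) t • v j = 0 := fun j _ hj => by
    have : grid h δ (k + 1) ≤ grid h δ j := grid_mono hh δ (by simpa using hj)
    rw [ramp, max_eq_left ((min_le_right _ _).trans (by linarith)), zero_smul]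
  have hmid : ramp h (grid h δ k) t = t - grid h δ k := by
    rw [grid_succ] at h2
    rw [ramp, min_eq_right (by linarith), max_eq_right (by linarith)]
  rw [gridPath, ← Finset.sum_subset (Finset.range_subset_range.2 hk) hlast, Finset.sum_range_succ,
    Finset.sum_congr rfl hfirst, hmid, hx k hk.le, add_assoc]

lemma exists_grid_cell {h : ℝ} {δ : ℝ} {n : ℕ} (hn : 0 < n) {t : ℝ}
    (h0 : grid h δ 0 ≤ t) (h1 : t ≤ grid h δ n) :
    ∃ k < n, grid h δ k ≤ t ∧ t ≤ grid h δ (k + 1) := by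
  induction n with
  | zero => exact absurd hn (lt_irrefl 0)
  | succ n ih =>
    rcases le_or_gt (grid h δ n) t with h | h
    · exact ⟨n, by omega, h, h1⟩
    · have hn : 0 < n := Nat.pos_of_ne_zero fun e => by subst e; exact absurd h0 (not_le.2 h)
      obtain ⟨k, hk, hk'⟩ := ih hn h.le
      exact ⟨k, by omega, hk'⟩

/-- How far a polygonal path is from solving the differential equation of a vector field `f`. -/
lemma norm_gridPath_sub_integral_le {h : ℝ} (hh : 0 ≤ h) {δ : ℝ} {n : ℕ} {x v : ℕ → E d}
    (hstep : ∀ k < n, x (k + 1) = x k + h • v k)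
    {f : ℝ × E d → E d} (hf : Continuous f) {ε K : ℝ} (hε : 0 ≤ ε) (hK : 0 ≤ K)
    (hfK : ∀ p q, ‖f p - f q‖ ≤ ε + K * (|p.1 - q.1| + ‖p.2 - q.2‖)) (m : ℕ → E d)
    {t : ℝ} (ht : t ∈ Icc (0 : ℝ) 1) (h0 : grid h δ 0 ≤ 0) (h1 : t ≤ grid h δ n) :
    ‖gridPath h δ n (x 0) v t - gridPath h δ n (x 0) v 0 -
        ∫ s in (0 : ℝ)..t, f (s, gridPath h δ n (x 0) v s)‖ ≤
      ‖∑ j ∈ Finset.range n, (ramp h (grid h δ j) t - ramp h (grid h δ j) 0) • (v j - m j)‖ +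
      h * ∑ j ∈ Finset.range n, ‖m j - f (grid h δ j, x j)‖ +
      (ε + K * h) + K * h * (h * ∑ j ∈ Finset.range n, ‖v j‖) := by
  set y := gridPath h δ n (x 0) v with hy
  have hyc : Continuous y := continuous_gridPath _ _ _ _ _
  set c : ℕ → ℝ := fun j => ramp h (grid h δ j) t - ramp h (grid h δ j) 0 with hc
  -- Grid times clipped to [0, t]; cells outside this interval get length zero.
  set a : ℕ → ℝ := fun j => max 0 (min t (grid h δ j)) with ha
  have hca : ∀ j, c j = a (j + 1) - a j := fun j => by
    simp only [hc, ha, ramp_sub_eq_clip hh ht.1, grid_succ]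
  have hc0 : ∀ j, 0 ≤ c j := fun j => sub_nonneg.2 (ramp_mono _ _ ht.1)
  have hch : ∀ j, c j ≤ h := fun j => by
    have h1 : ramp h (grid h δ j) t ≤ h := max_le hh (min_le_left _ _)
    have h2 : 0 ≤ ramp h (grid h δ j) 0 := le_max_left _ _
    simp only [hc]; linarith
  have hcs : ∑ j ∈ Finset.range n, c j ≤ 1 := by
    refine (sum_ramp_sub_le hh δ n ht.1).trans ?_
    linarith [ht.2]
  have hg : Continuous fun s => f (s, y s) := by fun_prop
  have hint : ∫ s in (0 : ℝ)..t, f (s, y s) =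
      ∑ j ∈ Finset.range n, ∫ s in a j..a (j + 1), f (s, y s) := by
    rw [intervalIntegral.sum_integral_adjacent_intervals
      (fun k _ => hg.intervalIntegrable _ _)]
    have e1 : a 0 = 0 := max_eq_left ((min_le_right _ _).trans h0)
    have e2 : a n = t := by simp only [ha]; rw [min_eq_left h1, max_eq_right ht.1]
    rw [e1, e2]
  have hdiff : y t - y 0 = ∑ j ∈ Finset.range n, c j • v j := by
    simp only [hy, gridPath, hc, sub_smul, Finset.sum_sub_distrib]
    abel
  have hcell : ∀ j ∈ Finset.range n, ‖c j • f (grid h δ j, x j) -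
      ∫ s in a j..a (j + 1), f (s, y s)‖ ≤ c j * (ε + K * h) + K * h * (h * ‖v j‖) :=
      fun j hj => by
    have hle : a j ≤ a (j + 1) := by linarith [hc0 j, hca j]
    have e : c j • f (grid h δ j, x j) - ∫ s in a j..a (j + 1), f (s, y s) =
        ∫ s in a j..a (j + 1), (f (grid h δ j, x j) - f (s, y s)) := by
      rw [intervalIntegral.integral_sub (by simp) (hg.intervalIntegrable _ _),
        intervalIntegral.integral_const, hca]
    rw [e]
    have hb : ∀ s ∈ uIoc (a j) (a (j + 1)),
        ‖f (grid h δ j, x j) - f (s, y s)‖ ≤ ε + K * (h + h * ‖v j‖) := fun s hs => by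
      rw [uIoc_of_le hle] at hs
      have hs1 : grid h δ j ≤ s := by
        rcases le_total t (grid h δ j) with h5 | h5
        · have : a (j + 1) ≤ t := max_le ht.1 (min_le_left _ _)
          have h6 : a j = t := by simp only [ha]; rw [min_eq_left h5, max_eq_right ht.1]
          linarith [hs.1, hs.2]
        · have : grid h δ j ≤ a j := by simp only [ha]; rw [min_eq_right h5]; exact le_max_right _ _
          linarith [hs.1]
      have hs2 : s ≤ grid h δ (j + 1) := by
        have hpos : 0 ≤ a j := le_max_left _ _
        rcases max_cases 0 (min t (grid h δ (j + 1))) with h5 | h5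
        · have : a (j + 1) = 0 := h5.1
          linarith [hs.1, hs.2]
        · have : a (j + 1) = min t (grid h δ (j + 1)) := h5.1
          linarith [hs.2, min_le_right t (grid h δ (j + 1))]
      have hys := gridPath_eq hh hstep (Finset.mem_range.1 hj) hs1 hs2
      rw [grid_succ] at hs2
      refine (hfK _ _).trans ?_
      have e1 : |grid h δ j - s| ≤ h := by rw [abs_le]; constructor <;> linarith
      have e2 : ‖x j - y s‖ ≤ h * ‖v j‖ := by
        rw [hy, hys, sub_add_cancel_left, norm_neg, norm_smul, Real.norm_eq_abs, abs_sub_comm]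
        gcongr
      gcongr
    refine (intervalIntegral.norm_integral_le_of_norm_le_const hb).trans ?_
    rw [← hca, abs_of_nonneg (hc0 j)]
    have : K * h * ‖v j‖ * c j ≤ K * h * ‖v j‖ * h := by gcongr; exact hch j
    nlinarith
  -- Three sources of error: noise in the drawn velocity, distance of its prescribed mean m from the
  -- field, and variation of the field within a cell.
  have hsplit : y t - y 0 - ∫ s in (0 : ℝ)..t, f (s, y s) =
      ∑ j ∈ Finset.range n, c j • (v j - m j) +
      ∑ j ∈ Finset.range n, c j • (m j - f (grid h δ j, x j)) +
      ∑ j ∈ Finset.range n, (c j • f (grid h δ j, x j) -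
        ∫ s in a j..a (j + 1), f (s, y s)) := by
    rw [hdiff, hint, ← Finset.sum_add_distrib, ← Finset.sum_add_distrib, ← Finset.sum_sub_distrib]
    refine Finset.sum_congr rfl fun j _ => ?_
    module
  have hA : ‖∑ j ∈ Finset.range n, c j • (m j - f (grid h δ j, x j))‖ ≤
      h * ∑ j ∈ Finset.range n, ‖m j - f (grid h δ j, x j)‖ := by
    rw [Finset.mul_sum]
    refine (norm_sum_le _ _).trans (Finset.sum_le_sum fun j _ => ?_)
    rw [norm_smul, Real.norm_of_nonneg (hc0 j)]
    gcongr
    exact hch j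
  have hB : ‖∑ j ∈ Finset.range n, (c j • f (grid h δ j, x j) -
      ∫ s in a j..a (j + 1), f (s, y s))‖ ≤
      (ε + K * h) + K * h * (h * ∑ j ∈ Finset.range n, ‖v j‖) := by
    refine (norm_sum_le _ _).trans ((Finset.sum_le_sum hcell).trans ?_)
    rw [Finset.sum_add_distrib, ← Finset.sum_mul, ← Finset.mul_sum, ← Finset.mul_sum]
    have : (∑ j ∈ Finset.range n, c j) * (ε + K * h) ≤ 1 * (ε + K * h) := by gcongr
    linarith
  rw [hsplit]
  have t1 := norm_add_le (∑ j ∈ Finset.range n, c j • (v j - m j) +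
      ∑ j ∈ Finset.range n, c j • (m j - f (grid h δ j, x j))) (∑ j ∈ Finset.range n,
      (c j • f (grid h δ j, x j) - ∫ s in a j..a (j + 1), f (s, y s)))
  have t2 := norm_add_le (∑ j ∈ Finset.range n, c j • (v j - m j))
      (∑ j ∈ Finset.range n, c j • (m j - f (grid h δ j, x j)))
  linarith

/-! ### Mean defect of the resampled process. -/

lemma lintegral_enorm_le_of_integral_sq_le {Ω : Type*} [MeasurableSpace Ω] {Q : Measure Ω}
    [IsProbabilityMeasure Q] {S : Ω → E d} (hS : MemLp S 2 Q) {B : ℝ}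
    (h : ∫ o, ‖S o‖ ^ 2 ∂Q ≤ B) : ∫⁻ o, ‖S o‖ₑ ∂Q ≤ ENNReal.ofReal (√B) := by
  have h1 : ∫⁻ o, ‖S o‖ₑ ∂Q ≤ eLpNorm S 2 Q := by
    rw [← eLpNorm_one_eq_lintegral_enorm]
    exact eLpNorm_le_eLpNorm_of_exponent_le (by norm_num) hS.1
  refine h1.trans ?_
  have h2 : eLpNorm S 2 Q ^ 2 = ENNReal.ofReal (∫ o, ‖S o‖ ^ 2 ∂Q) := by
    have := eLpNorm_nnreal_pow_eq_lintegral (μ := Q) (f := S) (p := 2) (by norm_num)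
    rw [ofReal_integral_eq_lintegral_ofReal (hS.integrable_norm_pow (by norm_num))
      (ae_of_all _ fun o => by positivity)]
    simpa [ENNReal.ofReal_pow] using this
  have h3 : eLpNorm S 2 Q ^ 2 ≤ ENNReal.ofReal (√B) ^ 2 := by
    rw [h2, ← ENNReal.ofReal_pow (Real.sqrt_nonneg _), Real.sq_sqrt]
    · exact ENNReal.ofReal_le_ofReal h
    · exact (integral_nonneg fun o => by positivity).trans h
  exact (ENNReal.pow_right_strictMono two_ne_zero).le_iff_le.1 h3

section
variable {γ : Measure (E d × E d)} [IsProbabilityMeasure γ]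
  {n : ℕ} {Ω : Type} [MeasurableSpace Ω] {Q : Measure Ω} {X V : ℕ → Ω → E d} {h δ : ℝ}

/-- Within a cell the path continues the pair (X k, V k) linearly, and this pair has the law of
position and velocity of the random line. So the marginals are exact between the grid times too. -/
lemma IsChain.gridPath_law (hc : IsChain γ (grid h δ) n Q X V) (hn : 0 < n) (hh : 0 ≤ h) {t : ℝ}
    (h0 : grid h δ 0 ≤ t) (h1 : t ≤ grid h δ n) :
    Q.map (fun o => gridPath h δ n (X 0 o) (fun j => V j o) t) = γ.map (line t) := by
  obtain ⟨k, hk, hk1, hk2⟩ := exists_grid_cell hn h0 h1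
  have hX := hc.measurable_pos k
  have hV := hc.measurable_vel k
  have e : (fun o => gridPath h δ n (X 0 o) (fun j => V j o) t) =
      (fun q : E d × E d => q.1 + (t - grid h δ k) • q.2) ∘ fun o => (X k o, V k o) := by
    funext o
    refine gridPath_eq hh (x := fun j => X j o) (fun k hk => ?_) hk hk1 hk2
    rw [hc.step k hk o, grid_succ, add_sub_cancel_left]
  have h2 : Measurable fun q : E d × E d => q.1 + (t - grid h δ k) • q.2 := by fun_prop
  rw [e, ← Measure.map_map h2 (by fun_prop), hc.law k hk, Measure.map_map h2 (by fun_prop)]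
  refine congrArg (fun f => γ.map f) (funext fun p => ?_)
  simp only [line, Function.comp_apply]
  module

/-- In mean, the resampled process nearly solves the differential equation of a continuous vector
field that is close to the conditional mean velocity. -/
lemma IsChain.lintegral_defect_le (hc : IsChain γ (grid h δ) n Q X V)
    (hγ : ∫⁻ p, ‖p.2‖ₑ ^ 2 ∂γ < ⊤) (hh : 0 ≤ h)
    {f : ℝ × E d → E d} (hf : Continuous f) {ε K : ℝ} (hε : 0 ≤ ε) (hK : 0 ≤ K)
    (hfK : ∀ p q, ‖f p - f q‖ ≤ ε + K * (|p.1 - q.1| + ‖p.2 - q.2‖))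
    {t : ℝ} (ht : t ∈ Icc (0 : ℝ) 1) (h0 : grid h δ 0 ≤ 0) (h1 : t ≤ grid h δ n) :
    ∫⁻ o, ‖gridPath h δ n (X 0 o) (fun j => V j o) t - gridPath h δ n (X 0 o) (fun j => V j o) 0 -
        ∫ s in (0 : ℝ)..t, f (s, gridPath h δ n (X 0 o) (fun j => V j o) s)‖ₑ ∂Q ≤
      ENNReal.ofReal (√(n * h ^ 2 * (4 * ∫ p, ‖p.2‖ ^ 2 ∂γ))) +
      ENNReal.ofReal h * ∑ j ∈ Finset.range n, ∫⁻ p, ‖meanVel γ (grid h δ j) (line (grid h δ j) p) -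
          f (grid h δ j, line (grid h δ j) p)‖ₑ ∂γ +
      ENNReal.ofReal (ε + K * h) +
      ENNReal.ofReal (K * h * (h * n)) * ∫⁻ p, ‖p.2‖ₑ ∂γ := by
  have := hc.prob
  have hX := hc.measurable_pos
  have hV := hc.measurable_vel
  have hm := measurable_meanVel_apply γ
  have hmX : ∀ j, Measurable fun o => meanVel γ (grid h δ j) (X j o) := fun j => (hm _).comp (hX j)
  set c : ℕ → ℝ := fun j => ramp h (grid h δ j) t - ramp h (grid h δ j) 0 with hcdef
  set S : Ω → E d := fun o =>
    ∑ j ∈ Finset.range n, c j • (V j o - meanVel γ (grid h δ j) (X j o)) with hSdef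
  have hSm : Measurable S := by
    rw [hSdef]
    fun_prop
  have hS : ∫⁻ o, ‖S o‖ₑ ∂Q ≤ ENNReal.ofReal (√(n * h ^ 2 * (4 * ∫ p, ‖p.2‖ ^ 2 ∂γ))) := by
    refine lintegral_enorm_le_of_integral_sq_le (hc.memLp_sum hγ c) ((hc.orth c).trans ?_)
    -- With n of order 1/h this is of order h, so the noise disappears with the mesh.
    have : ∑ j ∈ Finset.range n, c j ^ 2 ≤ n * h ^ 2 := by
      refine (Finset.sum_le_sum (g := fun _ => h ^ 2) fun j _ => ?_).trans (by simp)
      have h1 : ramp h (grid h δ j) t ≤ h := max_le hh (min_le_left _ _)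
      have h2 : 0 ≤ ramp h (grid h δ j) 0 := le_max_left _ _
      have h3 := ramp_mono h (grid h δ j) ht.1
      simp only [hcdef]
      gcongr
      linarith
    have h4 : 0 ≤ ∫ p, ‖p.2‖ ^ 2 ∂γ := integral_nonneg fun p => by positivity
    gcongr
  have hA : ∀ j ∈ Finset.range n, ∫⁻ o, ‖meanVel γ (grid h δ j) (X j o) -
      f (grid h δ j, X j o)‖ₑ ∂Q = ∫⁻ p, ‖meanVel γ (grid h δ j) (line (grid h δ j) p) -
          f (grid h δ j, line (grid h δ j) p)‖ₑ ∂γ := fun j hj => by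
    have hm' := hm (grid h δ j)
    have : Measurable fun q : E d × E d => ‖meanVel γ (grid h δ j) q.1 - f (grid h δ j, q.1)‖ₑ := by
      refine ((hm'.comp measurable_fst).sub ?_).enorm
      exact (hf.comp (by fun_prop)).measurable
    exact hc.lintegral_comp (Finset.mem_range.1 hj) this
  have hB : ∀ j ∈ Finset.range n, ∫⁻ o, ‖V j o‖ₑ ∂Q = ∫⁻ p, ‖p.2‖ₑ ∂γ := fun j hj =>
    hc.lintegral_comp (Finset.mem_range.1 hj) (f := fun q => ‖q.2‖ₑ) (by fun_prop)
  have hAm : ∀ j, Measurable fun o => ‖meanVel γ (grid h δ j) (X j o) - f (grid h δ j, X j o)‖ₑ :=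
    fun j => by
    refine ((hmX j).sub (hf.measurable.comp ?_)).enorm
    exact measurable_const.prodMk (hX j)
  calc _ ≤ ∫⁻ o, (‖S o‖ₑ + ENNReal.ofReal h * ∑ j ∈ Finset.range n,
          ‖meanVel γ (grid h δ j) (X j o) - f (grid h δ j, X j o)‖ₑ + ENNReal.ofReal (ε + K * h) +
          ENNReal.ofReal (K * h * h) * ∑ j ∈ Finset.range n, ‖V j o‖ₑ) ∂Q := by
        refine lintegral_mono fun o => ?_
        have key := norm_gridPath_sub_integral_le hh (x := fun j => X j o) (v := fun j => V j o)
          (fun k hk => by rw [hc.step k hk o, grid_succ, add_sub_cancel_left])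
          hf hε hK hfK (fun j => meanVel γ (grid h δ j) (X j o)) ht h0 h1
        have key2 := ENNReal.ofReal_le_ofReal key
        rw [ofReal_norm] at key2
        refine key2.trans ?_
        rw [ENNReal.ofReal_add (by positivity) (by positivity),
          ENNReal.ofReal_add (by positivity) (by positivity),
          ENNReal.ofReal_add (by positivity) (by positivity), ofReal_norm,
          ENNReal.ofReal_mul hh, ← mul_assoc, ENNReal.ofReal_mul (by positivity),
          ENNReal.ofReal_sum_of_nonneg (fun _ _ => norm_nonneg _),
          ENNReal.ofReal_sum_of_nonneg (fun _ _ => norm_nonneg _)]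
        simp only [ofReal_norm]
        rfl
    _ = ∫⁻ o, ‖S o‖ₑ ∂Q + ENNReal.ofReal h * ∑ j ∈ Finset.range n,
          ∫⁻ p, ‖meanVel γ (grid h δ j) (line (grid h δ j) p) -
          f (grid h δ j, line (grid h δ j) p)‖ₑ ∂γ + ENNReal.ofReal (ε + K * h) +
          ENNReal.ofReal (K * h * (h * n)) * ∫⁻ p, ‖p.2‖ₑ ∂γ := by
        rw [lintegral_add_right _ (by fun_prop), lintegral_add_right _ (by fun_prop),
          lintegral_add_left (by fun_prop), lintegral_const_mul _ (by fun_prop),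
          lintegral_const_mul _ (by fun_prop), lintegral_finsetSum _ (fun j _ => hAm j),
          lintegral_finsetSum _ (fun j _ => by fun_prop), Finset.sum_congr rfl hA,
          Finset.sum_congr rfl hB]
        simp only [lintegral_const, measure_univ, mul_one, Finset.sum_const, Finset.card_range,
          nsmul_eq_mul]
        rw [← mul_assoc, ← mul_assoc (K * h), ENNReal.ofReal_mul (by positivity : 0 ≤ K * h * h),
          ENNReal.ofReal_natCast]
    _ ≤ _ := by gcongr

end

/-! ### Choice of the grid shift. -/

lemma sum_setLIntegral_Ico {G : ℝ → ℝ≥0∞} {h : ℝ} (hh : 0 ≤ h) (n : ℕ) :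
    ∑ j ∈ Finset.range n, ∫⁻ s in Ico ((j : ℝ) * h - h) (j * h), G s =
      ∫⁻ s in Ico (-h) (n * h - h), G s := by
  induction n with
  | zero => simp
  | succ n ih =>
    have : 0 ≤ n * h := by positivity
    rw [Finset.sum_range_succ, ih, ← lintegral_union measurableSet_Ico, Ico_union_Ico_eq_Ico]
    · push_cast; congr 2; ring_nf
    · linarith
    · linarith
    · exact Ico_disjoint_Ico_same

/-- Some grid of a given mesh undersamples a given function. -/
lemma exists_grid_sum_le {G : ℝ → ℝ≥0∞} (hG : Measurable G) (N : ℕ) (hN : 0 < N) :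
    ∃ δ ∈ Ioc (0 : ℝ) (N : ℝ)⁻¹, ENNReal.ofReal (N : ℝ)⁻¹ *
      ∑ j ∈ Finset.range (N + 1), G (grid (N : ℝ)⁻¹ δ j) ≤ ∫⁻ s in Icc (-1 : ℝ) 1, G s := by
  have hN' : (0 : ℝ) < N := by exact_mod_cast hN
  set h := (N : ℝ)⁻¹ with hdef
  have hh : 0 < h := by positivity
  have hNh : N * h = 1 := mul_inv_cancel₀ hN'.ne'
  have hh1 : h ≤ 1 := inv_le_one_of_one_le₀ (by exact_mod_cast hN)
  have hvol : volume (Ioc 0 h) = ENNReal.ofReal h := by simp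
  -- The average over the shift δ of the Riemann sum is an integral, and some shift does not exceed
  -- the average.
  obtain ⟨δ, hδ, hle⟩ := exists_le_setLAverage (μ := volume) (s := Ioc 0 h)
    (f := fun δ => ∑ j ∈ Finset.range (N + 1), G (grid h δ j))
    (by rw [hvol]; simpa using hh) (by rw [hvol]; simp)
    (by
      refine Measurable.aemeasurable (Finset.measurable_sum _ fun j _ => hG.comp ?_)
      unfold grid; fun_prop)
  refine ⟨δ, hδ, ?_⟩
  rw [setLAverage_eq, hvol] at hle
  -- As δ runs through (0, h], the j-th grid time sweeps out one cell. The cell for j = 0 lies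
  -- before time zero, which is why integrals start at -1.
  have hj : ∀ j : ℕ, ∫⁻ δ in Ioc 0 h, G (grid h δ j) =
      ∫⁻ s in Ico ((j : ℝ) * h - h) (j * h), G s := fun j => by
    have := (Measure.measurePreserving_sub_left volume ((j : ℝ) * h)).setLIntegral_comp_preimage
      (s := Ico ((j : ℝ) * h - h) (j * h)) measurableSet_Ico hG
    rw [← this]
    congr 2
    ext x
    simp only [mem_preimage, mem_Ioc, mem_Ico]
    constructor <;> rintro ⟨h1, h2⟩ <;> constructor <;> linarith
  calc ENNReal.ofReal h * ∑ j ∈ Finset.range (N + 1), G (grid h δ j)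
      ≤ ENNReal.ofReal h * ((∫⁻ δ in Ioc 0 h,
          ∑ j ∈ Finset.range (N + 1), G (grid h δ j)) / ENNReal.ofReal h) := by gcongr
    _ = ∫⁻ δ in Ioc 0 h, ∑ j ∈ Finset.range (N + 1), G (grid h δ j) :=
        ENNReal.mul_div_cancel (by simpa using hh) (by simp)
    _ = ∫⁻ s in Ico (-h) (((N + 1 : ℕ) : ℝ) * h - h), G s := by
        have hGm : ∀ j : ℕ, Measurable fun δ => G (grid h δ j) := fun j =>
          hG.comp (by unfold grid; fun_prop)
        rw [lintegral_finsetSum _ fun j _ => hGm j,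
          Finset.sum_congr rfl fun j _ => hj j, sum_setLIntegral_Ico hh.le]
    _ ≤ ∫⁻ s in Icc (-1 : ℝ) 1, G s := by
        refine lintegral_mono_set fun s hs => ⟨by linarith [hs.1], ?_⟩
        have := hs.2
        push_cast at this
        linarith

/-! ### Path space and its compact sets of Hölder paths. -/

/-- The space of continuous paths in `ℝᵈ`, with its Borel σ-algebra. -/
abbrev Path (d : ℕ) := C(Icc (0 : ℝ) 1, E d)

instance : MeasurableSpace (Path d) := borel _

instance : BorelSpace (Path d) := ⟨rfl⟩

/-- The position at time `s` of a path, which is constant outside of the unit interval. -/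
def pathAt (s : ℝ) (x : Path d) : E d := x (projIcc 0 1 zero_le_one s)

lemma continuous_uncurry_pathAt : Continuous fun q : Path d × ℝ => pathAt q.2 q.1 := by
  have h : Continuous (projIcc (0 : ℝ) 1 zero_le_one) := continuous_projIcc
  unfold pathAt
  fun_prop

lemma continuous_pathAt (s : ℝ) : Continuous (pathAt s : Path d → E d) :=
  continuous_uncurry_pathAt.comp (by fun_prop : Continuous fun x : Path d => (x, s))

/-- The defect of a path as a solution of `x' = f (t, x)`. -/
def defect (f : ℝ × E d → E d) (t : ℝ) (x : Path d) : E d :=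
  pathAt t x - pathAt 0 x - ∫ s in (0 : ℝ)..t, f (s, pathAt s x)

lemma continuous_defect {f : ℝ × E d → E d} (hf : Continuous f) (t : ℝ) :
    Continuous (defect f t) := by
  unfold defect
  refine ((continuous_pathAt t).sub (continuous_pathAt 0)).sub ?_
  refine intervalIntegral.continuous_parametric_intervalIntegral_of_continuous'
    (f := fun (x : Path d) s => f (s, pathAt s x)) ?_ 0 t
  exact hf.comp (continuous_snd.prodMk continuous_uncurry_pathAt)

/-- The paths that start in a given ball and have a given Hölder constant of order one half. -/
def holderSet (d : ℕ) (M : ℝ) : Set (Path d) :=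
  {x | ‖x 0‖ ≤ M ∧ ∀ s t, ‖x t - x s‖ ^ 2 ≤ M * dist t s}

/-- Arzelà–Ascoli. The Hölder bound forces continuity by itself, so the set is described by
pointwise conditions alone and is closed for pointwise convergence. -/
lemma isCompact_holderSet {M : ℝ} (hM : 0 ≤ M) : IsCompact (holderSet d M) := by
  have hmod : ∀ f : Icc (0 : ℝ) 1 → E d, (∀ s t, ‖f t - f s‖ ^ 2 ≤ M * dist t s) →
      ∀ s t, dist (f s) (f t) ≤ √(M * dist s t) := fun f hf s t => by
    rw [dist_eq_norm]
    exact Real.le_sqrt_of_sq_le (hf t s)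
  have hlim : Tendsto (fun r => √(M * r)) (𝓝 0) (𝓝 0) := by
    have : Continuous fun r => √(M * r) := by fun_prop
    simpa using this.tendsto 0
  refine ArzelaAscoli.isCompact_of_equicontinuous _ ?_ ?_
  · set T : Set (Icc (0 : ℝ) 1 → E d) := {f | ‖f 0‖ ≤ M ∧ ∀ s t, ‖f t - f s‖ ^ 2 ≤ M * dist t s}
    have hT : ContinuousMap.toFun '' holderSet d M = T := by
      ext f
      constructor
      · rintro ⟨x, hx, rfl⟩
        exact hx
      · intro hf
        have hc : Continuous f := by
          have := Metric.equicontinuous_of_continuity_modulus (fun r => √(M * r)) hlim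
            (fun _ : Unit => f) (fun s t _ => hmod f hf.2 s t)
          exact this.continuous ()
        exact ⟨⟨f, hc⟩, hf, rfl⟩
    rw [hT]
    have hclosed : IsClosed T := by
      have e : T = {f | ‖f 0‖ ≤ M} ∩
          ⋂ s, ⋂ t, {f | ‖f t - f s‖ ^ 2 ≤ M * dist t s} := by
        ext f; simp only [T, mem_inter_iff, mem_iInter, mem_ofPred_eq]
      rw [e]
      refine (isClosed_le (by fun_prop) (by fun_prop)).inter
        (isClosed_iInter fun s => isClosed_iInter fun t => isClosed_le (by fun_prop) (by fun_prop))
    -- The radius is M for the starting point plus √M for the Hölder increment over a time of at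
    -- most one.
    refine (isCompact_univ_pi fun _ : Icc (0 : ℝ) 1 =>
      isCompact_closedBall (0 : E d) (M + √M)).of_isClosed_subset hclosed fun f hf t _ => ?_
    have h1 := hmod f hf.2 t 0
    have h2 : √(M * dist t 0) ≤ √M := by
      refine Real.sqrt_le_sqrt ?_
      have : dist t 0 ≤ 1 := by
        rw [Subtype.dist_eq, Real.dist_eq]
        simpa [abs_of_nonneg t.2.1] using t.2.2
      exact mul_le_of_le_one_right hM this
    rw [mem_closedBall_zero_iff]
    have h3 : ‖f t‖ ≤ ‖f 0‖ + dist (f t) (f 0) := by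
      rw [dist_eq_norm]
      have := norm_add_le (f 0) (f t - f 0)
      simpa using this
    linarith [hf.1]
  · exact Metric.equicontinuous_of_continuity_modulus (fun r => √(M * r)) hlim _
      fun s t x => hmod _ x.2.2 s t

/-- The polygonal path with a given starting point and given velocities, as an element of path
space. -/
def gridPathMap (h δ : ℝ) (n : ℕ) : C(E d × (ℕ → E d), Path d) :=
  ContinuousMap.curry ⟨fun q => gridPath h δ n q.1.1 q.1.2 q.2, by unfold gridPath; fun_prop⟩

lemma pathAt_gridPathMap (h δ : ℝ) (n : ℕ) (q : E d × (ℕ → E d)) {t : ℝ}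
    (ht : t ∈ Icc (0 : ℝ) 1) : pathAt t (gridPathMap h δ n q) = gridPath h δ n q.1 q.2 t := by
  rw [pathAt, projIcc_of_mem _ ht]
  rfl

lemma defect_gridPathMap (h δ : ℝ) (n : ℕ) (q : E d × (ℕ → E d)) (f : ℝ × E d → E d) {t : ℝ}
    (ht : t ∈ Icc (0 : ℝ) 1) : defect f t (gridPathMap h δ n q) =
      gridPath h δ n q.1 q.2 t - gridPath h δ n q.1 q.2 0 -
        ∫ s in (0 : ℝ)..t, f (s, gridPath h δ n q.1 q.2 s) := by
  rw [defect, pathAt_gridPathMap _ _ _ _ ht, pathAt_gridPathMap _ _ _ _ (by simp)]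
  congr 1
  refine intervalIntegral.integral_congr fun s hs => ?_
  rw [uIcc_of_le ht.1] at hs
  rw [pathAt_gridPathMap _ _ _ _ ⟨hs.1, hs.2.trans ht.2⟩]

lemma gridPathMap_mem_holderSet {h : ℝ} (hh : 0 ≤ h) (δ : ℝ) (n : ℕ) (q : E d × (ℕ → E d)) {M : ℝ}
    (h0 : ‖gridPath h δ n q.1 q.2 0‖ ≤ M)
    (hM : h * ∑ j ∈ Finset.range n, ‖q.2 j‖ ^ 2 ≤ M) :
    gridPathMap h δ n q ∈ holderSet d M := by
  have key : ∀ s t : Icc (0 : ℝ) 1, s ≤ t →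
      ‖gridPathMap h δ n q t - gridPathMap h δ n q s‖ ^ 2 ≤ M * dist t s := fun s t hst => by
    refine (norm_gridPath_sub_sq_le hh δ n q.1 q.2 (show (s : ℝ) ≤ t from hst)).trans ?_
    have hst' : (0 : ℝ) ≤ t - s := sub_nonneg.2 hst
    rw [Subtype.dist_eq, Real.dist_eq, abs_of_nonneg hst', mul_comm]
    exact mul_le_mul_of_nonneg_right hM hst'
  refine ⟨h0, fun s t => ?_⟩
  rcases le_total s t with hst | hst
  · exact key s t hst
  · rw [norm_sub_rev, dist_comm]
    exact key t s hst

/-! ### Approximating laws on path space. -/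

/-- For every mesh there is a law on path space with the same marginal laws as the random line `γ`,
which is concentrated on Hölder paths and whose paths nearly solve the differential equation of
each of the vector fields `f i` in so far as it is close to the conditional mean velocity. -/
lemma exists_approx_law {γ : Measure (E d × E d)} [IsProbabilityMeasure γ]
    (hγ : ∫⁻ p, ‖p.2‖ₑ ^ 2 ∂γ < ⊤) {f : ℕ → ℝ × E d → E d} (hf : ∀ i, Continuous (f i))
    (hfm : ∀ i, ∫⁻ t in Icc (-1 : ℝ) 1, ∫⁻ p, ‖meanVel γ t (line t p) - f i (t, line t p)‖ₑ ∂γ ≤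
      (4 : ℝ≥0∞)⁻¹ ^ i) (N : ℕ) (hN : 0 < N) :
    ∃ P : ProbabilityMeasure (Path d),
      (∀ t ∈ Icc (0 : ℝ) 1, (P : Measure (Path d)).map (pathAt t) = γ.map (line t)) ∧
      (∀ M : ℝ, 0 < M → (P : Measure (Path d)) (holderSet d M)ᶜ ≤
        γ.map (line 0) (Metric.closedBall 0 M)ᶜ +
          2 * (∫⁻ p, ‖p.2‖ₑ ^ 2 ∂γ) / ENNReal.ofReal M) ∧
      ∀ i, ∀ t ∈ Icc (0 : ℝ) 1, ∀ ε K : ℝ, 0 ≤ ε → 0 ≤ K →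
        (∀ p q, ‖f i p - f i q‖ ≤ ε + K * (|p.1 - q.1| + ‖p.2 - q.2‖)) →
        ∫⁻ x, ‖defect (f i) t x‖ₑ ∂(P : Measure (Path d)) ≤
          ENNReal.ofReal (√(2 * (N : ℝ)⁻¹ * (4 * ∫ p, ‖p.2‖ ^ 2 ∂γ))) + 2 * (2 : ℝ≥0∞)⁻¹ ^ i +
          ENNReal.ofReal (ε + K * (N : ℝ)⁻¹) +
          ENNReal.ofReal (K * (N : ℝ)⁻¹ * 2) * ∫⁻ p, ‖p.2‖ₑ ∂γ := by
  set g : ℕ → ℝ → ℝ≥0∞ := fun i t => ∫⁻ p, ‖meanVel γ t (line t p) - f i (t, line t p)‖ₑ ∂γ with hg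
  have hgm : ∀ i, Measurable (g i) := fun i => by
    have h1 : Measurable fun q : ℝ × E d × E d => (q.1, line q.1 q.2) :=
      measurable_fst.prodMk measurable_uncurry_line
    have : Measurable fun q : ℝ × E d × E d =>
        ‖meanVel γ q.1 (line q.1 q.2) - f i (q.1, line q.1 q.2)‖ₑ :=
      (((measurable_meanVel γ).comp h1).sub ((hf i).measurable.comp h1)).enorm
    exact this.lintegral_prod_right'
  -- A single shift has to serve all the fields. The weights 2^i against errors of at most 4^(-i)
  -- keep the total integral below 2, and undoing the weight leaves an error 2 · 2^(-i) for the i-th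
  -- field.
  set G : ℝ → ℝ≥0∞ := fun t => ∑' i, (2 : ℝ≥0∞) ^ i * g i t with hG
  have hGm : Measurable G := Measurable.tsum fun i => (hgm i).const_mul _
  have hGint : ∫⁻ t in Icc (-1 : ℝ) 1, G t ≤ 2 := by
    rw [hG, lintegral_tsum fun i => ((hgm i).const_mul _).aemeasurable]
    calc ∑' i, ∫⁻ t in Icc (-1 : ℝ) 1, (2 : ℝ≥0∞) ^ i * g i t
        ≤ ∑' i, (2 : ℝ≥0∞)⁻¹ ^ i := by
          refine ENNReal.tsum_le_tsum fun i => ?_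
          rw [lintegral_const_mul _ (hgm i)]
          refine (mul_le_mul_right (hfm i) _).trans_eq ?_
          rw [← mul_pow]
          congr 1
          rw [show (4 : ℝ≥0∞) = 2 * 2 by norm_num, ENNReal.mul_inv (by simp) (by simp), ← mul_assoc,
            ENNReal.mul_inv_cancel (by simp) (by simp), one_mul]
      _ = 2 := by rw [ENNReal.tsum_geometric, ENNReal.one_sub_inv_two, inv_inv]
  obtain ⟨δ, hδ, hsum⟩ := exists_grid_sum_le hGm N hN
  have hN' : (0 : ℝ) < N := by exact_mod_cast hN
  set h := (N : ℝ)⁻¹ with hdef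
  have hh : 0 < h := by positivity
  have hNh : N * h = 1 := mul_inv_cancel₀ hN'.ne'
  have hh1 : h ≤ 1 := inv_le_one_of_one_le₀ (by exact_mod_cast hN)
  have hstart : grid h δ 0 ≤ 0 := by simp [grid, hδ.1.le]
  -- The grid starts at -δ, so one cell beyond N is needed to reach time one.
  have hend : ∀ t ∈ Icc (0 : ℝ) 1, t ≤ grid h δ (N + 1) := fun t ht => by
    simp only [grid]; push_cast; linarith [hδ.2, ht.2]
  obtain ⟨Ω, _, Q, X, V, hc⟩ := exists_isChain γ hγ (grid h δ) (N + 1)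
  have hQ := hc.prob
  have hX := hc.measurable_pos
  have hV := hc.measurable_vel
  set Φ : Ω → Path d := fun o => gridPathMap h δ (N + 1) (X 0 o, fun j => V j o) with hΦ
  have hΦm : Measurable Φ := by
    refine (gridPathMap h δ (N + 1)).continuous.measurable.comp ?_
    exact (hX 0).prodMk (measurable_pi_lambda _ hV)
  have hmarg : ∀ t ∈ Icc (0 : ℝ) 1, (Q.map Φ).map (pathAt t) = γ.map (line t) := fun t ht => by
    rw [Measure.map_map (continuous_pathAt t).measurable hΦm,
      ← hc.gridPath_law (Nat.succ_pos N) hh.le (hstart.trans ht.1) (hend t ht)]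
    refine congrArg (fun f => Q.map f) (funext fun o => ?_)
    exact pathAt_gridPathMap _ _ _ _ ht
  refine ⟨⟨Q.map Φ, Measure.isProbabilityMeasure_map hΦm.aemeasurable⟩, hmarg, fun M hM => ?_,
    fun i t ht ε K hε hK hfK => ?_⟩
  -- A path fails to be in the Hölder set only if it starts far out or if its discrete energy
  -- exceeds M. The second case is handled by Markov's inequality, with (N + 1)h ≤ 2.
  · have hsub : (holderSet d M)ᶜ ⊆ pathAt 0 ⁻¹' (Metric.closedBall 0 M)ᶜ ∪
        {x | x ∉ holderSet d M ∧ ‖pathAt 0 x‖ ≤ M} := fun x hx => by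
      by_cases h : ‖pathAt 0 x‖ ≤ M
      · exact Or.inr ⟨hx, h⟩
      · exact Or.inl (by simpa using h)
    have hcl : MeasurableSet (holderSet d M) := (isCompact_holderSet hM.le).measurableSet
    have hm0 := (continuous_pathAt (d := d) 0).measurable
    have hms : MeasurableSet {x : Path d | x ∉ holderSet d M ∧ ‖pathAt 0 x‖ ≤ M} :=
      hcl.compl.inter (measurableSet_le hm0.norm measurable_const)
    have hW : ∫⁻ o, ENNReal.ofReal h * ∑ j ∈ Finset.range (N + 1), ‖V j o‖ₑ ^ 2 ∂Q ≤
        2 * ∫⁻ p, ‖p.2‖ₑ ^ 2 ∂γ := by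
      rw [lintegral_const_mul _ (by fun_prop), lintegral_finsetSum _ (fun j _ => by fun_prop),
        Finset.sum_congr rfl fun j hj => hc.lintegral_comp (Finset.mem_range.1 hj)
          (f := fun q => ‖q.2‖ₑ ^ 2) (by fun_prop)]
      simp only [Finset.sum_const, Finset.card_range, nsmul_eq_mul]
      rw [← mul_assoc]
      gcongr
      rw [← ENNReal.ofReal_natCast, ← ENNReal.ofReal_mul hh.le, ← ENNReal.ofReal_ofNat]
      refine ENNReal.ofReal_le_ofReal ?_
      push_cast
      linarith
    refine (measure_mono hsub).trans ((measure_union_le _ _).trans (add_le_add ?_ ?_))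
    · rw [← hmarg 0 (by simp),
        Measure.map_apply hm0 Metric.isClosed_closedBall.measurableSet.compl]
      rfl
    · refine le_trans ?_ (ENNReal.div_le_div_right hW _)
      refine le_trans ?_ (meas_ge_le_lintegral_div (by fun_prop) (by simpa using hM) (by simp))
      change (Q.map Φ) _ ≤ _
      rw [Measure.map_apply hΦm hms]
      refine measure_mono fun o ho => ?_
      by_contra hlt
      refine ho.1 (gridPathMap_mem_holderSet hh.le δ (N + 1) _ ?_ ?_)
      · have := ho.2
        rwa [hΦ, pathAt_gridPathMap _ _ _ _ (by simp)] at this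
      · simp only [mem_ofPred_eq, not_le] at hlt
        have h1 : ENNReal.ofReal (h * ∑ j ∈ Finset.range (N + 1), ‖V j o‖ ^ 2) <
            ENNReal.ofReal M := by
          rw [ENNReal.ofReal_mul hh.le, ENNReal.ofReal_sum_of_nonneg fun _ _ => by positivity]
          simpa only [ENNReal.ofReal_pow (norm_nonneg _), ofReal_norm] using hlt
        exact (ENNReal.ofReal_lt_ofReal_iff hM).1 h1 |>.le
  · have hd : Measurable (defect (f i) t : Path d → E d) := (continuous_defect (hf i) t).measurable
    change ∫⁻ x, ‖defect (f i) t x‖ₑ ∂(Q.map Φ) ≤ _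
    rw [lintegral_map hd.enorm hΦm]
    simp only [hΦ, defect_gridPathMap _ _ _ _ _ ht]
    refine (hc.lintegral_defect_le hγ hh.le (hf i) hε hK hfK ht hstart (hend t ht)).trans ?_
    have hn2 : h * ((N + 1 : ℕ) : ℝ) ≤ 2 := by push_cast; linarith
    have hC : 0 ≤ ∫ p, ‖p.2‖ ^ 2 ∂γ := integral_nonneg fun p => by positivity
    have e1 : ((N + 1 : ℕ) : ℝ) * h ^ 2 ≤ 2 * h := by
      have := mul_le_mul_of_nonneg_right hn2 hh.le
      linarith
    have e2 : ENNReal.ofReal h * ∑ j ∈ Finset.range (N + 1), g i (grid h δ j) ≤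
        2 * (2 : ℝ≥0∞)⁻¹ ^ i := by
      have h1 : ∀ t, g i t ≤ (2 : ℝ≥0∞)⁻¹ ^ i * G t := fun t => by
        have h2 : (2 : ℝ≥0∞) ^ i * g i t ≤ G t :=
          ENNReal.le_tsum (f := fun i => (2 : ℝ≥0∞) ^ i * g i t) i
        calc g i t = (2 : ℝ≥0∞)⁻¹ ^ i * ((2 : ℝ≥0∞) ^ i * g i t) := by
              rw [← mul_assoc, ← mul_pow, ENNReal.inv_mul_cancel (by simp) (by simp), one_pow,
                one_mul]
          _ ≤ _ := by gcongr
      calc ENNReal.ofReal h * ∑ j ∈ Finset.range (N + 1), g i (grid h δ j)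
          ≤ ENNReal.ofReal h * ∑ j ∈ Finset.range (N + 1), (2 : ℝ≥0∞)⁻¹ ^ i * G (grid h δ j) := by
            gcongr with j
            exact h1 _
        _ = (ENNReal.ofReal h * ∑ j ∈ Finset.range (N + 1), G (grid h δ j)) * (2 : ℝ≥0∞)⁻¹ ^ i := by
            rw [← Finset.mul_sum]; ring
        _ ≤ 2 * (2 : ℝ≥0∞)⁻¹ ^ i := by gcongr; exact hsum.trans hGint
    gcongr

lemma enorm_le_one_add_sq {F : Type*} [NormedAddCommGroup F] (x : F) : ‖x‖ₑ ≤ 1 + ‖x‖ₑ ^ 2 := by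
  rcases le_total ‖x‖ₑ 1 with h | h
  · exact h.trans le_self_add
  · calc ‖x‖ₑ = ‖x‖ₑ * 1 := (mul_one _).symm
      _ ≤ ‖x‖ₑ * ‖x‖ₑ := by gcongr
      _ ≤ 1 + ‖x‖ₑ ^ 2 := by rw [sq]; exact le_add_self

lemma measurable_meanVel_line (γ : Measure (E d × E d)) [IsProbabilityMeasure γ] :
    Measurable fun q : ℝ × E d × E d => meanVel γ q.1 (line q.1 q.2) :=
  (measurable_meanVel γ).comp (measurable_fst.prodMk measurable_uncurry_line)

section
variable {γ : Measure (E d × E d)} [IsProbabilityMeasure γ]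

lemma lintegral_meanVel_le (t : ℝ) :
    ∫⁻ p, ‖meanVel γ t (line t p)‖ₑ ∂γ ≤ 1 + ∫⁻ p, ‖p.2‖ₑ ^ 2 ∂γ := by
  have hm := measurable_meanVel_apply γ t
  calc ∫⁻ p, ‖meanVel γ t (line t p)‖ₑ ∂γ
      ≤ ∫⁻ p, (1 + ‖meanVel γ t (line t p)‖ₑ ^ 2) ∂γ :=
        lintegral_mono fun p => enorm_le_one_add_sq _
    _ = 1 + ∫⁻ p, ‖meanVel γ t (line t p)‖ₑ ^ 2 ∂γ := by
        rw [lintegral_add_left measurable_const]; simp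
    _ ≤ _ := add_le_add le_rfl (lintegral_meanVel_sq_le γ t)

/-- The conditional mean velocity is approximated in mean by compactly supported continuous
vector fields. -/
lemma exists_approx_meanVel (hγ : ∫⁻ p, ‖p.2‖ₑ ^ 2 ∂γ < ⊤) {η : ℝ≥0∞} (hη : η ≠ 0) :
    ∃ f : ℝ × E d → E d, HasCompactSupport f ∧ Continuous f ∧
      ∫⁻ t in Icc (-1 : ℝ) 1, ∫⁻ p, ‖meanVel γ t (line t p) - f (t, line t p)‖ₑ ∂γ ≤ η := by
  set lam : Measure ℝ := volume.restrict (Icc (-1 : ℝ) 1) with hlam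
  have hφ : Measurable fun q : ℝ × E d × E d => (q.1, line q.1 q.2) :=
    measurable_fst.prodMk measurable_uncurry_line
  -- Compactly supported continuous fields are dense in L¹ of this space-time law. Times down to -1
  -- are included because the resampling starts before time zero.
  set ν : Measure (ℝ × E d) := (lam.prod γ).map fun q => (q.1, line q.1 q.2) with hν
  have hfin : IsFiniteMeasure ν := by rw [hν]; infer_instance
  have hint : Integrable (Function.uncurry (meanVel γ)) ν := by
    refine ⟨(measurable_meanVel γ).aestronglyMeasurable, ?_⟩
    have hm : Measurable fun q : ℝ × E d × E d =>
        ‖Function.uncurry (meanVel γ) (q.1, line q.1 q.2)‖ₑ :=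
      ((measurable_meanVel γ).comp hφ).enorm
    rw [hasFiniteIntegral_iff_enorm, hν, lintegral_map (measurable_meanVel γ).enorm hφ,
      lintegral_prod _ hm.aemeasurable]
    calc ∫⁻ t, ∫⁻ p, ‖meanVel γ t (line t p)‖ₑ ∂γ ∂lam
        ≤ ∫⁻ _, (1 + ∫⁻ p, ‖p.2‖ₑ ^ 2 ∂γ) ∂lam := lintegral_mono fun t => lintegral_meanVel_le t
      _ < ⊤ := by
        rw [lintegral_const]
        exact ENNReal.mul_lt_top (by simp [hγ]) (measure_lt_top _ _)
  obtain ⟨f, hfc, hfi, hf, -⟩ := hint.exists_hasCompactSupport_lintegral_sub_le hη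
  refine ⟨f, hfc, hf, le_of_eq_of_le ?_ hfi⟩
  have hm : Measurable fun q : ℝ × E d => ‖Function.uncurry (meanVel γ) q - f q‖ₑ :=
    ((measurable_meanVel γ).sub hf.measurable).enorm
  have hm' : Measurable fun q : ℝ × E d × E d => ‖Function.uncurry (meanVel γ) (q.1, line q.1 q.2) -
      f (q.1, line q.1 q.2)‖ₑ := hm.comp hφ
  rw [hν, lintegral_map hm hφ, lintegral_prod _ hm'.aemeasurable]
  rfl

end

/-- A uniformly continuous bounded function is Lipschitz up to an arbitrarily small error. -/
lemma exists_modulus {f : ℝ × E d → E d} (hf : Continuous f) (hfc : HasCompactSupport f) {ε : ℝ}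
    (hε : 0 < ε) : ∃ K : ℝ, 0 ≤ K ∧
      ∀ p q, ‖f p - f q‖ ≤ ε + K * (|p.1 - q.1| + ‖p.2 - q.2‖) := by
  obtain ⟨C, hC⟩ := hfc.exists_bound_of_continuous hf
  have hC0 : 0 ≤ C := (norm_nonneg _).trans (hC 0)
  obtain ⟨δ, hδ, h⟩ := Metric.uniformContinuous_iff.1 (hfc.uniformContinuous_of_continuous hf) ε hε
  refine ⟨2 * C / δ, by positivity, fun p q => ?_⟩
  have h0 : 0 ≤ |p.1 - q.1| + ‖p.2 - q.2‖ := by positivity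
  have hd : dist p q ≤ |p.1 - q.1| + ‖p.2 - q.2‖ := by
    rw [Prod.dist_eq, Real.dist_eq, dist_eq_norm]
    exact max_le (by linarith [norm_nonneg (p.2 - q.2)]) (by linarith [abs_nonneg (p.1 - q.1)])
  by_cases hpq : dist p q < δ
  · have h1 := (h hpq).le
    rw [dist_eq_norm] at h1
    have : 0 ≤ 2 * C / δ * (|p.1 - q.1| + ‖p.2 - q.2‖) := by positivity
    linarith
  · have h2 : ‖f p - f q‖ ≤ 2 * C := by
      have := norm_sub_le (f p) (f q)
      linarith [hC p, hC q]
    have h3 : 2 * C ≤ 2 * C / δ * (|p.1 - q.1| + ‖p.2 - q.2‖) := by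
      rw [div_mul_eq_mul_div, le_div_iff₀ hδ]
      have : δ ≤ |p.1 - q.1| + ‖p.2 - q.2‖ := (not_lt.1 hpq).trans hd
      gcongr
    linarith

/-! ### Passage to the limit and the superposition principle. -/

section
variable {γ : Measure (E d × E d)} [IsProbabilityMeasure γ]

/-- One finite measure controls all the starting points, and its mass outside large balls tends to
zero; so does C / M. -/
lemma isTightMeasureSet_of_holderSet {S : Set (Measure (Path d))} {ν : Measure (E d)}
    [IsFiniteMeasure ν] {C : ℝ≥0∞} (hC : C ≠ ⊤)
    (h : ∀ P ∈ S, ∀ M : ℝ, 0 < M → P (holderSet d M)ᶜ ≤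
      ν (Metric.closedBall 0 M)ᶜ + C / ENNReal.ofReal M) : IsTightMeasureSet S := by
  rw [isTightMeasureSet_iff_exists_isCompact_measure_compl_le]
  intro ε hε
  have hlim : Tendsto (fun M : ℝ => ν (Metric.closedBall 0 M)ᶜ + C / ENNReal.ofReal M) atTop
      (𝓝 0) := by
    have h1 : Tendsto (fun M : ℝ => ν (Metric.closedBall 0 M)ᶜ) atTop (𝓝 0) := by
      have := tendsto_measure_compl_closedBall_of_isTightMeasureSet
        (isTightMeasureSet_singleton (μ := ν)) (0 : E d)
      simpa using this
    have h2 : Tendsto (fun M : ℝ => C / ENNReal.ofReal M) atTop (𝓝 0) := by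
      simpa using ENNReal.Tendsto.const_div ENNReal.tendsto_ofReal_atTop (Or.inr hC)
    simpa using h1.add h2
  obtain ⟨M, hM, hM0⟩ := ((hlim.eventually_lt_const hε).and (eventually_gt_atTop 0)).exists
  exact ⟨holderSet d M, isCompact_holderSet hM0.le, fun P hP => (h P hP M hM0).trans hM.le⟩

@[fun_prop]
lemma measurable_uncurry_pathAt : Measurable fun q : Path d × ℝ => pathAt q.2 q.1 :=
  measurable_uncurry_of_continuous_of_measurable (u := fun (s : ℝ) (x : Path d) => pathAt s x)
    (fun x => continuous_uncurry_pathAt.comp (by fun_prop : Continuous fun s : ℝ => (x, s)))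
    (fun s => (continuous_pathAt s).measurable) |>.comp measurable_swap

lemma measurable_comp_pathAt {F : Type*} [MeasurableSpace F] {f : ℝ × E d → F}
    (hf : Measurable f) : Measurable fun q : Path d × ℝ => f (q.2, pathAt q.2 q.1) :=
  hf.comp (measurable_snd.prodMk measurable_uncurry_pathAt)

lemma measurable_defect {f : ℝ × E d → E d} (hf : Measurable f) {t : ℝ} (ht : 0 ≤ t) :
    Measurable (defect f t) := by
  refine ((continuous_pathAt t).measurable.sub (continuous_pathAt 0).measurable).sub ?_
  simp only [intervalIntegral.integral_of_le ht]
  exact ((measurable_comp_pathAt hf).stronglyMeasurable.integral_prod_right'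
    (ν := volume.restrict (Ioc 0 t))).measurable

omit [IsProbabilityMeasure γ] in
lemma lintegral_pathAt {P : Measure (Path d)} [IsProbabilityMeasure P]
    (hP : ∀ t ∈ Icc (0 : ℝ) 1, P.map (pathAt t) = γ.map (line t)) {g : ℝ × E d → ℝ≥0∞}
    (hg : Measurable g) :
    ∫⁻ x, (∫⁻ s in Icc (0 : ℝ) 1, g (s, pathAt s x)) ∂P =
      ∫⁻ s in Icc (0 : ℝ) 1, ∫⁻ p, g (s, line s p) ∂γ := by
  rw [lintegral_lintegral_swap (measurable_comp_pathAt hg).aemeasurable]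
  refine setLIntegral_congr_fun measurableSet_Icc fun s hs => ?_
  have h1 : Measurable fun y => g (s, y) := hg.comp measurable_prodMk_left
  rw [← lintegral_map h1 (continuous_pathAt s).measurable, hP s hs,
    lintegral_map h1 (measurable_line s)]

lemma ae_intervalIntegrable_meanVel (hγ : ∫⁻ p, ‖p.2‖ₑ ^ 2 ∂γ < ⊤) {P : Measure (Path d)}
    [IsProbabilityMeasure P] (hP : ∀ t ∈ Icc (0 : ℝ) 1, P.map (pathAt t) = γ.map (line t)) :
    ∀ᵐ x ∂P, IntegrableOn (fun s => meanVel γ s (pathAt s x)) (Icc 0 1) := by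
  have hm : Measurable fun q : ℝ × E d => ‖Function.uncurry (meanVel γ) q‖ₑ :=
    (measurable_meanVel γ).enorm
  have h : ∫⁻ x, (∫⁻ s in Icc (0 : ℝ) 1, ‖meanVel γ s (pathAt s x)‖ₑ) ∂P < ⊤ := by
    refine (lintegral_pathAt hP hm).trans_lt ?_
    calc ∫⁻ s in Icc (0 : ℝ) 1, ∫⁻ p, ‖meanVel γ s (line s p)‖ₑ ∂γ
        ≤ ∫⁻ _ in Icc (0 : ℝ) 1, (1 + ∫⁻ p, ‖p.2‖ₑ ^ 2 ∂γ) :=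
          lintegral_mono fun t => lintegral_meanVel_le t
      _ < ⊤ := by simp [hγ]
  have hm2 := (measurable_comp_pathAt hm).lintegral_prod_right' (ν := volume.restrict (Icc 0 1))
  filter_upwards [ae_lt_top hm2 h.ne] with x hx
  refine ⟨?_, hx⟩
  exact ((measurable_comp_pathAt (measurable_meanVel γ)).comp
    measurable_prodMk_left).aestronglyMeasurable

/-- There is a law on path space with the same marginal laws as the random line `γ` whose paths
follow the conditional mean velocity. -/
theorem exists_limit_law (hγ : ∫⁻ p, ‖p.2‖ₑ ^ 2 ∂γ < ⊤) :
    ∃ P : Measure (Path d), IsProbabilityMeasure P ∧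
      (∀ t ∈ Icc (0 : ℝ) 1, P.map (pathAt t) = γ.map (line t)) ∧
      ∀ t ∈ Icc (0 : ℝ) 1, ∀ᵐ x ∂P, defect (Function.uncurry (meanVel γ)) t x = 0 := by
  have hex : ∀ i : ℕ, (4 : ℝ≥0∞)⁻¹ ^ i ≠ 0 := fun i => pow_ne_zero _ (by simp)
  choose f hfc hf hfm using fun i => exists_approx_meanVel hγ (hex i)
  choose P hP1 hP2 hP3 using fun N : ℕ => exists_approx_law hγ hf hfm (N + 1) N.succ_pos
  have : IsProbabilityMeasure (γ.map (line 0)) :=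
    Measure.isProbabilityMeasure_map (measurable_line 0).aemeasurable
  have htight : IsTightMeasureSet {(μ : Measure (Path d)) | μ ∈ range P} := by
    refine isTightMeasureSet_of_holderSet (ν := γ.map (line 0))
      (C := 2 * (∫⁻ p, ‖p.2‖ₑ ^ 2 ∂γ)) (ENNReal.mul_ne_top (by simp) hγ.ne) ?_
    rintro _ ⟨_, ⟨N, rfl⟩, rfl⟩ M hM
    exact hP2 N M hM
  -- Compactness gives a limit along an ultrafilter finer than `atTop`; no subsequence has to be
  -- extracted.
  set U : Ultrafilter ℕ := Ultrafilter.of atTop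
  have hU : (U : Filter ℕ) ≤ atTop := Ultrafilter.of_le _
  obtain ⟨P', -, hP'⟩ := (isCompact_closure_of_isTightMeasureSet htight).ultrafilter_le_nhds
    (U.map P) (by
      rw [le_principal_iff]
      exact mem_map.2 (Eventually.of_forall fun N => subset_closure (mem_range_self N)))
  have hlim : Tendsto P U (𝓝 P') := hP'
  have hmarg : ∀ t ∈ Icc (0 : ℝ) 1, (P' : Measure (Path d)).map (pathAt t) = γ.map (line t) := by
    intro t ht
    have : IsFiniteMeasure ((P' : Measure (Path d)).map (pathAt t)) := inferInstance
    refine ext_of_forall_lintegral_eq_of_IsFiniteMeasure fun g => ?_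
    have h1 := ProbabilityMeasure.tendsto_iff_forall_lintegral_tendsto.1 hlim
      (g.compContinuous ⟨pathAt t, continuous_pathAt t⟩)
    have hgm : Measurable fun y => (g y : ℝ≥0∞) := g.continuous.measurable.coe_nnreal_ennreal
    have h2 : ∀ N, ∫⁻ x, (g.compContinuous ⟨pathAt t, continuous_pathAt t⟩ x : ℝ≥0∞)
        ∂(P N : Measure (Path d)) = ∫⁻ y, g y ∂γ.map (line t) := fun N => by
      rw [← hP1 N t ht, lintegral_map hgm (continuous_pathAt t).measurable]
      rfl
    simp only [h2] at h1
    rw [lintegral_map hgm (continuous_pathAt t).measurable]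
    exact (tendsto_nhds_unique h1 tendsto_const_nhds)
  refine ⟨P', inferInstance, hmarg, fun t ht => ?_⟩
  -- the truncated defect for the approximating fields
  have hcont : ∀ i, Continuous fun x : Path d => min 1 ‖defect (f i) t x‖₊ := fun i => by
    have := continuous_defect (hf i) t
    fun_prop
  -- For a continuous field the defect is continuous on path space, and truncation at one makes it a
  -- bounded test function for weak convergence.
  have hbound : ∀ i, ∫⁻ x, min 1 ‖defect (f i) t x‖ₑ ∂(P' : Measure (Path d)) ≤
      2 * (2 : ℝ≥0∞)⁻¹ ^ i := fun i => by
    set F : BoundedContinuousFunction (Path d) ℝ≥0 :=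
      BoundedContinuousFunction.mkOfBound ⟨_, hcont i⟩ 1 (fun x y => by
        rw [NNReal.dist_eq, abs_le]
        have h1 := (min 1 ‖defect (f i) t x‖₊).2
        have h2 := (min 1 ‖defect (f i) t y‖₊).2
        have h3 : ((min 1 ‖defect (f i) t x‖₊ : ℝ≥0) : ℝ) ≤ 1 := by exact_mod_cast min_le_left _ _
        have h4 : ((min 1 ‖defect (f i) t y‖₊ : ℝ≥0) : ℝ) ≤ 1 := by exact_mod_cast min_le_left _ _
        constructor <;> simp only [ContinuousMap.coe_mk] <;> linarith) with hF
    have hFe : ∀ x, (F x : ℝ≥0∞) = min 1 ‖defect (f i) t x‖ₑ := fun x => by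
      simp [hF, enorm_eq_nnnorm]
    have h1 := ProbabilityMeasure.tendsto_iff_forall_lintegral_tendsto.1 hlim F
    simp only [hFe] at h1
    refine ENNReal.le_of_forall_pos_le_add fun ε hε _ => ?_
    -- The constant K depends on ε, so the mesh goes to zero with ε fixed, and ε goes to zero last.
    obtain ⟨K, hK, hfK⟩ := exists_modulus (hf i) (hfc i) (NNReal.coe_pos.2 hε)
    have h0 : Tendsto (fun N : ℕ => ((N + 1 : ℕ) : ℝ)⁻¹) U (𝓝 0) :=
      ((tendsto_inv_atTop_nhds_zero_nat (𝕜 := ℝ)).comp (tendsto_add_atTop_nat 1)).mono_left hU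
    have hV : ∫⁻ p, ‖p.2‖ₑ ∂γ ≠ ⊤ := by
      have := (memLp_snd hγ).integrable (by norm_num)
      exact this.2.ne
    have h2 : Tendsto (fun N : ℕ =>
        ENNReal.ofReal (√(2 * ((N + 1 : ℕ) : ℝ)⁻¹ * (4 * ∫ p, ‖p.2‖ ^ 2 ∂γ))) +
          2 * (2 : ℝ≥0∞)⁻¹ ^ i + ENNReal.ofReal (ε + K * ((N + 1 : ℕ) : ℝ)⁻¹) +
          ENNReal.ofReal (K * ((N + 1 : ℕ) : ℝ)⁻¹ * 2) * ∫⁻ p, ‖p.2‖ₑ ∂γ) U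
        (𝓝 (0 + 2 * (2 : ℝ≥0∞)⁻¹ ^ i + ε + 0)) := by
      refine ((Tendsto.add ?_ tendsto_const_nhds).add ?_).add ?_
      · have := ENNReal.tendsto_ofReal
          (((h0.const_mul 2).mul_const (4 * ∫ p, ‖p.2‖ ^ 2 ∂γ)).sqrt)
        simpa using this
      · have := ENNReal.tendsto_ofReal ((h0.const_mul K).const_add (ε : ℝ))
        simpa using this
      · have := ENNReal.Tendsto.mul_const
          (ENNReal.tendsto_ofReal ((h0.const_mul K).mul_const 2)) (Or.inr hV)
        simpa using this
    have h3 := le_of_tendsto_of_tendsto h1 h2 (Eventually.of_forall fun N =>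
      (lintegral_mono fun x => min_le_right _ _).trans (hP3 N i t ht ε K ε.2 hK hfK))
    simpa using h3
  have hm := measurable_meanVel γ
  -- Replacing the i-th field by `meanVel γ` costs at most 4^(-i) in mean. Only the marginals of the
  -- limit law enter, and these are those of the line.
  have hfinal : ∀ i, ∫⁻ x, min 1 ‖defect (Function.uncurry (meanVel γ)) t x‖ₑ
      ∂(P' : Measure (Path d)) ≤ 2 * (2 : ℝ≥0∞)⁻¹ ^ i + (4 : ℝ≥0∞)⁻¹ ^ i := fun i => by
    have hdm : Measurable fun q : ℝ × E d => ‖Function.uncurry (meanVel γ) q - f i q‖ₑ :=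
      (hm.sub (hf i).measurable).enorm
    have hpt : ∀ᵐ x ∂(P' : Measure (Path d)),
        min 1 ‖defect (Function.uncurry (meanVel γ)) t x‖ₑ ≤ min 1 ‖defect (f i) t x‖ₑ +
          ∫⁻ s in Icc (0 : ℝ) 1, ‖meanVel γ s (pathAt s x) - f i (s, pathAt s x)‖ₑ := by
      filter_upwards [ae_intervalIntegrable_meanVel hγ hmarg] with x hx
      have hI : IntervalIntegrable (fun s => meanVel γ s (pathAt s x)) volume 0 t := by
        rw [intervalIntegrable_iff_integrableOn_Icc_of_le ht.1]
        exact hx.mono_set (Icc_subset_Icc_right ht.2)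
      have hJ : IntervalIntegrable (fun s => f i (s, pathAt s x)) volume 0 t := by
        refine Continuous.intervalIntegrable ?_ _ _
        exact (hf i).comp (continuous_id.prodMk
          (continuous_uncurry_pathAt.comp (by fun_prop : Continuous fun s : ℝ => (x, s))))
      have e : defect (Function.uncurry (meanVel γ)) t x = defect (f i) t x -
          ∫ s in (0 : ℝ)..t, (meanVel γ s (pathAt s x) - f i (s, pathAt s x)) := by
        rw [intervalIntegral.integral_sub hI hJ]
        simp only [defect, Function.uncurry_apply_pair]
        abel
      have h1 : ‖∫ s in (0 : ℝ)..t, (meanVel γ s (pathAt s x) - f i (s, pathAt s x))‖ₑ ≤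
          ∫⁻ s in Icc (0 : ℝ) 1, ‖meanVel γ s (pathAt s x) - f i (s, pathAt s x)‖ₑ := by
        rw [intervalIntegral.integral_of_le ht.1]
        refine (enorm_integral_le_lintegral_enorm _).trans (lintegral_mono_set ?_)
        exact Ioc_subset_Icc_self.trans (Icc_subset_Icc_right ht.2)
      have h2 : ‖defect (Function.uncurry (meanVel γ)) t x‖ₑ ≤ ‖defect (f i) t x‖ₑ +
          ∫⁻ s in Icc (0 : ℝ) 1, ‖meanVel γ s (pathAt s x) - f i (s, pathAt s x)‖ₑ := by
        rw [e]
        exact (enorm_sub_le).trans (add_le_add le_rfl h1)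
      rcases le_total 1 ‖defect (f i) t x‖ₑ with h3 | h3
      · rw [min_eq_left h3]
        exact (min_le_left _ _).trans le_self_add
      · rw [min_eq_right h3]
        exact (min_le_right _ _).trans h2
    refine (lintegral_mono_ae hpt).trans ?_
    have hdf : Measurable (defect (f i) t) := measurable_defect (hf i).measurable ht.1
    rw [lintegral_add_left (measurable_const.min hdf.enorm)]
    refine add_le_add (hbound i) ?_
    have := lintegral_pathAt hmarg hdm
    refine this.trans_le (le_trans (lintegral_mono_set ?_) (hfm i))
    exact Icc_subset_Icc_left (by norm_num)
  have hzero : ∫⁻ x, min 1 ‖defect (Function.uncurry (meanVel γ)) t x‖ₑ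
      ∂(P' : Measure (Path d)) = 0 := by
    have h1 : Tendsto (fun i : ℕ => 2 * (2 : ℝ≥0∞)⁻¹ ^ i + (4 : ℝ≥0∞)⁻¹ ^ i) atTop
        (𝓝 (2 * 0 + 0)) := by
      refine Tendsto.add (ENNReal.Tendsto.const_mul ?_ (Or.inr (by simp))) ?_
      · exact ENNReal.tendsto_pow_atTop_nhds_zero_of_lt_one (by simp)
      · refine ENNReal.tendsto_pow_atTop_nhds_zero_of_lt_one ?_
        rw [ENNReal.inv_lt_one]; norm_num
    simpa using ge_of_tendsto' h1 hfinal
  have hdm := measurable_defect hm ht.1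
  rw [lintegral_eq_zero_iff (measurable_const.min hdm.enorm)] at hzero
  filter_upwards [hzero] with x hx
  simpa using hx

/-- A random line with square integrable velocity can be replaced by a process with the same
marginal laws that follows the conditional mean velocity. -/
theorem produces_of_ae_eq_meanVel (hγ : ∫⁻ p, ‖p.2‖ₑ ^ 2 ∂γ < ⊤) {b : ℝ → E d → E d}
    (hb : Measurable (Function.uncurry b))
    (hbm : ∀ᵐ t ∂volume.restrict (Icc (0 : ℝ) 1), ∀ᵐ p ∂γ, b t (line t p) = meanVel γ t (line t p))
    {ρ : ℝ → Measure (E d)} (hρ : ∀ t ∈ Icc (0 : ℝ) 1, ρ t = γ.map (line t)) :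
    Produces b ρ := by
  obtain ⟨P, hP, hmarg, hdef⟩ := exists_limit_law hγ
  have hm := measurable_meanVel γ
  refine ⟨Path d, inferInstance, P, pathAt, hP, fun t _ => (continuous_pathAt t).measurable, ?_,
    fun t ht => (hmarg t ht).trans (hρ t ht).symm⟩
  -- Agreement of the fields at almost every time depends only on the marginal laws; Fubini turns it
  -- into agreement along almost every path.
  have hcongr : ∀ᵐ x ∂P, ∀ᵐ s ∂volume.restrict (Icc (0 : ℝ) 1),
      b s (pathAt s x) = meanVel γ s (pathAt s x) := by
    rw [Measure.ae_ae_comm (p := fun x s => b s (pathAt s x) = meanVel γ s (pathAt s x))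
      (measurableSet_eq_fun (measurable_comp_pathAt hb)
      (measurable_comp_pathAt hm))]
    filter_upwards [hbm, ae_restrict_mem measurableSet_Icc] with s hs hs'
    have hset : MeasurableSet {y : E d | b s y = meanVel γ s y} :=
      measurableSet_eq_fun (hb.comp measurable_prodMk_left) (hm.comp measurable_prodMk_left)
    refine ae_of_ae_map (continuous_pathAt s).measurable.aemeasurable
      (p := fun y => b s y = meanVel γ s y) ?_
    rw [hmarg s hs', ae_map_iff (measurable_line s).aemeasurable hset]
    exact hs
  -- The null set of vanishing defect depends on t. Countably many dense times share one null set,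
  -- and continuity of the defect in t gives the others.
  have hcount : ∀ᵐ x ∂P, ∀ i : ℕ, defect (Function.uncurry (meanVel γ))
      (TopologicalSpace.denseSeq (Icc (0 : ℝ) 1) i : ℝ) x = 0 :=
    ae_all_iff.2 fun i => hdef _ (Subtype.coe_prop _)
  filter_upwards [hcongr, hcount, ae_intervalIntegrable_meanVel hγ hmarg] with x hx1 hx2 hx3
  have hcont : Continuous fun t : Icc (0 : ℝ) 1 =>
      defect (Function.uncurry (meanVel γ)) (t : ℝ) x := by
    have h1 : ContinuousOn (fun t => ∫ s in (0 : ℝ)..t, meanVel γ s (pathAt s x)) (Icc 0 1) := by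
      have := intervalIntegral.continuousOn_primitive_interval (a := 0) (b := 1) (μ := volume)
        (f := fun s => meanVel γ s (pathAt s x)) (by rwa [uIcc_of_le zero_le_one])
      rwa [uIcc_of_le zero_le_one] at this
    have h2 : Continuous fun t : Icc (0 : ℝ) 1 => pathAt (t : ℝ) x :=
      continuous_uncurry_pathAt.comp
        (by fun_prop : Continuous fun s : Icc (0 : ℝ) 1 => (x, (s : ℝ)))
    exact (h2.sub continuous_const).sub (continuousOn_iff_continuous_domRestrict.1 h1)
  have hall : (fun t : Icc (0 : ℝ) 1 => defect (Function.uncurry (meanVel γ)) (t : ℝ) x) =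
      fun _ => 0 :=
    (TopologicalSpace.denseRange_denseSeq _).equalizer hcont continuous_const
      (funext fun i => hx2 i)
  refine ⟨?_, fun t ht => ?_⟩
  · rw [intervalIntegrable_iff_integrableOn_Icc_of_le zero_le_one]
    exact hx3.congr (hx1.mono fun s hs => hs.symm)
  · have h1 := congrFun hall ⟨t, ht⟩
    simp only [defect, Function.uncurry_apply_pair, sub_eq_zero] at h1
    have h2 : ∫ s in (0 : ℝ)..t, b s (pathAt s x) =
        ∫ s in (0 : ℝ)..t, meanVel γ s (pathAt s x) := by
      rw [intervalIntegral.integral_of_le ht.1, intervalIntegral.integral_of_le ht.1]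
      refine integral_congr_ae (ae_restrict_of_ae_restrict_of_subset ?_ hx1)
      exact Ioc_subset_Icc_self.trans (Icc_subset_Icc_right ht.2)
    rw [h2, ← h1]
    abel

end

/-! ### Optimal flows move along straight lines. -/

/-- A process that realizes a flow can be taken to be jointly measurable. -/
lemma Produces.exists_measurable {u : ℝ → E d → E d} {ρ : ℝ → Measure (E d)}
    (h : Produces u ρ) : ∃ (Ω : Type) (_ : MeasurableSpace Ω) (Q : Measure Ω) (Y : ℝ → Ω → E d),
      IsProbabilityMeasure Q ∧ Measurable (Function.uncurry Y) ∧
      (∀ᵐ o ∂Q, IntervalIntegrable (fun s => u s (Y s o)) volume 0 1 ∧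
        ∀ t ∈ Icc (0 : ℝ) 1, Y t o = Y 0 o + ∫ s in (0 : ℝ)..t, u s (Y s o)) ∧
      ∀ t ∈ Icc (0 : ℝ) 1, Q.map (Y t) = ρ t := by
  classical
  obtain ⟨Ω, _, Q, X, hQ, hX, hpath, hlaw⟩ := h
  obtain ⟨S, hSQ, hSm, hS⟩ := hpath.exists_measurable_mem
  -- On the exceptional null set the path is frozen at its starting point, so that all paths are
  -- continuous; with measurability at each time this gives joint measurability.
  set Y : ℝ → Ω → E d := fun t o => if o ∈ S then X (projIcc 0 1 zero_le_one t) o else X 0 o with hY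
  have hX' : ∀ t : Icc (0 : ℝ) 1, Measurable (X t) := fun t => hX t t.2
  have hYm : ∀ t, Measurable (Y t) := fun t =>
    Measurable.ite hSm (hX' _) (hX 0 (by simp))
  have hYc : ∀ o, Continuous fun t => Y t o := fun o => by
    by_cases ho : o ∈ S
    · simp only [hY, ho, if_true]
      obtain ⟨hint, hpath⟩ := hS o ho
      have h1 : ContinuousOn (fun t => X t o) (Icc 0 1) := by
        have h2 := intervalIntegral.continuousOn_primitive_interval' hint left_mem_uIcc
        rw [uIcc_of_le zero_le_one] at h2
        exact (continuousOn_const.add h2).congr hpath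
      exact (continuousOn_iff_continuous_domRestrict.1 h1).comp continuous_projIcc
    · simp only [hY, ho, if_false]
      exact continuous_const
  have heq : ∀ o ∈ S, ∀ t ∈ Icc (0 : ℝ) 1, Y t o = X t o := fun o ho t ht => by
    simp only [hY, ho, if_true]
    rw [projIcc_of_mem _ ht]
  refine ⟨Ω, inferInstance, Q, Y, hQ,
    measurable_uncurry_of_continuous_of_measurable hYc hYm, ?_, fun t ht => ?_⟩
  · filter_upwards [hSQ] with o ho
    obtain ⟨hint, hpath⟩ := hS o ho
    refine ⟨hint.congr fun s hs => ?_, fun t ht => ?_⟩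
    · rw [uIoc_of_le zero_le_one] at hs
      rw [heq o ho s (Ioc_subset_Icc_self hs)]
    · rw [heq o ho t ht, heq o ho 0 (by simp), hpath t ht]
      congr 1
      refine intervalIntegral.integral_congr fun s hs => ?_
      rw [uIcc_of_le ht.1] at hs
      rw [heq o ho s ⟨hs.1, hs.2.trans ht.2⟩]
  · rw [← hlaw t ht]
    refine Measure.map_congr ?_
    filter_upwards [hSQ] with o ho using heq o ho t ht

instance : IsProbabilityMeasure (volume.restrict (Icc (0 : ℝ) 1)) := ⟨by simp⟩

/-- The variance decomposition of a vector-valued square integrable function. -/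
lemma lintegral_sq_sub_add {α : Type*} [MeasurableSpace α] {μ : Measure α} [IsProbabilityMeasure μ]
    {Z : α → E d} (hZ : MemLp Z 2 μ) :
    ∫⁻ a, ‖Z a - ∫ b, Z b ∂μ‖ₑ ^ 2 ∂μ + ‖∫ b, Z b ∂μ‖ₑ ^ 2 = ∫⁻ a, ‖Z a‖ₑ ^ 2 ∂μ := by
  set m := ∫ b, Z b ∂μ with hm
  have key : ∀ f : α → E d, MemLp f 2 μ →
      ∫⁻ a, ‖f a‖ₑ ^ 2 ∂μ = ENNReal.ofReal (∫ a, ‖f a‖ ^ 2 ∂μ) := fun f hf => by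
    rw [ofReal_integral_eq_lintegral_ofReal (hf.integrable_norm_pow (by norm_num))
      (ae_of_all _ fun o => by positivity)]
    refine lintegral_congr fun a => ?_
    rw [ENNReal.ofReal_pow (norm_nonneg _), ofReal_norm]
  have hZi := hZ.integrable (by norm_num)
  have hZm : MemLp (fun a => Z a - m) 2 μ := hZ.sub (memLp_const m)
  have h1 : ∫ a, ‖Z a - m‖ ^ 2 ∂μ = ∫ a, ‖Z a‖ ^ 2 ∂μ - ‖m‖ ^ 2 := by
    have e : ∀ a, ‖Z a - m‖ ^ 2 = ‖Z a‖ ^ 2 - 2 * inner ℝ m (Z a) + ‖m‖ ^ 2 := fun a => by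
      rw [norm_sub_sq_real, real_inner_comm]
    have i1 := hZ.integrable_norm_pow (p := 2) (by norm_num)
    have i2 := (hZi.const_inner (𝕜 := ℝ) m).const_mul 2
    have i3 : Integrable (fun a => ‖Z a‖ ^ 2 - 2 * inner ℝ m (Z a)) μ := i1.sub i2
    simp only [e]
    rw [integral_add i3 (integrable_const _), integral_sub i1 i2, integral_const_mul,
      integral_inner hZi, ← hm, real_inner_self_eq_norm_sq]
    simp only [integral_const, probReal_univ, one_smul]
    ring
  rw [key _ hZm, key _ hZ, h1, ← ofReal_norm, ← ENNReal.ofReal_pow (norm_nonneg _),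
    ← ENNReal.ofReal_add _ (by positivity)]
  · congr 1; ring
  · rw [← h1]; exact integral_nonneg fun a => by positivity

/-- The solutions of the minimum energy problem move along straight lines. -/
theorem SolvesBridge.exists_line {ν₀ ν₁ : Measure (E d)} {u : ℝ → E d → E d}
    {ρ : ℝ → Measure (E d)} (h : SolvesBridge ν₀ ν₁ u ρ) :
    ∃ γ : Measure (E d × E d), IsProbabilityMeasure γ ∧
      (∀ t ∈ Icc (0 : ℝ) 1, ρ t = γ.map (line t)) ∧
      (∀ᵐ t ∂volume.restrict (Icc (0 : ℝ) 1), ∀ᵐ p ∂γ, u t (line t p) = p.2) ∧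
      ∫⁻ p, ‖p.2‖ₑ ^ 2 ∂γ ≤ energy u ρ := by
  obtain ⟨⟨hu, hprod, hinit, hterm, hfin⟩, hopt⟩ := h
  obtain ⟨Ω, _, Q, Y, hQ, hY, hpath, hlaw⟩ := hprod.exists_measurable
  have hYt : ∀ t, Measurable (Y t) := fun t => hY.comp measurable_prodMk_left
  set lam : Measure ℝ := volume.restrict (Icc (0 : ℝ) 1) with hlam
  set Z : Ω × ℝ → E d := fun q => u q.2 (Y q.2 q.1) with hZdef
  have hZ : Measurable Z := hu.comp (measurable_snd.prodMk (hY.comp measurable_swap))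
  -- The displacement over the unit interval is the time average of the velocity, so the variance
  -- decomposition applies path by path.
  set V : Ω → E d := fun o => Y 1 o - Y 0 o with hVdef
  have hVm : Measurable V := (hYt 1).sub (hYt 0)
  have hVZ : ∀ᵐ o ∂Q, V o = ∫ s, Z (o, s) ∂lam := by
    filter_upwards [hpath] with o ho
    rw [hVdef, hlam, integral_Icc_eq_integral_Ioc, ← intervalIntegral.integral_of_le zero_le_one]
    simp only [ho.2 1 (by simp), add_sub_cancel_left, hZdef]
  have henergy : energy u ρ = ∫⁻ o, ∫⁻ s, ‖Z (o, s)‖ₑ ^ 2 ∂lam ∂Q := by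
    have hm : Measurable fun q : Ω × ℝ => ‖Z q‖ₑ ^ 2 := by fun_prop
    rw [lintegral_lintegral_swap hm.aemeasurable, energy]
    refine setLIntegral_congr_fun measurableSet_Icc fun s hs => ?_
    have h1 : Measurable fun y => ‖u s y‖ₑ ^ 2 :=
      (hu.comp measurable_prodMk_left).enorm.pow_const 2
    rw [← hlaw s hs, lintegral_map h1 (hYt s)]
  have hZ2 : ∀ᵐ o ∂Q, MemLp (fun s => Z (o, s)) 2 lam := by
    have hm : Measurable fun o => ∫⁻ s, ‖Z (o, s)‖ₑ ^ 2 ∂lam :=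
      (by fun_prop : Measurable fun q : Ω × ℝ => ‖Z q‖ₑ ^ 2).lintegral_prod_right'
    filter_upwards [ae_lt_top hm (by rw [← henergy]; exact hfin.ne)] with o ho
    exact (memLp_two_iff_lintegral (f := fun s => Z (o, s))
      (hZ.comp measurable_prodMk_left).aestronglyMeasurable).2 ho
  have hdecomp : ∀ᵐ o ∂Q, ∫⁻ s, ‖Z (o, s) - V o‖ₑ ^ 2 ∂lam + ‖V o‖ₑ ^ 2 =
      ∫⁻ s, ‖Z (o, s)‖ₑ ^ 2 ∂lam := by
    filter_upwards [hVZ, hZ2] with o h1 h2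
    rw [h1]
    exact lintegral_sq_sub_add h2
  set γ : Measure (E d × E d) := Q.map fun o => (Y 0 o, V o) with hγdef
  have hpair : Measurable fun o => (Y 0 o, V o) := (hYt 0).prodMk hVm
  have hγ : IsProbabilityMeasure γ := Measure.isProbabilityMeasure_map hpair.aemeasurable
  have hγV : ∫⁻ p, ‖p.2‖ₑ ^ 2 ∂γ = ∫⁻ o, ‖V o‖ₑ ^ 2 ∂Q := by
    rw [hγdef, lintegral_map (by fun_prop) hpair]
  have hVle : ∫⁻ p, ‖p.2‖ₑ ^ 2 ∂γ ≤ energy u ρ := by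
    rw [hγV, henergy]
    refine lintegral_mono_ae ?_
    filter_upwards [hdecomp] with o ho
    rw [← ho]
    exact le_add_self
  have hγfin : ∫⁻ p, ‖p.2‖ₑ ^ 2 ∂γ < ⊤ := hVle.trans_lt hfin
  have hcomp : energy (meanVel γ) (fun t => γ.map (line t)) ≤ ∫⁻ p, ‖p.2‖ₑ ^ 2 ∂γ := by
    calc energy (meanVel γ) (fun t => γ.map (line t))
        ≤ ∫⁻ _ in Icc (0 : ℝ) 1, ∫⁻ p, ‖p.2‖ₑ ^ 2 ∂γ := by
          refine lintegral_mono fun t => ?_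
          have := measurable_meanVel_apply γ t
          rw [lintegral_map (by fun_prop) (measurable_line t)]
          exact lintegral_meanVel_sq_le γ t
      _ = ∫⁻ p, ‖p.2‖ₑ ^ 2 ∂γ := by simp
  have hmaple : ∀ t, γ.map (line t) = Q.map fun o => Y 0 o + t • V o := fun t => by
    rw [hγdef, Measure.map_map (measurable_line t) hpair]
    rfl
  -- The line through `Y 0` and `Y 1` has the same endpoints as the path, hence the same boundary
  -- laws.
  have hfeas : IsFeasible ν₀ ν₁ (meanVel γ) (fun t => γ.map (line t)) := by
    refine ⟨measurable_meanVel γ, ?_, ?_, ?_, hcomp.trans_lt hγfin⟩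
    · exact produces_of_ae_eq_meanVel hγfin (measurable_meanVel γ)
        (ae_of_all _ fun t => ae_of_all _ fun p => rfl) fun t _ => rfl
    · rw [hmaple, ← hinit, ← hlaw 0 (by simp)]
      simp
    · rw [hmaple, ← hterm, ← hlaw 1 (by simp)]
      simp [hVdef]
  have hmin : energy u ρ ≤ ∫⁻ o, ‖V o‖ₑ ^ 2 ∂Q := by
    rw [← hγV]
    exact (hopt _ _ hfeas).trans hcomp
  have hmZV : Measurable fun q : Ω × ℝ => ‖Z q - V q.1‖ₑ ^ 2 := by fun_prop
  -- Energy is displacement energy plus time variance, and by optimality it is at most the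
  -- displacement energy, which is finite and can be cancelled.
  have hzero : ∫⁻ o, ∫⁻ s, ‖Z (o, s) - V o‖ₑ ^ 2 ∂lam ∂Q = 0 := by
    have h1 : ∫⁻ o, ∫⁻ s, ‖Z (o, s) - V o‖ₑ ^ 2 ∂lam ∂Q + ∫⁻ o, ‖V o‖ₑ ^ 2 ∂Q ≤
        0 + ∫⁻ o, ‖V o‖ₑ ^ 2 ∂Q := by
      rw [← lintegral_add_right _ (by fun_prop), lintegral_congr_ae hdecomp, ← henergy, zero_add]
      exact hmin
    rw [← hγV] at h1
    exact le_zero_iff.1 ((ENNReal.add_le_add_iff_right hγfin.ne).1 h1)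
  have hae : ∀ᵐ o ∂Q, ∀ᵐ s ∂lam, Z (o, s) = V o := by
    rw [lintegral_eq_zero_iff hmZV.lintegral_prod_right'] at hzero
    filter_upwards [hzero] with o ho
    have hmo : Measurable fun s => ‖Z (o, s) - V o‖ₑ ^ 2 := hmZV.comp measurable_prodMk_left
    simp only [Pi.zero_apply] at ho
    rw [lintegral_eq_zero_iff hmo] at ho
    filter_upwards [ho] with s hs
    simpa [sub_eq_zero] using hs
  have hline : ∀ᵐ o ∂Q, ∀ t ∈ Icc (0 : ℝ) 1, Y t o = line t (Y 0 o, V o) := by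
    filter_upwards [hpath, hae] with o h1 h2 t ht
    rw [h1.2 t ht, line]
    congr 1
    rw [intervalIntegral.integral_of_le ht.1]
    have : ∫ s in Ioc 0 t, u s (Y s o) = ∫ _ in Ioc 0 t, V o := by
      refine integral_congr_ae (ae_restrict_of_ae_restrict_of_subset ?_ h2)
      exact Ioc_subset_Icc_self.trans (Icc_subset_Icc_right ht.2)
    rw [this]
    simp [ht.1]
  refine ⟨γ, hγ, fun t ht => ?_, ?_, hVle⟩
  · rw [← hlaw t ht, hmaple]
    refine Measure.map_congr ?_
    filter_upwards [hline] with o ho using ho t ht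
  · rw [Measure.ae_ae_comm (p := fun o s => Z (o, s) = V o)
      (measurableSet_eq_fun hZ (hVm.comp measurable_fst))] at hae
    filter_upwards [hae, ae_restrict_mem measurableSet_Icc] with s hs hs'
    have hset : MeasurableSet {p : E d × E d | u s (line s p) = p.2} := measurableSet_eq_fun
      (hu.comp (measurable_const.prodMk (measurable_line s))) measurable_snd
    rw [hγdef, ae_map_iff hpair.aemeasurable hset]
    filter_upwards [hs, hline] with o h1 h2
    rw [← h2 s hs', ← h1]

/-! ### Flows along lines and their crossing of balls. -/

/-- The lines of `γ` have the marginal densities `r` on the unit interval and follow the vector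
field `u`. -/
structure IsLineFlow (r : ℝ → E d → ℝ≥0) (u : ℝ → E d → E d) (γ : Measure (E d × E d)) : Prop where
  prob : IsProbabilityMeasure γ
  law : ∀ t ∈ Icc (0 : ℝ) 1, densityLaw (r t) = γ.map (line t)
  vel : ∀ᵐ t ∂volume.restrict (Icc (0 : ℝ) 1), ∀ᵐ p ∂γ, u t (line t p) = p.2

/-- The marginals agree at every time in [0, 1], but the field equals the velocity of the line only
at almost every time; hence the integral over time. -/
lemma IsLineFlow.lintegral_eq {r : ℝ → E d → ℝ≥0} {u : ℝ → E d → E d} {γ : Measure (E d × E d)}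
    (h : IsLineFlow r u γ) (hr : Measurable (Function.uncurry r))
    (hu : Measurable (Function.uncurry u))
    {F : ℝ × E d × E d → ℝ≥0∞} (hF : Measurable F) :
    ∫⁻ t in Icc (0 : ℝ) 1, ∫⁻ x, r t x * F (t, x, u t x) =
      ∫⁻ t in Icc (0 : ℝ) 1, ∫⁻ p, F (t, line t p, p.2) ∂γ := by
  refine lintegral_congr_ae ?_
  filter_upwards [h.vel, ae_restrict_mem measurableSet_Icc] with t h1 ht
  have hut : Measurable (u t) := hu.comp measurable_prodMk_left
  have hrt : Measurable fun x => (r t x : ℝ≥0∞) :=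
    (hr.comp measurable_prodMk_left).coe_nnreal_ennreal
  have hm : Measurable fun x => F (t, x, u t x) := by fun_prop
  calc ∫⁻ x, r t x * F (t, x, u t x) = ∫⁻ x, F (t, x, u t x) ∂densityLaw (r t) := by
        rw [densityLaw, lintegral_withDensity_eq_lintegral_mul _ hrt hm]
        rfl
    _ = ∫⁻ p, F (t, line t p, u t (line t p)) ∂γ := by
        rw [h.law t ht, lintegral_map hm (measurable_line t)]
    _ = ∫⁻ p, F (t, line t p, p.2) ∂γ := by
        refine lintegral_congr_ae ?_
        filter_upwards [h1] with p hp
        rw [hp]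

lemma IsLineFlow.lintegral_law {r : ℝ → E d → ℝ≥0} {u : ℝ → E d → E d} {γ : Measure (E d × E d)}
    (h : IsLineFlow r u γ) (hr : Measurable (Function.uncurry r)) {G : E d → ℝ≥0∞}
    (hG : Measurable G) {t : ℝ} (ht : t ∈ Icc (0 : ℝ) 1) :
    ∫⁻ x, r t x * G x = ∫⁻ p, G (line t p) ∂γ := by
  have hrt : Measurable fun x => (r t x : ℝ≥0∞) :=
    (hr.comp measurable_prodMk_left).coe_nnreal_ennreal
  rw [← lintegral_map hG (measurable_line t), ← h.law t ht, densityLaw,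
    lintegral_withDensity_eq_lintegral_mul _ hrt hG]
  rfl

/-- A particle crosses a ball in a time that is inversely proportional to its speed. -/
lemma lintegral_crossing_le (R : ℝ) (p : E d × E d) :
    ∫⁻ t in Icc (0 : ℝ) 1, (Metric.closedBall (0 : E d) R).indicator (fun _ => ‖p.2‖ₑ) (line t p) ≤
      ENNReal.ofReal (2 * R) := by
  set S : Set ℝ := {t | t ∈ Icc (0 : ℝ) 1 ∧ line t p ∈ Metric.closedBall (0 : E d) R} with hS
  have hset : MeasurableSet {t : ℝ | line t p ∈ Metric.closedBall (0 : E d) R} := by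
    have : Measurable fun t : ℝ => line t p := by unfold line; fun_prop
    exact this measurableSet_closedBall
  have h1 : ∫⁻ t in Icc (0 : ℝ) 1,
      (Metric.closedBall (0 : E d) R).indicator (fun _ => ‖p.2‖ₑ) (line t p) =
        ‖p.2‖ₑ * volume S := by
    have e : (fun t => (Metric.closedBall (0 : E d) R).indicator (fun _ => ‖p.2‖ₑ) (line t p)) =
        {t : ℝ | line t p ∈ Metric.closedBall (0 : E d) R}.indicator fun _ => ‖p.2‖ₑ := by
      funext t; rfl
    rw [e, lintegral_indicator hset, lintegral_const, Measure.restrict_restrict hset,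
      Measure.restrict_apply_univ]
    congr 2
    ext t
    exact and_comm
  rw [h1]
  rcases eq_or_ne p.2 0 with h0 | h0
  · simp [h0]
  have hpos : 0 < ‖p.2‖ := norm_pos_iff.2 h0
  -- Two positions in the ball are at most 2R apart, which bounds the time between them by 2R over
  -- the speed.
  have hdiam : volume S ≤ ENNReal.ofReal (2 * R / ‖p.2‖) := by
    refine (Real.volume_le_diam S).trans (Metric.ediam_le fun s hs t ht => ?_)
    rw [edist_dist]
    refine ENNReal.ofReal_le_ofReal ?_
    rw [le_div_iff₀ hpos, Real.dist_eq, ← Real.norm_eq_abs, ← norm_smul]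
    have e : (s - t) • p.2 = line s p - line t p := by simp only [line]; module
    rw [e]
    have := norm_sub_le (line s p) (line t p)
    have h2 := mem_closedBall_zero_iff.1 hs.2
    have h3 := mem_closedBall_zero_iff.1 ht.2
    linarith
  calc ‖p.2‖ₑ * volume S ≤ ENNReal.ofReal ‖p.2‖ * ENNReal.ofReal (2 * R / ‖p.2‖) := by
        rw [ofReal_norm]; gcongr
    _ = ENNReal.ofReal (2 * R) := by
        rw [← ENNReal.ofReal_mul hpos.le, mul_div_cancel₀ _ hpos.ne']

/-! ### Measurable choice of the lines, and their mixture. -/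

section
variable {W : Type*} [MeasurableSpace W] {Λ : Measure W} {R : W × ℝ × E d → ℝ≥0}
  {U : W × ℝ × E d → E d}

/-- The starting point and the velocity of the line through a given point of space-time whose
velocity is given by a vector field. -/
def backLine (U : W × ℝ × E d → E d) (q : W × ℝ × E d) : E d × E d := (q.2.2 - q.2.1 • U q, U q)

@[fun_prop]
lemma measurable_backLine (hU : Measurable U) : Measurable (backLine U) := by
  unfold backLine; fun_prop

/-- The law of the line through a random point of space-time. -/
def lineLaw (R : W × ℝ × E d → ℝ≥0) (U : W × ℝ × E d → E d) (w : W) : Measure (E d × E d) :=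
  (((volume.restrict (Icc (0 : ℝ) 1)).prod volume).withDensity fun q => (R (w, q) : ℝ≥0∞)).map
    fun q => backLine U (w, q)

lemma lintegral_lineLaw_prod (hR : Measurable R) (hU : Measurable U) (w : W)
    {G : E d × E d → ℝ≥0∞} (hG : Measurable G) : ∫⁻ p, G p ∂lineLaw R U w =
      ∫⁻ q : ℝ × E d, R (w, q) * G (backLine U (w, q))
        ∂(volume.restrict (Icc (0 : ℝ) 1)).prod volume := by
  have h1 : Measurable fun q : ℝ × E d => (R (w, q) : ℝ≥0∞) := by fun_prop
  have h2 : Measurable fun q : ℝ × E d => G (backLine U (w, q)) := by fun_prop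
  rw [lineLaw, lintegral_map hG (by fun_prop), lintegral_withDensity_eq_lintegral_mul _ h1 h2]
  rfl

lemma lintegral_lineLaw (hR : Measurable R) (hU : Measurable U) (w : W) {G : E d × E d → ℝ≥0∞}
    (hG : Measurable G) : ∫⁻ p, G p ∂lineLaw R U w =
      ∫⁻ t in Icc (0 : ℝ) 1, ∫⁻ x, R (w, t, x) * G (backLine U (w, t, x)) := by
  rw [lintegral_lineLaw_prod hR hU w hG, lintegral_prod _ (by fun_prop)]

lemma measurable_lineLaw (hR : Measurable R) (hU : Measurable U) : Measurable (lineLaw R U) := by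
  refine Measure.measurable_of_measurable_coe _ fun s hs => ?_
  have hs1 : Measurable (s.indicator (1 : E d × E d → ℝ≥0∞)) := measurable_one.indicator hs
  simp only [← lintegral_indicator_one hs, lintegral_lineLaw_prod hR hU _ hs1]
  have h1 : Measurable fun q : W × ℝ × E d =>
      R q * s.indicator (1 : E d × E d → ℝ≥0∞) (backLine U q) := by fun_prop
  exact h1.lintegral_prod_right'

/-- At time t the point x = `line t p` has field value `p.2`, and x - t • `p.2` is `p.1`: density
and field determine the line. So γ, known only to exist for each parameter, is an explicit
measurable function of it. -/
lemma IsLineFlow.eq_lineLaw (hR : Measurable R) (hU : Measurable U) {w : W}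
    {γ : Measure (E d × E d)}
    (h : IsLineFlow (fun t x => R (w, t, x)) (fun t x => U (w, t, x)) γ) : lineLaw R U w = γ := by
  have := h.prob
  refine Measure.ext_of_lintegral _ fun G hG => ?_
  rw [lintegral_lineLaw hR hU w hG]
  have h1 := h.lintegral_eq (by unfold Function.uncurry; fun_prop)
    (by unfold Function.uncurry; fun_prop)
    (F := fun q => G (q.2.1 - q.1 • q.2.2, q.2.2)) (by fun_prop)
  refine Eq.trans h1 ?_
  have e : ∀ (t : ℝ) (p : E d × E d), (line t p - t • p.2, p.2) = p := fun t p => by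
    simp [line]
  simp only [e]
  simp

/-- The lines of a mixture of flows along lines. -/
def mixLine (Λ : Measure W) (R : W × ℝ × E d → ℝ≥0) (U : W × ℝ × E d → E d) :
    Measure (E d × E d) := Λ.bind (lineLaw R U)

lemma isProbabilityMeasure_mixLine [IsProbabilityMeasure Λ] (hR : Measurable R) (hU : Measurable U)
    (h : ∀ᵐ w ∂Λ, IsLineFlow (fun t x => R (w, t, x)) (fun t x => U (w, t, x)) (lineLaw R U w)) :
    IsProbabilityMeasure (mixLine Λ R U) := by
  refine ⟨?_⟩
  rw [mixLine, Measure.bind_apply .univ (measurable_lineLaw hR hU).aemeasurable]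
  rw [lintegral_congr_ae (g := fun _ => 1)]
  · simp
  · filter_upwards [h] with w hw
    exact hw.prob.measure_univ

lemma lintegral_mixLine (hR : Measurable R) (hU : Measurable U) {G : E d × E d → ℝ≥0∞}
    (hG : Measurable G) :
    ∫⁻ p, G p ∂mixLine Λ R U = ∫⁻ w, ∫⁻ p, G p ∂lineLaw R U w ∂Λ :=
  Measure.lintegral_bind (measurable_lineLaw hR hU).aemeasurable hG.aemeasurable

lemma lintegral_mixLine_law (hR : Measurable R) (hU : Measurable U)
    (h : ∀ᵐ w ∂Λ, IsLineFlow (fun t x => R (w, t, x)) (fun t x => U (w, t, x)) (lineLaw R U w))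
    {G : E d → ℝ≥0∞} (hG : Measurable G) {t : ℝ} (ht : t ∈ Icc (0 : ℝ) 1) :
    ∫⁻ w, ∫⁻ x, R (w, t, x) * G x ∂volume ∂Λ = ∫⁻ p, G (line t p) ∂mixLine Λ R U := by
  rw [lintegral_mixLine hR hU (by fun_prop)]
  refine lintegral_congr_ae ?_
  filter_upwards [h] with w hw
  exact hw.lintegral_law (by unfold Function.uncurry; fun_prop) hG ht

/-- The version of `lintegral_mixLine_law` that also sees velocities, at the price of integrating
over time. -/
lemma lintegral_mixLine_eq [SFinite Λ] (hR : Measurable R) (hU : Measurable U)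
    (h : ∀ᵐ w ∂Λ, IsLineFlow (fun t x => R (w, t, x)) (fun t x => U (w, t, x)) (lineLaw R U w))
    {F : ℝ × E d × E d → ℝ≥0∞} (hF : Measurable F) :
    ∫⁻ w, (∫⁻ t in Icc (0 : ℝ) 1, ∫⁻ x, R (w, t, x) * F (t, x, U (w, t, x))) ∂Λ =
      ∫⁻ t in Icc (0 : ℝ) 1, ∫⁻ p, F (t, line t p, p.2) ∂mixLine Λ R U := by
  have hFt : ∀ t : ℝ, Measurable fun p : E d × E d => F (t, line t p, p.2) := fun t =>
    hF.comp (measurable_const.prodMk ((measurable_line t).prodMk measurable_snd))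
  have e : ∀ t : ℝ, ∫⁻ p, F (t, line t p, p.2) ∂mixLine Λ R U =
      ∫⁻ w, ∫⁻ p, F (t, line t p, p.2) ∂lineLaw R U w ∂Λ := fun t =>
    lintegral_mixLine hR hU (hFt t)
  simp only [e]
  have hm : Measurable fun q : W × ℝ => ∫⁻ p, F (q.2, line q.2 p, p.2) ∂lineLaw R U q.1 := by
    have hmF : Measurable fun q : (W × ℝ) × ℝ × E d =>
        (R (q.1.1, q.2) : ℝ≥0∞) * F (q.1.2, line q.1.2 (backLine U (q.1.1, q.2)),
          (backLine U (q.1.1, q.2)).2) := by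
      have h1 : Measurable fun q : (W × ℝ) × ℝ × E d => backLine U (q.1.1, q.2) := by fun_prop
      have h2 : Measurable fun q : (W × ℝ) × ℝ × E d => line q.1.2 (backLine U (q.1.1, q.2)) :=
        measurable_uncurry_line.comp ((measurable_snd.comp measurable_fst).prodMk h1)
      fun_prop
    simp only [lintegral_lineLaw_prod hR hU _ (hFt _)]
    exact hmF.lintegral_prod_right'
  rw [← lintegral_lintegral_swap (f := fun w t => ∫⁻ p, F (t, line t p, p.2) ∂lineLaw R U w)
    hm.aemeasurable]
  refine lintegral_congr_ae ?_
  filter_upwards [h] with w hw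
  exact hw.lintegral_eq (by unfold Function.uncurry; fun_prop)
    (by unfold Function.uncurry; fun_prop) hF

end

/-- A measurable mixture of flows along lines, with densities `R` and velocity fields `U`. -/
structure IsLineMixture {W : Type*} [MeasurableSpace W] (Λ : Measure W) (R : W × ℝ × E d → ℝ≥0)
    (U : W × ℝ × E d → E d) : Prop where
  prob : IsProbabilityMeasure Λ
  measurable_density : Measurable R
  measurable_field : Measurable U
  flow : ∀ᵐ w ∂Λ, IsLineFlow (fun t x => R (w, t, x)) (fun t x => U (w, t, x)) (lineLaw R U w)

/-! ### Mixture density and mixture velocity. -/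

section
variable {W : Type*} [MeasurableSpace W] {Λ : Measure W} {R : W × ℝ × E d → ℝ≥0}
  {U : W × ℝ × E d → E d}

/-- The mixture density, as a function on space-time. -/
def jointDensity (Λ : Measure W) (R : W × ℝ × E d → ℝ≥0) (q : ℝ × E d) : ℝ :=
  ∫ w, (R (w, q) : ℝ) ∂Λ

/-- The mixture velocity, as a function on space-time. -/
def jointField (Λ : Measure W) (R : W × ℝ × E d → ℝ≥0) (U : W × ℝ × E d → E d)
    (q : ℝ × E d) : E d :=
  ∫ w, ((R (w, q) : ℝ) / jointDensity Λ R q) • U (w, q) ∂Λ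

lemma measurable_jointDensity [SFinite Λ] (hR : Measurable R) : Measurable (jointDensity Λ R) := by
  have h : Measurable fun q : (ℝ × E d) × W => (R (q.2, q.1) : ℝ) := by fun_prop
  exact (h.stronglyMeasurable.integral_prod_right' (ν := Λ)).measurable

lemma measurable_jointField [SFinite Λ] (hR : Measurable R) (hU : Measurable U) :
    Measurable (jointField Λ R U) := by
  have hD := measurable_jointDensity (Λ := Λ) hR
  have h : Measurable fun q : (ℝ × E d) × W =>
    ((R (q.2, q.1) : ℝ) / jointDensity Λ R q.1) • U (q.2, q.1) := by fun_prop
  exact (h.stronglyMeasurable.integral_prod_right' (ν := Λ)).measurable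

lemma integrable_density_iff (hR : Measurable R) (q : ℝ × E d) :
    Integrable (fun w => (R (w, q) : ℝ)) Λ ↔ ∫⁻ w, R (w, q) ∂Λ < ⊤ := by
  have h : AEStronglyMeasurable (fun w => (R (w, q) : ℝ)) Λ :=
    (by fun_prop : Measurable fun w => (R (w, q) : ℝ)).aestronglyMeasurable
  rw [Integrable, and_iff_right h, hasFiniteIntegral_iff_enorm]
  simp

lemma ofReal_jointDensity (hR : Measurable R) {q : ℝ × E d} (hq : ∫⁻ w, R (w, q) ∂Λ < ⊤) :
    ENNReal.ofReal (jointDensity Λ R q) = ∫⁻ w, R (w, q) ∂Λ := by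
  rw [jointDensity, ofReal_integral_eq_lintegral_ofReal ((integrable_density_iff hR q).2 hq)
    (ae_of_all _ fun w => (R (w, q)).2)]
  simp

/-- Division by the density can be undone even where the density vanishes: there R(·, q) is zero
almost everywhere, so both sides are zero. -/
lemma jointDensity_smul_jointField (hR : Measurable R) {q : ℝ × E d}
    (hq : ∫⁻ w, R (w, q) ∂Λ < ⊤) :
    jointDensity Λ R q • jointField Λ R U q = ∫ w, (R (w, q) : ℝ) • U (w, q) ∂Λ := by
  rcases eq_or_ne (jointDensity Λ R q) 0 with h0 | h0
  · rw [h0, zero_smul]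
    symm
    refine integral_eq_zero_of_ae ?_
    have h1 := (integral_eq_zero_iff_of_nonneg (fun w => (R (w, q)).2)
      ((integrable_density_iff hR q).2 hq)).1 h0
    filter_upwards [h1] with w hw
    have hw' : (R (w, q) : ℝ) = 0 := hw
    rw [hw', zero_smul, Pi.zero_apply]
  · rw [jointField, ← integral_smul]
    refine integral_congr_ae (ae_of_all _ fun w => ?_)
    simp only [smul_smul]
    rw [mul_div_cancel₀ _ h0]

variable (h : IsLineMixture Λ R U)
include h

lemma IsLineMixture.isProbabilityMeasure : IsProbabilityMeasure (mixLine Λ R U) :=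
  have := h.prob
  isProbabilityMeasure_mixLine h.measurable_density h.measurable_field h.flow

/-- By Tonelli the integral over x is the total mass of `mixLine`, which is one. -/
lemma IsLineMixture.ae_lintegral_lt_top {t : ℝ} (ht : t ∈ Icc (0 : ℝ) 1) :
    ∀ᵐ x : E d, ∫⁻ w, R (w, t, x) ∂Λ < ⊤ := by
  have := h.prob
  have := h.isProbabilityMeasure
  have hR := h.measurable_density
  have hm : Measurable fun q : W × E d => (R (q.1, t, q.2) : ℝ≥0∞) := by fun_prop
  refine ae_lt_top hm.lintegral_prod_left' ?_
  have h1 := lintegral_mixLine_law hR h.measurable_field h.flow (G := fun _ => 1)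
    measurable_const ht
  rw [← lintegral_lintegral_swap (f := fun w x => (R (w, t, x) : ℝ≥0∞)) hm.aemeasurable]
  simp only [mul_one, lintegral_one, measure_univ] at h1
  rw [h1]
  simp

/-- The mixture density is the density of the mixture of the lines. -/
lemma IsLineMixture.withDensity_eq {t : ℝ} (ht : t ∈ Icc (0 : ℝ) 1) :
    volume.withDensity (fun x => ENNReal.ofReal (jointDensity Λ R (t, x))) =
      (mixLine Λ R U).map (line t) := by
  have := h.prob
  have hR := h.measurable_density
  have hm : Measurable fun q : W × E d => (R (q.1, t, q.2) : ℝ≥0∞) := by fun_prop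
  rw [withDensity_congr_ae (g := fun x => ∫⁻ w, R (w, t, x) ∂Λ) ((h.ae_lintegral_lt_top ht).mono
    fun x hx => ofReal_jointDensity hR hx)]
  refine Measure.ext_of_lintegral _ fun G hG => ?_
  have hGm : Measurable fun q : W × E d => (R (q.1, t, q.2) : ℝ≥0∞) * G q.2 := by fun_prop
  rw [lintegral_map hG (measurable_line t), ← lintegral_mixLine_law hR h.measurable_field h.flow
    hG ht, lintegral_withDensity_eq_lintegral_mul _ hm.lintegral_prod_left' hG,
    lintegral_lintegral_swap hGm.aemeasurable]
  refine lintegral_congr fun x => ?_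
  simp only [Pi.mul_apply]
  rw [lintegral_mul_const _ (by fun_prop)]

/-- Uniformly in the mixing measure, the momentum in a ball is bounded. -/
lemma IsLineMixture.lintegral_momentum_le (k : ℝ) :
    ∫⁻ t in Icc (0 : ℝ) 1, ∫⁻ x in Metric.closedBall (0 : E d) k,
      ∫⁻ w, R (w, t, x) * ‖U (w, t, x)‖ₑ ∂Λ ≤ ENNReal.ofReal (2 * k) := by
  have := h.prob
  have := h.isProbabilityMeasure
  have hR := h.measurable_density
  have hU := h.measurable_field
  set F : ℝ × E d × E d → ℝ≥0∞ := fun q =>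
    (Metric.closedBall (0 : E d) k).indicator (fun _ => ‖q.2.2‖ₑ) q.2.1 with hFdef
  have hF : Measurable F := by
    have : F = {q : ℝ × E d × E d | q.2.1 ∈ Metric.closedBall (0 : E d) k}.indicator
      fun q => ‖q.2.2‖ₑ := rfl
    rw [this]
    refine Measurable.indicator (by fun_prop) ?_
    exact (by fun_prop : Measurable fun q : ℝ × E d × E d => q.2.1) measurableSet_closedBall
  have hl : Measurable fun q : ℝ × E d × E d => F (q.1, line q.1 q.2, q.2.2) :=
    hF.comp (measurable_fst.prodMk (measurable_uncurry_line.prodMk (by fun_prop)))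
  -- Integrating over time first leaves, for each line, speed times the time spent in the ball. This
  -- is bounded whatever the speed, so no energy assumption is needed.
  have h1 : ∫⁻ t in Icc (0 : ℝ) 1, ∫⁻ p, F (t, line t p, p.2) ∂mixLine Λ R U ≤
      ENNReal.ofReal (2 * k) := by
    rw [lintegral_lintegral_swap hl.aemeasurable]
    calc _ ≤ ∫⁻ _, ENNReal.ofReal (2 * k) ∂mixLine Λ R U :=
          lintegral_mono fun p => lintegral_crossing_le k p
      _ = _ := by simp
  rw [← lintegral_mixLine_eq hR hU h.flow hF] at h1
  refine le_of_eq_of_le ?_ h1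
  have hm : Measurable fun q : W × ℝ × E d => (R q : ℝ≥0∞) * F (q.2.1, q.2.2, U q) := by fun_prop
  have e1 : ∀ t : ℝ, ∫⁻ x in Metric.closedBall (0 : E d) k,
      ∫⁻ w, R (w, t, x) * ‖U (w, t, x)‖ₑ ∂Λ =
      ∫⁻ w, ∫⁻ x, R (w, t, x) * F (t, x, U (w, t, x)) ∂volume ∂Λ := fun t => by
    rw [← lintegral_indicator measurableSet_closedBall]
    have hmt : Measurable fun q : W × E d =>
        (R (q.1, t, q.2) : ℝ≥0∞) * F (t, q.2, U (q.1, t, q.2)) := by fun_prop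
    rw [lintegral_lintegral_swap hmt.aemeasurable]
    refine lintegral_congr fun x => ?_
    by_cases hx : x ∈ Metric.closedBall (0 : E d) k
    · simp only [hFdef, indicator_of_mem hx]
    · simp only [hFdef, indicator_of_notMem hx, mul_zero, lintegral_zero]
  simp only [e1]
  have hm2 : Measurable fun q : (ℝ × W) × E d =>
    (R (q.1.2, q.1.1, q.2) : ℝ≥0∞) * F (q.1.1, q.2, U (q.1.2, q.1.1, q.2)) := by fun_prop
  exact lintegral_lintegral_swap hm2.lintegral_prod_right'.aemeasurable

/-- The momentum bound is local; balls of integer radius exhaust the space. -/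
lemma IsLineMixture.ae_momentum_lt_top :
    ∀ᵐ t ∂volume.restrict (Icc (0 : ℝ) 1), ∀ᵐ x : E d,
      ∫⁻ w, R (w, t, x) * ‖U (w, t, x)‖ₑ ∂Λ < ⊤ := by
  have := h.prob
  have hR := h.measurable_density
  have hU := h.measurable_field
  have hm : Measurable fun q : (ℝ × E d) × W => (R (q.2, q.1) : ℝ≥0∞) * ‖U (q.2, q.1)‖ₑ := by
    fun_prop
  have hm2 := hm.lintegral_prod_right' (ν := Λ)
  have hk : ∀ k : ℕ, ∀ᵐ t ∂volume.restrict (Icc (0 : ℝ) 1),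
      ∀ᵐ x ∂(volume : Measure (E d)).restrict (Metric.closedBall 0 k),
        ∫⁻ w, R (w, t, x) * ‖U (w, t, x)‖ₑ ∂Λ < ⊤ := fun k => by
    have h1 : ∫⁻ t in Icc (0 : ℝ) 1, ∫⁻ x in Metric.closedBall (0 : E d) k,
        ∫⁻ w, R (w, t, x) * ‖U (w, t, x)‖ₑ ∂Λ ≠ ⊤ :=
      ((h.lintegral_momentum_le k).trans_lt ENNReal.ofReal_lt_top).ne
    filter_upwards [ae_lt_top (hm2.lintegral_prod_right'
      (ν := (volume : Measure (E d)).restrict (Metric.closedBall 0 (k : ℝ)))) h1] with t ht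
    exact ae_lt_top (hm2.comp measurable_prodMk_left) ht.ne
  filter_upwards [ae_all_iff.2 hk] with t ht
  have h2 : ∀ k : ℕ, ∀ᵐ x : E d, x ∈ Metric.closedBall (0 : E d) k →
      ∫⁻ w, R (w, t, x) * ‖U (w, t, x)‖ₑ ∂Λ < ⊤ := fun k =>
    (ae_restrict_iff' measurableSet_closedBall).1 (ht k)
  filter_upwards [ae_all_iff.2 h2] with x hx
  obtain ⟨k, hk⟩ := exists_nat_ge ‖x‖
  exact hx k (mem_closedBall_zero_iff.2 hk)

omit h in
lemma integrable_momentum_iff (hR : Measurable R) (hU : Measurable U) (q : ℝ × E d) :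
    Integrable (fun w => (R (w, q) : ℝ) • U (w, q)) Λ ↔
      ∫⁻ w, R (w, q) * ‖U (w, q)‖ₑ ∂Λ < ⊤ := by
  have h : AEStronglyMeasurable (fun w => (R (w, q) : ℝ) • U (w, q)) Λ :=
    (by fun_prop : Measurable fun w => (R (w, q) : ℝ) • U (w, q)).aestronglyMeasurable
  rw [Integrable, and_iff_right h, hasFiniteIntegral_iff_enorm]
  simp [enorm_smul]

/-- The law of a mixture of lines in space-time. -/
lemma IsLineMixture.map_prod_eq :
    ((volume.restrict (Icc (0 : ℝ) 1)).prod (mixLine Λ R U)).map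
        (fun q => (q.1, line q.1 q.2)) =
      ((volume.restrict (Icc (0 : ℝ) 1)).prod volume).withDensity
        fun q => ENNReal.ofReal (jointDensity Λ R q) := by
  have := h.prob
  have := h.isProbabilityMeasure
  have hD := measurable_jointDensity (Λ := Λ) h.measurable_density
  have hφ : Measurable fun q : ℝ × E d × E d => (q.1, line q.1 q.2) :=
    measurable_fst.prodMk measurable_uncurry_line
  refine Measure.ext_of_lintegral _ fun G hG => ?_
  have hm : Measurable fun q : ℝ × E d => ENNReal.ofReal (jointDensity Λ R q) * G q := by fun_prop
  have hG' : Measurable fun q : ℝ × E d × E d => G (q.1, line q.1 q.2) := hG.comp hφ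
  rw [lintegral_map hG hφ, lintegral_prod _ hG'.aemeasurable,
    lintegral_withDensity_eq_lintegral_mul _ (by fun_prop) hG]
  change _ = ∫⁻ q, ENNReal.ofReal (jointDensity Λ R q) * G q ∂_
  rw [lintegral_prod _ hm.aemeasurable]
  refine setLIntegral_congr_fun measurableSet_Icc fun t ht => ?_
  have hGt : Measurable fun x => G (t, x) := hG.comp measurable_prodMk_left
  have hDt : Measurable fun x => ENNReal.ofReal (jointDensity Λ R (t, x)) := by fun_prop
  rw [← lintegral_map hGt (measurable_line t), ← h.withDensity_eq ht,
    lintegral_withDensity_eq_lintegral_mul _ hDt hGt]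
  rfl

lemma IsLineMixture.ae_prod_lt_top :
    ∀ᵐ q ∂(volume.restrict (Icc (0 : ℝ) 1)).prod (volume : Measure (E d)),
      ∫⁻ w, R (w, q) ∂Λ < ⊤ ∧ ∫⁻ w, R (w, q) * ‖U (w, q)‖ₑ ∂Λ < ⊤ := by
  have := h.prob
  have hR := h.measurable_density
  have hU := h.measurable_field
  have hm1 : Measurable fun q : (ℝ × E d) × W => (R (q.2, q.1) : ℝ≥0∞) := by fun_prop
  have hm2 : Measurable fun q : (ℝ × E d) × W => (R (q.2, q.1) : ℝ≥0∞) * ‖U (q.2, q.1)‖ₑ := by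
    fun_prop
  have hs : MeasurableSet {q : ℝ × E d | ∫⁻ w, R (w, q) ∂Λ < ⊤ ∧
      ∫⁻ w, R (w, q) * ‖U (w, q)‖ₑ ∂Λ < ⊤} :=
    (measurableSet_lt hm1.lintegral_prod_right' measurable_const).inter
      (measurableSet_lt hm2.lintegral_prod_right' measurable_const)
  rw [Measure.ae_prod_iff_ae_ae hs]
  filter_upwards [h.ae_momentum_lt_top, ae_restrict_mem measurableSet_Icc] with t h1 ht
  filter_upwards [h1, h.ae_lintegral_lt_top ht] with x h2 h3 using ⟨h3, h2⟩

/-- The mixture velocity is the mean velocity of the lines through a given point of space-time. -/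
lemma IsLineMixture.integral_jointField {F : Type*} [NormedAddCommGroup F] [NormedSpace ℝ F]
    [CompleteSpace F] [SecondCountableTopology F] [MeasurableSpace F] [BorelSpace F]
    (Φ : ℝ × E d → E d →L[ℝ] F) (hΦ : Measurable fun z : (ℝ × E d) × E d => Φ z.1 z.2)
    (hfin : ∫⁻ t in Icc (0 : ℝ) 1, ∫⁻ p, ‖Φ (t, line t p) p.2‖ₑ ∂mixLine Λ R U < ⊤) :
    Integrable (fun q : ℝ × E d × E d =>
        Φ (q.1, line q.1 q.2) (jointField Λ R U (q.1, line q.1 q.2)))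
      ((volume.restrict (Icc (0 : ℝ) 1)).prod (mixLine Λ R U)) ∧
    Integrable (fun q : ℝ × E d × E d => Φ (q.1, line q.1 q.2) q.2.2)
      ((volume.restrict (Icc (0 : ℝ) 1)).prod (mixLine Λ R U)) ∧
    ∫ q : ℝ × E d × E d, Φ (q.1, line q.1 q.2) (jointField Λ R U (q.1, line q.1 q.2))
      ∂(volume.restrict (Icc (0 : ℝ) 1)).prod (mixLine Λ R U) =
    ∫ q : ℝ × E d × E d, Φ (q.1, line q.1 q.2) q.2.2
      ∂(volume.restrict (Icc (0 : ℝ) 1)).prod (mixLine Λ R U) := by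
  have := h.prob
  have := h.isProbabilityMeasure
  have hR := h.measurable_density
  have hU := h.measurable_field
  have hD := measurable_jointDensity (Λ := Λ) hR
  have hV := measurable_jointField (Λ := Λ) hR hU
  set lam : Measure ℝ := volume.restrict (Icc (0 : ℝ) 1) with hlam
  set γ := mixLine Λ R U with hγ
  have hφ : Measurable fun q : ℝ × E d × E d => (q.1, line q.1 q.2) :=
    measurable_fst.prodMk measurable_uncurry_line
  have hφ2 : Measurable fun q : ℝ × E d × E d => ((q.1, line q.1 q.2), q.2.2) :=
    hφ.prodMk (by fun_prop)
  have hΦU : Measurable fun z : W × ℝ × E d => Φ z.2 (U z) :=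
    hΦ.comp (measurable_snd.prodMk hU)
  have hΦV : Measurable fun q : ℝ × E d => Φ q (jointField Λ R U q) :=
    hΦ.comp (measurable_id.prodMk hV)
  -- Time, position and velocity have the same joint law whether sampled from the weighted
  -- components or from a line of the mixture.
  have hmeas : ((Λ.prod (lam.prod (volume : Measure (E d)))).withDensity fun z => (R z : ℝ≥0∞)).map
      (fun z => (z.2, U z)) = (lam.prod γ).map fun q => ((q.1, line q.1 q.2), q.2.2) := by
    refine Measure.ext_of_lintegral _ fun G hG => ?_
    have h1 := lintegral_mixLine_eq hR hU h.flow (F := fun q => G ((q.1, q.2.1), q.2.2))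
      (by fun_prop)
    have h2 : Measurable fun z : W × ℝ × E d => (R z : ℝ≥0∞) * G (z.2, U z) := by fun_prop
    have h4 : Measurable fun q : ℝ × E d × E d => G ((q.1, line q.1 q.2), q.2.2) := hG.comp hφ2
    rw [lintegral_map hG (by fun_prop), lintegral_map hG hφ2, lintegral_prod _ h4.aemeasurable,
      ← h1, lintegral_withDensity_eq_lintegral_mul _ (by fun_prop) (by fun_prop)]
    change ∫⁻ z, (R z : ℝ≥0∞) * G (z.2, U z) ∂_ = _
    rw [lintegral_prod _ h2.aemeasurable]
    refine lintegral_congr fun w => ?_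
    have h5 : Measurable fun q : ℝ × E d => (R (w, q) : ℝ≥0∞) * G (q, U (w, q)) :=
      h2.comp measurable_prodMk_left
    rw [lintegral_prod _ h5.aemeasurable]
  have hint : Integrable (fun q : ℝ × E d × E d => Φ (q.1, line q.1 q.2) q.2.2) (lam.prod γ) := by
    refine ⟨(hΦ.comp hφ2).aestronglyMeasurable, ?_⟩
    have h1 : Measurable fun q : ℝ × E d × E d => ‖Φ (q.1, line q.1 q.2) q.2.2‖ₑ :=
      (hΦ.comp hφ2).enorm
    rw [hasFiniteIntegral_iff_enorm, lintegral_prod _ h1.aemeasurable]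
    exact hfin
  have hint2 : Integrable (fun z : W × ℝ × E d => (R z : ℝ) • Φ z.2 (U z))
      (Λ.prod (lam.prod volume)) := by
    have h1 : Integrable (fun z : (ℝ × E d) × E d => Φ z.1 z.2)
        ((lam.prod γ).map fun q => ((q.1, line q.1 q.2), q.2.2)) :=
      (integrable_map_measure hΦ.aestronglyMeasurable hφ2.aemeasurable).2 hint
    rw [← hmeas, integrable_map_measure hΦ.aestronglyMeasurable (by fun_prop)] at h1
    exact (integrable_withDensity_iff_integrable_smul hR).1 h1
  have hval : ∫ q : ℝ × E d × E d, Φ (q.1, line q.1 q.2) q.2.2 ∂lam.prod γ =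
      ∫ z : W × ℝ × E d, (R z : ℝ) • Φ z.2 (U z) ∂Λ.prod (lam.prod volume) := by
    rw [← integral_map (φ := fun q : ℝ × E d × E d => ((q.1, line q.1 q.2), q.2.2))
      (f := fun z : (ℝ × E d) × E d => Φ z.1 z.2) hφ2.aemeasurable hΦ.aestronglyMeasurable,
      ← hmeas, integral_map (by fun_prop) hΦ.aestronglyMeasurable,
      integral_withDensity_eq_integral_smul hR]
    rfl
  -- The test field is linear in the velocity, so it commutes with the average over Λ.
  have hae : ∀ᵐ q ∂lam.prod (volume : Measure (E d)), ∫ w, (R (w, q) : ℝ) • Φ q (U (w, q)) ∂Λ =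
      jointDensity Λ R q • Φ q (jointField Λ R U q) := by
    filter_upwards [h.ae_prod_lt_top] with q hq
    rw [← map_smul, jointDensity_smul_jointField hR hq.1,
      ← ContinuousLinearMap.integral_comp_comm _ ((integrable_momentum_iff hR hU q).2 hq.2)]
    simp only [map_smul]
  have hD0 : ∀ q, 0 ≤ jointDensity Λ R q := fun q => integral_nonneg fun w => (R (w, q)).2
  have hint3 : Integrable (fun q => jointDensity Λ R q • Φ q (jointField Λ R U q))
      (lam.prod (volume : Measure (E d))) := hint2.integral_prod_right.congr hae
  have hval3 : ∫ q, jointDensity Λ R q • Φ q (jointField Λ R U q) ∂lam.prod volume =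
      ∫ z : W × ℝ × E d, (R z : ℝ) • Φ z.2 (U z) ∂Λ.prod (lam.prod volume) := by
    rw [integral_prod_symm _ hint2]
    exact (integral_congr_ae hae).symm
  have hmap := h.map_prod_eq
  rw [← hlam, ← hγ] at hmap
  have hDm : Measurable fun q : ℝ × E d => (jointDensity Λ R q).toNNReal := by fun_prop
  have hDe : (fun q : ℝ × E d => ENNReal.ofReal (jointDensity Λ R q)) =
      fun q => ((jointDensity Λ R q).toNNReal : ℝ≥0∞) := rfl
  have hsm : ∀ q, (jointDensity Λ R q).toNNReal • Φ q (jointField Λ R U q) =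
      jointDensity Λ R q • Φ q (jointField Λ R U q) := fun q => by
    rw [NNReal.smul_def, Real.coe_toNNReal _ (hD0 q)]
  refine ⟨?_, hint, ?_⟩
  · refine (integrable_map_measure (f := fun q : ℝ × E d × E d => (q.1, line q.1 q.2))
      (g := fun q => Φ q (jointField Λ R U q)) hΦV.aestronglyMeasurable hφ.aemeasurable).1 ?_
    rw [hmap, hDe, integrable_withDensity_iff_integrable_smul hDm]
    simp only [hsm]
    exact hint3
  · rw [← integral_map (φ := fun q : ℝ × E d × E d => (q.1, line q.1 q.2))
      (f := fun q => Φ q (jointField Λ R U q)) hφ.aemeasurable hΦV.aestronglyMeasurable, hmap, hDe,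
      integral_withDensity_eq_integral_smul hDm]
    simp only [hsm]
    rw [hval3, hval]

end

/-! ### The mixture velocity as a conditional mean. -/

/-- The defining property of the conditional mean velocity. -/
lemma integral_smul_meanVel {γ : Measure (E d × E d)} [IsProbabilityMeasure γ]
    (hγ : ∫⁻ p, ‖p.2‖ₑ ^ 2 ∂γ < ⊤) (t : ℝ) {s : Set (E d)} (hs : MeasurableSet s) :
    ∫ p, s.indicator (fun _ => p.2) (line t p) ∂γ =
      ∫ p, s.indicator (fun _ => meanVel γ t (line t p)) (line t p) ∂γ := by
  have hm := measurable_meanVel_apply γ t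
  have hmE : Measurable fun q : E d × E d => s.indicator (fun _ => q.2) q.1 := by
    have : (fun q : E d × E d => s.indicator (fun _ => q.2) q.1) =
      (Prod.fst ⁻¹' s).indicator fun q => q.2 := rfl
    rw [this]
    exact measurable_snd.indicator (measurable_fst hs)
  have hmM : Measurable fun x : E d => s.indicator (fun _ => meanVel γ t x) x :=
    hm.indicator hs
  have hpair : Measurable fun p : E d × E d => (line t p, p.2) := by fun_prop
  have hint : Integrable (fun q : E d × E d => s.indicator (fun _ => q.2) q.1)
      ((γ.map (line t)) ⊗ₘ (velKernel γ).sectR t) := by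
    rw [map_line_compProd, integrable_map_measure hmE.aestronglyMeasurable hpair.aemeasurable]
    refine ((memLp_snd hγ).integrable (by norm_num)).mono
      (hmE.comp hpair).aestronglyMeasurable (ae_of_all _ fun p => ?_)
    exact norm_indicator_le_norm_self (fun _ => p.2) _
  calc ∫ p, s.indicator (fun _ => p.2) (line t p) ∂γ
      = ∫ q, s.indicator (fun _ => q.2) q.1 ∂((γ.map (line t)) ⊗ₘ (velKernel γ).sectR t) := by
        rw [map_line_compProd, integral_map hpair.aemeasurable hmE.aestronglyMeasurable]
    _ = ∫ x, s.indicator (fun _ => meanVel γ t x) x ∂γ.map (line t) := by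
        rw [Measure.integral_compProd hint]
        refine integral_congr_ae (ae_of_all _ fun x => ?_)
        by_cases hx : x ∈ s
        · simp only [indicator_of_mem hx]; rfl
        · simp only [indicator_of_notMem hx, integral_zero]
    _ = _ := by
        rw [integral_map (measurable_line t).aemeasurable hmM.aestronglyMeasurable]

section
variable {W : Type*} [MeasurableSpace W] {Λ : Measure W} {R : W × ℝ × E d → ℝ≥0}
  {U : W × ℝ × E d → E d} (h : IsLineMixture Λ R U)
include h

/-- The triangle inequality bounds the momentum of the mixture by the mean momentum of the
components. -/
lemma IsLineMixture.locally_integrable (k : ℝ) :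
    ∫⁻ t in Icc (0 : ℝ) 1, ∫⁻ x in Metric.closedBall 0 k, ‖jointField Λ R U (t, x)‖ₑ
      ∂(volume.withDensity fun x => ENNReal.ofReal (jointDensity Λ R (t, x))) < ⊤ := by
  have := h.prob
  have hR := h.measurable_density
  have hD := measurable_jointDensity (Λ := Λ) hR
  have hV := measurable_jointField (Λ := Λ) hR h.measurable_field
  refine lt_of_le_of_lt ?_ ((h.lintegral_momentum_le k).trans_lt ENNReal.ofReal_lt_top)
  refine setLIntegral_mono_ae' measurableSet_Icc (ae_of_all _ fun t ht => ?_)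
  have hDt : Measurable fun x => ENNReal.ofReal (jointDensity Λ R (t, x)) := by fun_prop
  have hVt : Measurable fun x => ‖jointField Λ R U (t, x)‖ₑ := by fun_prop
  rw [setLIntegral_withDensity_eq_setLIntegral_mul _ hDt hVt measurableSet_closedBall]
  refine lintegral_mono_ae (ae_restrict_of_ae ?_)
  filter_upwards [h.ae_lintegral_lt_top ht] with x hx
  have h0 : 0 ≤ jointDensity Λ R (t, x) := integral_nonneg fun w => (R (w, t, x)).2
  calc ENNReal.ofReal (jointDensity Λ R (t, x)) * ‖jointField Λ R U (t, x)‖ₑ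
      = ‖∫ w, (R (w, t, x) : ℝ) • U (w, t, x) ∂Λ‖ₑ := by
        rw [← jointDensity_smul_jointField hR hx, enorm_smul, Real.enorm_of_nonneg h0]
    _ ≤ ∫⁻ w, ‖(R (w, t, x) : ℝ) • U (w, t, x)‖ₑ ∂Λ := enorm_integral_le_lintegral_enorm _
    _ = ∫⁻ w, R (w, t, x) * ‖U (w, t, x)‖ₑ ∂Λ := by simp [enorm_smul]

/-- For a mixture of finite mean energy, the mixture velocity is the conditional mean velocity of
the mixture of the lines. -/
lemma IsLineMixture.jointField_eq_meanVel [IsProbabilityMeasure (mixLine Λ R U)]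
    (hγ : ∫⁻ p, ‖p.2‖ₑ ^ 2 ∂mixLine Λ R U < ⊤) :
    ∀ᵐ t ∂volume.restrict (Icc (0 : ℝ) 1), ∀ᵐ p ∂mixLine Λ R U,
      jointField Λ R U (t, line t p) = meanVel (mixLine Λ R U) t (line t p) := by
  have := h.prob
  have hV := measurable_jointField (Λ := Λ) h.measurable_density h.measurable_field
  set γ := mixLine Λ R U with hγdef
  have hm := measurable_meanVel γ
  have hφ : Measurable fun q : ℝ × E d × E d => (q.1, line q.1 q.2) :=
    measurable_fst.prodMk measurable_uncurry_line
  set lam : Measure ℝ := volume.restrict (Icc (0 : ℝ) 1) with hlam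
  have hv1 : ∫⁻ p, ‖p.2‖ₑ ∂γ < ⊤ := ((memLp_snd hγ).integrable (by norm_num)).2
  have hΦm : ∀ s : Set (ℝ × E d), MeasurableSet s → Measurable fun z : (ℝ × E d) × E d =>
      s.indicator (fun _ => ContinuousLinearMap.id ℝ (E d)) z.1 z.2 := fun s hs => by
    have e : (fun z : (ℝ × E d) × E d =>
        s.indicator (fun _ => ContinuousLinearMap.id ℝ (E d)) z.1 z.2) =
        (Prod.fst ⁻¹' s).indicator fun z => z.2 := by
      funext z
      by_cases hz : z.1 ∈ s
      · rw [indicator_of_mem hz, indicator_of_mem (show z ∈ Prod.fst ⁻¹' s from hz)]; rfl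
      · rw [indicator_of_notMem hz, indicator_of_notMem (show z ∉ Prod.fst ⁻¹' s from hz)]; rfl
    rw [e]
    exact measurable_snd.indicator (measurable_fst hs)
  have happ : ∀ (s : Set (ℝ × E d)) (q : ℝ × E d) (v : E d),
      s.indicator (fun _ => ContinuousLinearMap.id ℝ (E d)) q v = s.indicator (fun _ => v) q :=
    fun s q v => by by_cases hq : q ∈ s <;> simp [hq]
  -- Testing with indicators of space-time sets: the mixture velocity has the same integrals as the
  -- velocity of the lines. `meanVel` has this property too, which identifies the two fields.
  have hI := fun (s : Set (ℝ × E d)) (hs : MeasurableSet s) =>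
    h.integral_jointField (s.indicator fun _ => ContinuousLinearMap.id ℝ (E d)) (hΦm s hs) (by
      calc _ ≤ ∫⁻ _ in Icc (0 : ℝ) 1, ∫⁻ p, ‖p.2‖ₑ ∂γ := by
            refine lintegral_mono fun t => lintegral_mono fun p => ?_
            rw [happ]
            exact enorm_indicator_le_enorm_self (fun _ => p.2) _
        _ < ⊤ := by simpa using hv1)
  simp only [happ] at hI
  have hVi : Integrable (jointField Λ R U) ((lam.prod γ).map fun q => (q.1, line q.1 q.2)) := by
    rw [integrable_map_measure hV.aestronglyMeasurable hφ.aemeasurable]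
    have := (hI univ .univ).1
    simp only [indicator_univ] at this
    exact this
  have hmi' : Integrable (fun q : ℝ × E d × E d => meanVel γ q.1 (line q.1 q.2)) (lam.prod γ) := by
    refine ⟨(measurable_meanVel_line γ).aestronglyMeasurable, ?_⟩
    rw [hasFiniteIntegral_iff_enorm, lintegral_prod _
      (measurable_meanVel_line γ).enorm.aemeasurable]
    calc _ ≤ ∫⁻ _, (1 + ∫⁻ p, ‖p.2‖ₑ ^ 2 ∂γ) ∂lam := lintegral_mono fun t => lintegral_meanVel_le t
      _ < ⊤ := by simp [hlam, hγ]
  have hmi : Integrable (Function.uncurry (meanVel γ))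
      ((lam.prod γ).map fun q => (q.1, line q.1 q.2)) := by
    rw [integrable_map_measure hm.aestronglyMeasurable hφ.aemeasurable]
    exact hmi'
  have hset : ∀ (f : ℝ × E d → E d), Measurable f → ∀ s, MeasurableSet s →
      ∫ q in s, f q ∂((lam.prod γ).map fun q => (q.1, line q.1 q.2)) =
      ∫ q : ℝ × E d × E d, s.indicator (fun _ => f (q.1, line q.1 q.2)) (q.1, line q.1 q.2)
        ∂lam.prod γ := fun f hf s hs => by
    rw [← integral_indicator hs, integral_map hφ.aemeasurable
      (hf.indicator hs).aestronglyMeasurable]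
    rfl
  have heq : jointField Λ R U =ᵐ[(lam.prod γ).map fun q => (q.1, line q.1 q.2)]
      Function.uncurry (meanVel γ) := by
    refine Integrable.ae_eq_of_forall_setIntegral_eq _ _ hVi hmi fun s hs _ => ?_
    obtain ⟨-, hi2, heq⟩ := hI s hs
    rw [hset _ hV s hs, hset _ hm s hs, heq, integral_prod _ hi2]
    have hmi2 : Integrable (fun q : ℝ × E d × E d => s.indicator
        (fun _ => Function.uncurry (meanVel γ) (q.1, line q.1 q.2)) (q.1, line q.1 q.2))
        (lam.prod γ) := hmi'.indicator (hφ hs)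
    rw [integral_prod _ hmi2]
    refine integral_congr_ae (ae_of_all _ fun t => ?_)
    exact integral_smul_meanVel hγ t (s := Prod.mk t ⁻¹' s) (measurable_prodMk_left hs)
  have h2 := ae_of_ae_map hφ.aemeasurable heq
  exact Measure.ae_ae_of_ae_prod h2

end

/-! ### The continuity equation. -/

/-- The derivative of a test function, switched off after time `t`. -/
def cutGrad (ψ : E d → ℝ) (t : ℝ) (q : ℝ × E d) : E d →L[ℝ] ℝ :=
  (Ioc 0 t).indicator (fun _ => fderiv ℝ ψ q.2) q.1

lemma cutGrad_apply (ψ : E d → ℝ) (t s : ℝ) (x v : E d) :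
    cutGrad ψ t (s, x) v = (Ioc 0 t).indicator (fun _ => fderiv ℝ ψ x v) s := by
  by_cases hs : s ∈ Ioc 0 t <;> simp [cutGrad, hs]

lemma measurable_cutGrad {ψ : E d → ℝ} (hψ : ContDiff ℝ ∞ ψ) (t : ℝ) :
    Measurable fun z : (ℝ × E d) × E d => cutGrad ψ t z.1 z.2 := by
  have hdψ : Continuous (fderiv ℝ ψ) := hψ.continuous_fderiv (by simp)
  have e : (fun z : (ℝ × E d) × E d => cutGrad ψ t z.1 z.2) =
      {z : (ℝ × E d) × E d | z.1.1 ∈ Ioc 0 t}.indicator fun z => fderiv ℝ ψ z.1.2 z.2 := by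
    funext z
    exact cutGrad_apply _ _ _ _ _
  rw [e]
  refine Measurable.indicator ?_ ?_
  · exact ((hdψ.comp (by fun_prop : Continuous fun z : (ℝ × E d) × E d => z.1.2)).clm_apply
      continuous_snd).measurable
  · exact (by fun_prop : Measurable fun z : (ℝ × E d) × E d => z.1.1) measurableSet_Ioc

/-- The derivative of a test function is bounded and supported in a ball, which reduces the flux to
the crossing estimate and requires no moment of the velocity. -/
lemma exists_enorm_cutGrad_le {ψ : E d → ℝ} (hψ : ContDiff ℝ ∞ ψ) (hψc : HasCompactSupport ψ)
    (t : ℝ) : ∃ C k : ℝ, ∀ (s : ℝ) (x v : E d), ‖cutGrad ψ t (s, x) v‖ₑ ≤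
      ENNReal.ofReal C * (Metric.closedBall (0 : E d) k).indicator (fun _ => ‖v‖ₑ) x := by
  have hdψ : Continuous (fderiv ℝ ψ) := hψ.continuous_fderiv (by simp)
  have hsupp := hψc.fderiv ℝ
  obtain ⟨C, hC⟩ := hsupp.exists_bound_of_continuous hdψ
  have hC0 : 0 ≤ C := (norm_nonneg _).trans (hC 0)
  obtain ⟨k, hk⟩ := hsupp.isCompact.isBounded.subset_closedBall (0 : E d)
  refine ⟨C, k, fun s x v => ?_⟩
  rw [cutGrad_apply]
  by_cases hx : x ∈ Metric.closedBall (0 : E d) k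
  · rw [indicator_of_mem hx]
    refine (enorm_indicator_le_enorm_self _ _).trans ?_
    rw [← ofReal_norm, ← ofReal_norm, ← ENNReal.ofReal_mul hC0]
    refine ENNReal.ofReal_le_ofReal ((ContinuousLinearMap.le_opNorm _ _).trans ?_)
    gcongr
    exact hC _
  · have h0 : fderiv ℝ ψ x = 0 := by
      by_contra h1
      exact hx (hk (subset_tsupport _ h1))
    simp [h0]

lemma lintegral_cutGrad_lt_top {ψ : E d → ℝ} (hψ : ContDiff ℝ ∞ ψ) (hψc : HasCompactSupport ψ)
    (t : ℝ) (γ : Measure (E d × E d)) [IsProbabilityMeasure γ] :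
    ∫⁻ s in Icc (0 : ℝ) 1, ∫⁻ p, ‖cutGrad ψ t (s, line s p) p.2‖ₑ ∂γ < ⊤ := by
  obtain ⟨C, k, hbound⟩ := exists_enorm_cutGrad_le hψ hψc t
  set G : E d → E d → ℝ≥0∞ := fun x v =>
    (Metric.closedBall (0 : E d) k).indicator (fun _ => ‖v‖ₑ) x with hG
  have hind : Measurable fun q : ℝ × E d × E d => G (line q.1 q.2) q.2.2 := by
    have e : (fun q : ℝ × E d × E d => G (line q.1 q.2) q.2.2) =
        {q : ℝ × E d × E d | line q.1 q.2 ∈ Metric.closedBall (0 : E d) k}.indicator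
          fun q => ‖q.2.2‖ₑ := rfl
    rw [e]
    exact Measurable.indicator (by fun_prop) (measurable_uncurry_line measurableSet_closedBall)
  have hcross : ∀ p : E d × E d, ∫⁻ s in Icc (0 : ℝ) 1, G (line s p) p.2 ≤ ENNReal.ofReal (2 * k) :=
    fun p => lintegral_crossing_le k p
  have hbound' : ∀ (s : ℝ) (x v : E d), ‖cutGrad ψ t (s, x) v‖ₑ ≤ ENNReal.ofReal C * G x v := hbound
  clear_value G
  have h1 : ∫⁻ s in Icc (0 : ℝ) 1, ∫⁻ p, G (line s p) p.2 ∂γ ≤ ENNReal.ofReal (2 * k) := by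
    rw [lintegral_lintegral_swap (f := fun s p => G (line s p) p.2) hind.aemeasurable]
    calc _ ≤ ∫⁻ _, ENNReal.ofReal (2 * k) ∂γ := lintegral_mono hcross
      _ = _ := by rw [lintegral_const, measure_univ, mul_one]
  calc ∫⁻ s in Icc (0 : ℝ) 1, ∫⁻ p, ‖cutGrad ψ t (s, line s p) p.2‖ₑ ∂γ
      ≤ ∫⁻ s in Icc (0 : ℝ) 1, ∫⁻ p, ENNReal.ofReal C * G (line s p) p.2 ∂γ :=
        lintegral_mono fun s => lintegral_mono fun p => hbound' s _ _
    _ = ∫⁻ s in Icc (0 : ℝ) 1, ENNReal.ofReal C * ∫⁻ p, G (line s p) p.2 ∂γ :=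
        lintegral_congr fun s => lintegral_const_mul' _ _ ENNReal.ofReal_ne_top
    _ = ENNReal.ofReal C * ∫⁻ s in Icc (0 : ℝ) 1, ∫⁻ p, G (line s p) p.2 ∂γ :=
        lintegral_const_mul' _ _ ENNReal.ofReal_ne_top
    _ < ⊤ := ENNReal.mul_lt_top ENNReal.ofReal_lt_top (h1.trans_lt ENNReal.ofReal_lt_top)

lemma setIntegral_Icc_indicator_Ioc (g : ℝ → ℝ) {t : ℝ} (ht : t ∈ Icc (0 : ℝ) 1) :
    ∫ s in Icc (0 : ℝ) 1, (Ioc 0 t).indicator g s = ∫ s in (0 : ℝ)..t, g s := by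
  rw [setIntegral_indicator measurableSet_Ioc, inter_eq_right.2
    (Ioc_subset_Icc_self.trans (Icc_subset_Icc_right ht.2)),
    intervalIntegral.integral_of_le ht.1]

lemma integral_cutGrad_line {ψ : E d → ℝ} (hψ : ContDiff ℝ ∞ ψ) {t : ℝ} (ht : t ∈ Icc (0 : ℝ) 1)
    (p : E d × E d) :
    ∫ s in Icc (0 : ℝ) 1, cutGrad ψ t (s, line s p) p.2 = ψ (line t p) - ψ (line 0 p) := by
  have hdψ : Continuous (fderiv ℝ ψ) := hψ.continuous_fderiv (by simp)
  have hline : ∀ s, HasDerivAt (fun s => line s p) p.2 s := fun s => by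
    have := ((hasDerivAt_id s).smul_const p.2).const_add p.1
    simpa [line] using this
  have hcl : Continuous fun s => line s p :=
    continuous_uncurry_line.comp (by fun_prop : Continuous fun s : ℝ => (s, p))
  have hder : ∀ s, HasDerivAt (fun s => ψ (line s p)) (fderiv ℝ ψ (line s p) p.2) s :=
    fun s => ((hψ.differentiable (by simp)) (line s p)).hasFDerivAt.comp_hasDerivAt s (hline s)
  have hci : Continuous fun s => fderiv ℝ ψ (line s p) p.2 :=
    (hdψ.comp hcl).clm_apply continuous_const
  rw [← intervalIntegral.integral_eq_sub_of_hasDerivAt (fun s _ => hder s)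
    (hci.intervalIntegrable 0 t), ← setIntegral_Icc_indicator_Ioc _ ht]
  refine integral_congr_ae (ae_of_all _ fun s => ?_)
  simp only [cutGrad_apply]
  rfl

lemma integral_cutGrad_field {ψ : E d → ℝ} (hψ : ContDiff ℝ ∞ ψ) {V : ℝ × E d → E d}
    (hV : Measurable V) (γ : Measure (E d × E d)) {t : ℝ} (ht : t ∈ Icc (0 : ℝ) 1) :
    ∫ s in Icc (0 : ℝ) 1, ∫ p, cutGrad ψ t (s, line s p) (V (s, line s p)) ∂γ =
      ∫ s in (0 : ℝ)..t, ∫ x, fderiv ℝ ψ x (V (s, x)) ∂γ.map (line s) := by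
  have hdψ : Continuous (fderiv ℝ ψ) := hψ.continuous_fderiv (by simp)
  rw [← setIntegral_Icc_indicator_Ioc _ ht]
  refine integral_congr_ae (ae_of_all _ fun s => ?_)
  simp only [cutGrad_apply]
  by_cases hs : s ∈ Ioc 0 t
  · have hm : Measurable fun x => fderiv ℝ ψ x (V (s, x)) := by
      have h1 : Continuous fun z : E d × E d => fderiv ℝ ψ z.1 z.2 :=
        (hdψ.comp continuous_fst).clm_apply continuous_snd
      exact h1.measurable.comp (measurable_id.prodMk (hV.comp measurable_prodMk_left))
    simp only [indicator_of_mem hs]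
    rw [integral_map (measurable_line s).aemeasurable hm.aestronglyMeasurable]
  · simp only [indicator_of_notMem hs, integral_zero]

lemma integral_map_line_sub {ψ : E d → ℝ} (hψ : Continuous ψ) (hψc : HasCompactSupport ψ)
    (γ : Measure (E d × E d)) [IsProbabilityMeasure γ] (s t : ℝ) :
    ∫ x, ψ x ∂γ.map (line t) - ∫ x, ψ x ∂γ.map (line s) =
      ∫ p, (ψ (line t p) - ψ (line s p)) ∂γ := by
  obtain ⟨B, hB⟩ := hψc.exists_bound_of_continuous hψ
  have hψi : ∀ s, Integrable (fun p => ψ (line s p)) γ := fun s =>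
    Integrable.of_bound (hψ.measurable.comp (measurable_line s)).aestronglyMeasurable B
      (ae_of_all _ fun p => hB _)
  rw [integral_map (measurable_line t).aemeasurable hψ.aestronglyMeasurable,
    integral_map (measurable_line s).aemeasurable hψ.aestronglyMeasurable,
    ← integral_sub (hψi t) (hψi s)]

/-- Along each line the increment of ψ is the integral of its derivative in the direction of the
line. After averaging over the lines, their velocity may be replaced by the mixture velocity, as the
integrand is linear in it. -/
lemma IsLineMixture.continuity_equation {W : Type*} [MeasurableSpace W] {Λ : Measure W}
    {R : W × ℝ × E d → ℝ≥0} {U : W × ℝ × E d → E d} (h : IsLineMixture Λ R U) {ψ : E d → ℝ}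
    (hψ : ContDiff ℝ ∞ ψ) (hψc : HasCompactSupport ψ) {t : ℝ} (ht : t ∈ Icc (0 : ℝ) 1) :
    ∫ x, ψ x ∂(mixLine Λ R U).map (line t) - ∫ x, ψ x ∂(mixLine Λ R U).map (line 0) =
      ∫ s in (0 : ℝ)..t, ∫ x, fderiv ℝ ψ x (jointField Λ R U (s, x))
        ∂(mixLine Λ R U).map (line s) := by
  have := h.prob
  have := h.isProbabilityMeasure
  have hV := measurable_jointField (Λ := Λ) h.measurable_density h.measurable_field
  obtain ⟨hi1, hi2, heq⟩ := h.integral_jointField (F := ℝ) (cutGrad ψ t) (measurable_cutGrad hψ t)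
    (lintegral_cutGrad_lt_top hψ hψc t _)
  rw [integral_map_line_sub hψ.continuous hψc, ← integral_cutGrad_field hψ hV _ ht]
  calc ∫ p, (ψ (line t p) - ψ (line 0 p)) ∂mixLine Λ R U
      = ∫ p, (∫ s in Icc (0 : ℝ) 1, cutGrad ψ t (s, line s p) p.2) ∂mixLine Λ R U :=
        integral_congr_ae (ae_of_all _ fun p => (integral_cutGrad_line hψ ht p).symm)
    _ = _ := (integral_prod_symm _ hi2).symm
    _ = _ := heq.symm
    _ = _ := integral_prod _ hi1

/-! ### Boundary laws and feasibility of the mixture. -/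

/-- Mixing a kernel that depends only on the first coordinate only involves the first marginal. -/
lemma bind_eq_bind_map_fst {A B Ω : Type*} [MeasurableSpace A] [MeasurableSpace B]
    [StandardBorelSpace B] [Nonempty B] [MeasurableSpace Ω] {Λ : Measure (A × B)}
    [IsProbabilityMeasure Λ] {h : A × B → Measure Ω} (hh : Measurable h) {g : A → Measure Ω}
    (hg : ∀ᵐ w ∂Λ, h w = g w.1) : Λ.bind h = (Λ.map Prod.fst).bind g := by
  have hdis : Λ.fst ⊗ₘ Λ.condKernel = Λ := Λ.disintegrate _
  have hg' : ∀ᵐ a ∂Λ.fst, ∀ᵐ b ∂Λ.condKernel a, h (a, b) = g a := by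
    rw [← hdis] at hg
    exact Measure.ae_ae_of_ae_compProd hg
  -- Measurability of g is not assumed. The average of h over the conditional law of the second
  -- coordinate is a measurable version of it.
  have hk : Measurable fun a => (Λ.condKernel a).bind fun b => h (a, b) := by
    refine Measure.measurable_of_measurable_coe _ fun s hs => ?_
    have e : ∀ a, (Λ.condKernel a).bind (fun b => h (a, b)) s =
        ∫⁻ b, h (a, b) s ∂Λ.condKernel a := fun a =>
      Measure.bind_apply hs (hh.comp measurable_prodMk_left).aemeasurable
    simp only [e]
    have hs' : Measurable fun w => h w s := (Measure.measurable_coe hs).comp hh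
    exact hs'.lintegral_kernel_prod_right'
  have hgm : AEMeasurable g Λ.fst := by
    refine ⟨_, hk, ?_⟩
    filter_upwards [hg'] with a ha
    refine Measure.ext fun s hs => ?_
    have hha : Measurable fun b => h (a, b) := hh.comp measurable_prodMk_left
    rw [Measure.bind_apply hs hha.aemeasurable,
      lintegral_congr_ae (g := fun _ => g a s) (ha.mono fun b hb => by simp only [hb])]
    simp
  change _ = Λ.fst.bind g
  refine Measure.ext fun s hs => ?_
  have hs' : Measurable fun w => h w s := (Measure.measurable_coe hs).comp hh
  rw [Measure.bind_apply hs hh.aemeasurable, Measure.bind_apply hs hgm]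
  nth_rewrite 1 [← hdis]
  rw [Measure.lintegral_compProd hs']
  refine lintegral_congr_ae ?_
  filter_upwards [hg'] with a ha
  rw [lintegral_congr_ae (g := fun _ => g a s) (ha.mono fun b hb => by simp only [hb])]
  simp

lemma bind_eq_bind_map_snd {A B Ω : Type*} [MeasurableSpace A] [MeasurableSpace B]
    [StandardBorelSpace A] [Nonempty A] [MeasurableSpace Ω] {Λ : Measure (A × B)}
    [IsProbabilityMeasure Λ] {h : A × B → Measure Ω} (hh : Measurable h) {g : B → Measure Ω}
    (hg : ∀ᵐ w ∂Λ, h w = g w.2) : Λ.bind h = (Λ.map Prod.snd).bind g := by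
  have : IsProbabilityMeasure (Λ.map Prod.swap) :=
    Measure.isProbabilityMeasure_map measurable_swap.aemeasurable
  have hsw : ∀ᵐ w ∂Λ.map Prod.swap, h w.swap = g w.1 :=
    (MeasurableEquiv.prodComm.measurableEmbedding.ae_map_iff (μ := Λ)
      (p := fun w : B × A => h w.swap = g w.1)).2 hg
  have h1 := bind_eq_bind_map_fst (hh.comp measurable_swap) hsw
  rw [Measure.map_map measurable_fst measurable_swap] at h1
  refine Eq.trans ?_ h1
  refine Measure.ext fun s hs => ?_
  have hs' : Measurable fun w : B × A => h w.swap s :=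
    (Measure.measurable_coe hs).comp (hh.comp measurable_swap)
  rw [Measure.bind_apply hs hh.aemeasurable,
    Measure.bind_apply hs (hh.comp measurable_swap).aemeasurable]
  exact (lintegral_map hs' measurable_swap).symm

section
variable {W : Type*} [MeasurableSpace W] {Λ : Measure W} {R : W × ℝ × E d → ℝ≥0}
  {U : W × ℝ × E d → E d}

lemma measurable_densityLaw (hR : Measurable R) (t : ℝ) :
    Measurable fun w => densityLaw fun x => R (w, t, x) := by
  refine Measure.measurable_of_measurable_coe _ fun s hs => ?_
  simp only [densityLaw, withDensity_apply _ hs]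
  have : Measurable fun q : W × E d => (R (q.1, t, q.2) : ℝ≥0∞) := by fun_prop
  exact this.lintegral_prod_right'

/-- The mixture density is the density of the mixture of the laws. -/
lemma IsLineMixture.bind_densityLaw (h : IsLineMixture Λ R U) {t : ℝ} (ht : t ∈ Icc (0 : ℝ) 1) :
    (Λ.bind fun w => densityLaw fun x => R (w, t, x)) = (mixLine Λ R U).map (line t) := by
  have hR := h.measurable_density
  refine Measure.ext_of_lintegral _ fun G hG => ?_
  rw [lintegral_map hG (measurable_line t), ← lintegral_mixLine_law hR h.measurable_field h.flow
    hG ht, Measure.lintegral_bind (measurable_densityLaw hR t).aemeasurable hG.aemeasurable]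
  refine lintegral_congr fun w => ?_
  rw [densityLaw, lintegral_withDensity_eq_lintegral_mul _ (by fun_prop) hG]
  rfl

/-- A measurable family of solutions of bridge problems is a mixture of flows along lines, and the
mean squared speed of the lines is at most the energy. -/
lemma isLineMixture_of_solvesBridge [IsProbabilityMeasure Λ] (hR : Measurable R)
    (hU : Measurable U) {ν₀ ν₁ : W → Measure (E d)}
    (h : ∀ᵐ w ∂Λ, SolvesBridge (ν₀ w) (ν₁ w) (fun t x => U (w, t, x))
      fun t => densityLaw fun x => R (w, t, x)) :
    IsLineMixture Λ R U ∧ ∀ᵐ w ∂Λ, ∫⁻ p, ‖p.2‖ₑ ^ 2 ∂lineLaw R U w ≤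
      energy (fun t x => U (w, t, x)) fun t => densityLaw fun x => R (w, t, x) := by
  have key : ∀ᵐ w ∂Λ, IsLineFlow (fun t x => R (w, t, x)) (fun t x => U (w, t, x)) (lineLaw R U w) ∧
      ∫⁻ p, ‖p.2‖ₑ ^ 2 ∂lineLaw R U w ≤
      energy (fun t x => U (w, t, x)) fun t => densityLaw fun x => R (w, t, x) := by
    filter_upwards [h] with w hw
    obtain ⟨γ, h1, h2, h3, h4⟩ := hw.exists_line
    have h5 : IsLineFlow (fun t x => R (w, t, x)) (fun t x => U (w, t, x)) γ := ⟨h1, h2, h3⟩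
    rw [h5.eq_lineLaw hR hU]
    exact ⟨h5, h4⟩
  exact ⟨⟨inferInstance, hR, hU, key.mono fun w hw => hw.1⟩, key.mono fun w hw => hw.2⟩

lemma IsLineMixture.solvesContinuityEquation (h : IsLineMixture Λ R U) :
    SolvesContinuityEquation (fun t x => jointField Λ R U (t, x))
      fun t => volume.withDensity fun x => ENNReal.ofReal (jointDensity Λ R (t, x)) := by
  refine ⟨fun k => h.locally_integrable k, fun ψ hψ hψc t ht => ?_⟩
  have h0 : (0 : ℝ) ∈ Icc (0 : ℝ) 1 := ⟨le_rfl, zero_le_one⟩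
  simp only [h.withDensity_eq ht, h.withDensity_eq h0, h.continuity_equation hψ hψc ht]
  refine intervalIntegral.integral_congr fun s hs => ?_
  rw [uIcc_of_le ht.1] at hs
  simp only [h.withDensity_eq ⟨hs.1, hs.2.trans ht.2⟩]

/-- Once the mixture velocity is a conditional mean, Jensen bounds its cost by the mean squared
speed of the lines. -/
lemma IsLineMixture.energy_lt_top (h : IsLineMixture Λ R U)
    (hγ : ∫⁻ p, ‖p.2‖ₑ ^ 2 ∂mixLine Λ R U < ⊤) :
    energy (fun t x => jointField Λ R U (t, x))
      (fun t => volume.withDensity fun x => ENNReal.ofReal (jointDensity Λ R (t, x))) < ⊤ := by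
  have := h.prob
  have := h.isProbabilityMeasure
  have hV := measurable_jointField (Λ := Λ) h.measurable_density h.measurable_field
  refine lt_of_le_of_lt ?_ hγ
  calc _ ≤ ∫⁻ _ in Icc (0 : ℝ) 1, ∫⁻ p, ‖p.2‖ₑ ^ 2 ∂mixLine Λ R U := by
        refine lintegral_mono_ae ?_
        filter_upwards [h.jointField_eq_meanVel hγ, ae_restrict_mem measurableSet_Icc] with t h1 ht
        rw [h.withDensity_eq ht, lintegral_map (by fun_prop) (measurable_line t),
          lintegral_congr_ae (h1.mono fun p hp => by rw [hp])]
        exact lintegral_meanVel_sq_le _ t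
    _ = _ := by simp

lemma IsLineMixture.produces (h : IsLineMixture Λ R U)
    (hγ : ∫⁻ p, ‖p.2‖ₑ ^ 2 ∂mixLine Λ R U < ⊤) :
    Produces (fun t x => jointField Λ R U (t, x))
      fun t => volume.withDensity fun x => ENNReal.ofReal (jointDensity Λ R (t, x)) := by
  have := h.prob
  have := h.isProbabilityMeasure
  have hV : Measurable (jointField Λ R U) :=
    measurable_jointField h.measurable_density h.measurable_field
  exact produces_of_ae_eq_meanVel (b := fun t x => jointField Λ R U (t, x)) hγ hV
    (h.jointField_eq_meanVel hγ) fun t ht => h.withDensity_eq ht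

end

end GMMBridge

end

theorem theorem5 (d m : ℕ)
    -- boundary data: Gaussian parameters and mixing measures
    (μ₀ μ₁ : E m → E d) (S₀ S₁ : E m → Matrix (Fin d) (Fin d) ℝ)
    (hμ₀ : Measurable μ₀) (hμ₁ : Measurable μ₁)
    (hS₀ : ∀ i j, Measurable fun w => S₀ w i j)
    (hS₁ : ∀ i j, Measurable fun w => S₁ w i j)
    (P₀ P₁ : Measure (E m)) [IsProbabilityMeasure P₀] [IsProbabilityMeasure P₁]
    (hpos₀ : ∀ᵐ w ∂P₀, (S₀ w).PosDef) (hpos₁ : ∀ᵐ w ∂P₁, (S₁ w).PosDef)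
    -- the coupling
    (Λ : Measure (E m × E m)) (hΛ₀ : Λ.map Prod.fst = P₀) (hΛ₁ : Λ.map Prod.snd = P₁)
    -- the conditional policies and the densities of their flows
    (u : ℝ → E m → E m → E d → E d) (r : ℝ → E m → E m → E d → ℝ≥0)
    (hu : Measurable fun q : ℝ × E m × E m × E d => u q.1 q.2.1 q.2.2.1 q.2.2.2)
    (hr : Measurable fun q : ℝ × E m × E m × E d => r q.1 q.2.1 q.2.2.1 q.2.2.2)
    (hbridge : ∀ᵐ w ∂Λ, SolvesBridge
      (multivariateGaussian (μ₀ w.1) (S₀ w.1)) (multivariateGaussian (μ₁ w.2) (S₁ w.2))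
      (fun t => u t w.1 w.2) (fun t => densityLaw (r t w.1 w.2))) :
    -- the integrals that define the mixture flow and the mixture policy converge
    (∀ t ∈ Icc (0 : ℝ) 1, ∀ᵐ x : E d, Integrable (fun w => (r t w.1 w.2 x : ℝ)) Λ) ∧
    (∀ᵐ t ∂(volume.restrict (Icc (0 : ℝ) 1)), ∀ᵐ x : E d,
      Integrable (fun w => (r t w.1 w.2 x : ℝ) • u t w.1 w.2 x) Λ) ∧
    -- the mixture flow consists of probability laws and has the required boundary laws
    (∀ t ∈ Icc (0 : ℝ) 1, IsProbabilityMeasure (mixFlow (d := d) Λ r t)) ∧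
    mixFlow Λ r 0 = gaussianMixture P₀ μ₀ S₀ ∧
    mixFlow Λ r 1 = gaussianMixture P₁ μ₁ S₁ ∧
    -- the mixture policy transports the mixture flow
    SolvesContinuityEquation (mixPolicy Λ r u) (mixFlow Λ r) ∧
    -- if the mean conditional cost is finite, the mixture policy is feasible, with the mixture flow
    (∫⁻ w, energy (fun t => u t w.1 w.2) (fun t => densityLaw (r t w.1 w.2)) ∂Λ < ⊤ →
      IsFeasible (gaussianMixture P₀ μ₀ S₀) (gaussianMixture P₁ μ₁ S₁)
        (mixPolicy Λ r u) (mixFlow Λ r)) := by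
  have : IsProbabilityMeasure Λ := by
    refine ⟨?_⟩
    have h1 := Measure.map_apply (μ := Λ) measurable_fst (MeasurableSet.univ (α := E m))
    rw [hΛ₀, measure_univ, preimage_univ] at h1
    exact h1.symm
  set R : (E m × E m) × ℝ × E d → ℝ≥0 := fun q => r q.2.1 q.1.1 q.1.2 q.2.2 with hRdef
  set U : (E m × E m) × ℝ × E d → E d := fun q => u q.2.1 q.1.1 q.1.2 q.2.2 with hUdef
  have hcoord : Measurable fun q : (E m × E m) × ℝ × E d => (q.2.1, q.1.1, q.1.2, q.2.2) := by
    fun_prop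
  have hR : Measurable R := hr.comp hcoord
  have hU : Measurable U := hu.comp hcoord
  obtain ⟨h, henergy⟩ := isLineMixture_of_solvesBridge (Λ := Λ) hR hU hbridge
  have hflow : ∀ t, mixFlow Λ r t =
      volume.withDensity fun x => ENNReal.ofReal (jointDensity Λ R (t, x)) := fun t => rfl
  have hmem₀ : (0 : ℝ) ∈ Icc (0 : ℝ) 1 := ⟨le_rfl, zero_le_one⟩
  have hmem₁ : (1 : ℝ) ∈ Icc (0 : ℝ) 1 := ⟨zero_le_one, le_rfl⟩
  have hprob := h.isProbabilityMeasure
  have hinit : mixFlow Λ r 0 = gaussianMixture P₀ μ₀ S₀ := by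
    rw [hflow, h.withDensity_eq hmem₀, ← h.bind_densityLaw hmem₀, gaussianMixture, ← hΛ₀]
    -- The initial law of a component depends on the first parameter only, so the coupling enters
    -- through its first marginal.
    exact bind_eq_bind_map_fst (measurable_densityLaw hR 0) (hbridge.mono fun w hw => hw.1.initial)
  have hterm : mixFlow Λ r 1 = gaussianMixture P₁ μ₁ S₁ := by
    rw [hflow, h.withDensity_eq hmem₁, ← h.bind_densityLaw hmem₁, gaussianMixture, ← hΛ₁]
    exact bind_eq_bind_map_snd (measurable_densityLaw hR 1)
      (hbridge.mono fun w hw => hw.1.terminal)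
  refine ⟨fun t ht => ?_, ?_, fun t ht => ?_, hinit, hterm, h.solvesContinuityEquation,
    fun hfin => ?_⟩
  · filter_upwards [h.ae_lintegral_lt_top ht] with x hx
    exact (integrable_density_iff hR (t, x)).2 hx
  · filter_upwards [h.ae_momentum_lt_top] with t ht
    filter_upwards [ht] with x hx
    exact (integrable_momentum_iff hR hU (t, x)).2 hx
  · rw [hflow, h.withDensity_eq ht]
    exact Measure.isProbabilityMeasure_map (measurable_line t).aemeasurable
  -- The squared speed of the lines of a component has mean at most its energy, so finite mean
  -- energy supplies the second moment needed by the superposition principle.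
  · have hγ : ∫⁻ p, ‖p.2‖ₑ ^ 2 ∂mixLine Λ R U < ⊤ := by
      rw [lintegral_mixLine hR hU (by fun_prop)]
      exact (lintegral_mono_ae henergy).trans_lt hfin
    exact ⟨measurable_jointField (Λ := Λ) hR hU, h.produces hγ, hinit, hterm, h.energy_lt_top hγ⟩
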